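/- Fix real $\lambda_0$, $Z_1$, $Z_2$ and $0<b<c$. For $0<a<b$ let $\Gamma$ be the curve $$w^2=\big((\lambda-\lambda_0)^2+a^2\big)\big((\lambda-\lambda_0)^2+b^2\big)\big((\lambda-\lambda_0)^2+c^2\big),$$ with points at infinity $\mathcal P_\infty^\pm$ at which $w\sim\pm\lambda^3$. Let $a_1$ be the cycle around the segment $[\lambda_0-ia,\lambda_0+ia]$, and $a_2$ the cycle on one sheet around the two segments $[\lambda_0+ia,\lambda_0+ib]$ and $[\lambda_0-ib,\lambda_0-ia]$. Let $K_1,K_2$ be the constants in $$\Omega_1=\mp i(\lambda+K_1+O(\lambda^{-1})),\qquad \Omega_2=\mp i(2\lambda^2+K_2+O(\lambda^{-1})),\qquad \mathcal P\to\mathcal P_\infty^\pm,$$ where $\Omega_j$ is the Abelian integral of the second kind on $\Gamma$ with this behaviour at infinity and zero $a$-periods, integrated from the branch point $\lambda_0+ic$ along the ray $\lambda_0+i[c,\infty)$. Put $$A_+=\int_{a^2}^{b^2}\!\frac{d\tau}{\sqrt{(\tau-a^2)(b^2-\tau)(c^2-\tau)}},\quad B_+=\int_{b^2}^{c^2}\!\frac{d\tau}{\sqrt{(\tau-a^2)(\tau-b^2)(c^2-\tau)}},$$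 $$A_-=\int_0^{a^2}\!\frac{d\tau}{\sqrt{\tau(a^2-\tau)(b^2-\tau)(c^2-\tau)}},\quad B_-=\int_{a^2}^{b^2}\!\frac{d\tau}{\sqrt{\tau(\tau-a^2)(b^2-\tau)(c^2-\tau)}},$$ $$B_-^1=\int_{c^2}^{\infty}\!\frac{d\tau}{R(\tau)},\quad D_-=\frac12\int_0^{a^2}\!\frac{\tau\,d\tau}{\sqrt{\tau(a^2-\tau)(b^2-\tau)(c^2-\tau)}},\quad F_-=\frac12\int_{c^2}^\infty\Big(\frac{\tau}{R(\tau)}-\frac1\tau\Big)d\tau,$$ where $R(\tau)=\sqrt{\tau(\tau-a^2)(\tau-b^2)(\tau-c^2)}$, and $$\mathfrak b_\pm=\frac{B_\pm}{A_\pm},\quad \delta=\frac{B_-^1}{A_-},\quad K_0=ic\,e^{D_-\delta-F_-},\quad \kappa_1=\frac4{A_-},\quad k=\frac2{A_+},\quad \kappa_2=\frac{8\lambda_0}{A_+}.$$ With $\vartheta_3(u|\tau)=\sum_{n\in\mathbb Z}e^{\pi i\tau n^2+2\pi inu}$ and $\vartheta_2(u|\tau)=\sum_{n\in\mathbb Z}e^{\pi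 i\tau(n+1/2)^2+2\pi i(n+1/2)u}$ let $$H(u_1,u_2)=\vartheta_3(u_1|2i\mathfrak b_-)\vartheta_3(u_2|2i\mathfrak b_+)+\vartheta_2(u_1|2i\mathfrak b_-)\vartheta_3(u_2|2i\mathfrak b_+)+\vartheta_3(u_1|2i\mathfrak b_-)\vartheta_2(u_2|2i\mathfrak b_+)-\vartheta_2(u_1|2i\mathfrak b_-)\vartheta_2(u_2|2i\mathfrak b_+)$$ and consider the two-phase function $$p_a(x,t)=-2iK_0\frac{H(u_1+i\delta,u_2+1)}{H(u_1,u_2)}e^{2iK_1x+2iK_2t},\qquad u_1=\kappa_1t+2Z_1,\quad u_2=kx+\kappa_2t+2Z_2.$$ Then for every $0<a<b$ the constants $K_1,K_2$ exist and are unique; as $a\to0^+$, $K_1\to-\lambda_0$ and $K_2\to b^2+c^2-2\lambda_0^2$; and for all real $x,t$, $p_a(x,t)\to p_0(x,t)$, where, with $k,\kappa_2,\mathfrak b_+,A_+$ now evaluated at $a=0$, $$p_0(x,t)=\sqrt{c^2-b^2}\;\frac{\vartheta_3(u|2i\mathfrak b_+)-\vartheta_2(u|2i\mathfrak b_+)}{\vartheta_3(u|2i\mathfrak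 b_+)+\vartheta_2(u|2i\mathfrak b_+)}\;e^{-2i\lambda_0x+2i(b^2+c^2-2\lambda_0^2)t},\qquad u=kx+\kappa_2t+2Z_2 .$$ Moreover $$p_0(x,t)=A\,\mathrm{dn}\big(A(x+4\lambda_0t-x_0);\varkappa\big)\,e^{-2i\lambda_0x+2i(b^2+c^2-2\lambda_0^2)t}$$ with modulus $\varkappa=\dfrac{2\sqrt{bc}}{b+c}\in(0,1)$, $A=b+c=\sqrt{\dfrac{2(b^2+c^2)}{2-\varkappa^2}}$ and $x_0=\big(\tfrac12-Z_2\big)A_+$. The function $p_0$ is a classical solution of the focusing nonlinear Schrödinger equation $ip_t+p_{xx}+2|p|^2p=0$. -/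

import Mathlib

open Filter Topology Set Asymptotics

noncomputable section

namespace TwoPhaseNLS

/-! ### Jacobi theta functions -/

/-- `ϑ₃(u | τ) = ∑ₙ exp (π i τ n² + 2 π i n u) = 1 + 2 ∑_{m ≥ 1} h ^ (m²) cos (2 m π u)`,
with `h = exp (π i τ)`. -/
def theta3 (u τ : ℂ) : ℂ := jacobiTheta₂ u τ

/-- `ϑ₂(u | τ) = ∑ₙ exp (π i τ (n + 1/2)² + 2 π i (n + 1/2) u)
  = 2 ∑_{m ≥ 1} h ^ ((m - 1/2)²) cos ((2 m - 1) π u)`, with `h = exp (π i τ)`. -/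
def theta2 (u τ : ℂ) : ℂ :=
  Complex.exp (Real.pi * Complex.I * (τ / 4 + u)) * jacobiTheta₂ (u + τ / 2) τ

/-! ### Elliptic integrals attached to the branch points `lam0 ± i a`, `lam0 ± i b`, `lam0 ± i c` -/

def Aplus (a b c : ℝ) : ℝ :=
  ∫ t in (a ^ 2)..(b ^ 2), 1 / √((t - a ^ 2) * (b ^ 2 - t) * (c ^ 2 - t))

def Bplus (a b c : ℝ) : ℝ :=
  ∫ t in (b ^ 2)..(c ^ 2), 1 / √((t - a ^ 2) * (t - b ^ 2) * (c ^ 2 - t))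

def Aminus (a b c : ℝ) : ℝ :=
  ∫ t in (0 : ℝ)..(a ^ 2), 1 / √(t * (a ^ 2 - t) * (b ^ 2 - t) * (c ^ 2 - t))

def Bminus (a b c : ℝ) : ℝ :=
  ∫ t in (a ^ 2)..(b ^ 2), 1 / √(t * (t - a ^ 2) * (b ^ 2 - t) * (c ^ 2 - t))

def Bminus1 (a b c : ℝ) : ℝ :=
  ∫ t in Ioi (c ^ 2), 1 / √(t * (t - a ^ 2) * (t - b ^ 2) * (t - c ^ 2))

def Dminus (a b c : ℝ) : ℝ :=
  1 / 2 * ∫ t in (0 : ℝ)..(a ^ 2), t / √(t * (a ^ 2 - t) * (b ^ 2 - t) * (c ^ 2 - t))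

def Fminus (a b c : ℝ) : ℝ :=
  1 / 2 * ∫ t in Ioi (c ^ 2),
    (t / √(t * (t - a ^ 2) * (t - b ^ 2) * (t - c ^ 2)) - 1 / t)

def frbPlus (a b c : ℝ) : ℝ := Bplus a b c / Aplus a b c

def frbMinus (a b c : ℝ) : ℝ := Bminus a b c / Aminus a b c

def delta (a b c : ℝ) : ℝ := Bminus1 a b c / Aminus a b c

/-- `K₀ = i c exp (D₋ δ - F₋)`. -/
def K0 (a b c : ℝ) : ℂ :=
  Complex.I * c * Complex.exp ((Dminus a b c * delta a b c - Fminus a b c : ℝ) : ℂ)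

def kappa1 (a b c : ℝ) : ℝ := 4 / Aminus a b c

/-- The wave number `k = 2 / A₊`. -/
def waveNumber (a b c : ℝ) : ℝ := 2 / Aplus a b c

def kappa2 (a b c lam0 : ℝ) : ℝ := 8 * lam0 / Aplus a b c

/-! ### Normalized Abelian integrals on
`Γ : w² = ((λ - lam0)² + a²) ((λ - lam0)² + b²) ((λ - lam0)² + c²)`

A differential on `Γ` which is odd under `(w, λ) ↦ (-w, λ)` and whose only poles are at the two
points at infinity has the form `P(λ) dλ / w` with a polynomial `P`. -/

/-- Up to a nonzero constant factor, the period of `P(λ) dλ / w` over the cycle `a₁`, which encircles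
the segment `[lam0 - i a, lam0 + i a]`; for `λ = lam0 + i y` with `|y| < a` one has
`w = ± √((a² - y²) (b² - y²) (c² - y²))`. -/
def periodA1 (a b c lam0 : ℝ) (P : Polynomial ℂ) : ℂ :=
  ∫ y in (-a)..a, P.eval ((lam0 : ℂ) + Complex.I * y) /
    ((√((a ^ 2 - y ^ 2) * (b ^ 2 - y ^ 2) * (c ^ 2 - y ^ 2)) : ℝ) : ℂ)

/-- Up to a nonzero constant factor, the period of `P(λ) dλ / w` over the cycle `a₂`, which on one
sheet encircles the two segments `[lam0 + i a, lam0 + i b]` and `[lam0 - i b, lam0 - i a]`. On the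
same side of both segments
`w = ± i √((y² - a²) (b² - y²) (c² - y²))` at `λ = lam0 + i y`, with opposite signs on the two. -/
def periodA2 (a b c lam0 : ℝ) (P : Polynomial ℂ) : ℂ :=
  ∫ y in a..b, (P.eval ((lam0 : ℂ) + Complex.I * y) - P.eval ((lam0 : ℂ) - Complex.I * y)) /
    ((√((y ^ 2 - a ^ 2) * (b ^ 2 - y ^ 2) * (c ^ 2 - y ^ 2)) : ℝ) : ℂ)

/-- The Abelian integral of `P(λ) dλ / w` from the branch point `lam0 + i c` along the ray
`λ = lam0 + i y`, `c ≤ y ≤ Y`, on the sheet where `w ∼ λ³` at infinity: there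
`w = -i √((y² - a²) (y² - b²) (y² - c²))`. On the other sheet it changes its sign. -/
def abelianIntegral (a b c lam0 : ℝ) (P : Polynomial ℂ) (Y : ℝ) : ℂ :=
  ∫ y in c..Y, P.eval ((lam0 : ℂ) + Complex.I * y) /
    (-Complex.I * ((√((y ^ 2 - a ^ 2) * (y ^ 2 - b ^ 2) * (y ^ 2 - c ^ 2)) : ℝ) : ℂ)) * Complex.I

/-- `K` is the constant in the expansion `Ω = ∓ i (f(λ) + K + O(λ⁻¹))` at the points at infinity,
for the Abelian integral `Ω` of the second kind with this principal part and zero `a`-periods. -/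
def IsAbelianConstant (a b c lam0 : ℝ) (f : ℂ → ℂ) (K : ℂ) : Prop :=
  ∃ P : Polynomial ℂ, periodA1 a b c lam0 P = 0 ∧ periodA2 a b c lam0 P = 0 ∧
    (fun Y : ℝ => abelianIntegral a b c lam0 P Y
        + Complex.I * (f ((lam0 : ℂ) + Complex.I * Y) + K)) =O[atTop] (fun Y : ℝ => Y⁻¹)

/-- `K₁`: the constant of `Ω₁ = ∓ i (λ + K₁ + O(λ⁻¹))`. -/
def IsK1 (a b c lam0 : ℝ) (K : ℂ) : Prop := IsAbelianConstant a b c lam0 (fun l => l) K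

/-- `K₂`: the constant of `Ω₂ = ∓ i (2 λ² + K₂ + O(λ⁻¹))`. -/
def IsK2 (a b c lam0 : ℝ) (K : ℂ) : Prop := IsAbelianConstant a b c lam0 (fun l => 2 * l ^ 2) K

/-! ### The two-phase solution and its one-phase limit -/

def H (a b c : ℝ) (u₁ u₂ : ℂ) : ℂ :=
  theta3 u₁ (2 * Complex.I * frbMinus a b c) * theta3 u₂ (2 * Complex.I * frbPlus a b c)
  + theta2 u₁ (2 * Complex.I * frbMinus a b c) * theta3 u₂ (2 * Complex.I * frbPlus a b c)
  + theta3 u₁ (2 * Complex.I * frbMinus a b c) * theta2 u₂ (2 * Complex.I * frbPlus a b c)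
  - theta2 u₁ (2 * Complex.I * frbMinus a b c) * theta2 u₂ (2 * Complex.I * frbPlus a b c)

/-- The two-phase solution, with initial phase `(Z₁, Z₂)`. -/
def twoPhase (a b c lam0 Z₁ Z₂ : ℝ) (K₁ K₂ : ℂ) (x t : ℝ) : ℂ :=
  let u₁ : ℂ := ((kappa1 a b c * t + 2 * Z₁ : ℝ) : ℂ);
  let u₂ : ℂ := ((waveNumber a b c * x + kappa2 a b c lam0 * t + 2 * Z₂ : ℝ) : ℂ);
  -2 * Complex.I * K0 a b c *
    (H a b c (u₁ + Complex.I * delta a b c) (u₂ + 1) / H a b c u₁ u₂) *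
    Complex.exp (2 * Complex.I * K₁ * x + 2 * Complex.I * K₂ * t)

/-- The one-phase wave
`√(c² - b²) (ϑ₃ - ϑ₂) / (ϑ₃ + ϑ₂) exp (2 i (K₁ x + K₂ t))`; the theta functions are taken at
`k x + κ₂ t + 2 Z₂` with parameter `2 i B₊ / A₊`, where `k`, `κ₂`, `A₊`, `B₊` are those at `a = 0`. -/
def onePhase (b c lam0 Z₂ : ℝ) (K₁ K₂ : ℂ) (x t : ℝ) : ℂ :=
  let u : ℂ := ((waveNumber 0 b c * x + kappa2 0 b c lam0 * t + 2 * Z₂ : ℝ) : ℂ);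
  let τ : ℂ := 2 * Complex.I * frbPlus 0 b c;
  (√(c ^ 2 - b ^ 2) : ℝ) * ((theta3 u τ - theta2 u τ) / (theta3 u τ + theta2 u τ)) *
    Complex.exp (2 * Complex.I * (K₁ * x + K₂ * t))

/-! ### The Jacobi function `dn` -/

/-- The incomplete elliptic integral of the first kind with modulus `k`. -/
def ellipticF (k φ : ℝ) : ℝ := ∫ θ in (0 : ℝ)..φ, 1 / √(1 - k ^ 2 * Real.sin θ ^ 2)

/-- The Jacobi amplitude, the inverse of `ellipticF k` (a bijection of `ℝ` when `|k| < 1`). -/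
def jacobiAm (k u : ℝ) : ℝ := Function.invFun (ellipticF k) u

/-- `dn(u; k)` with modulus `k`. -/
def dn (u k : ℝ) : ℝ := √(1 - k ^ 2 * Real.sin (jacobiAm k u) ^ 2)

/-- `p(x, t)` is a classical solution of the focusing NLS equation `i p_t + p_xx + 2 |p|² p = 0`. -/
def SolvesNLS (p : ℝ → ℝ → ℂ) : Prop :=
  ∀ x t : ℝ,
    DifferentiableAt ℝ (fun s => p x s) t ∧
    DifferentiableAt ℝ (fun y => p y t) x ∧
    DifferentiableAt ℝ (deriv (fun y => p y t)) x ∧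
    Complex.I * deriv (fun s => p x s) t + deriv (deriv (fun y => p y t)) x
      + 2 * (‖p x t‖ : ℂ) ^ 2 * p x t = 0

end TwoPhaseNLS

end

/-! The proof has three independent ingredients.

Degeneration of the formula. As a → 0 the period `Aminus` keeps a positive limit while `Bminus` is
at least of order log (1/a) (`log_div_le_Bminus`), so the first theta parameter 2i𝔟₋ goes to i∞.
Then ϑ₃(u₁) → 1 and ϑ₂(u₁) → 0 as long as Im u₁ stays bounded; this covers the shift by iδ, since δ
is bounded. Hence H(u₁, u₂) tends to ϑ₃ + ϑ₂ in the second variable, and the shift u₂ + 1 reverses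
the sign of ϑ₂, which gives ϑ₃ - ϑ₂. The prefactor tends to √(c² - b²): D₋ → 0, and F₋ becomes
elementary at a = 0 (`tendsto_K0`, `tendsto_twoPhase`).

The constants K₁, K₂. Write λ = lam0 + iy. The a₁-period sees only the part of the polynomial that
is even in y, the a₂-period only the odd part. For the odd differential (y³ + q y) dy / R,
subtracting the differential of an algebraic function leaves a remainder on (c, ∞) which an
involution of the quotient elliptic curve carries to the same differential on the gap (a, b). The
constant term is therefore the normalized a₂-period, that is zero (`isBigO_integral_odd`). For the
even differential, subtracting d(2R/y) leaves a remainder that vanishes with a, because the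
normalizing coefficient is O(a²) (`exists_isK2`). Uniqueness holds because two candidates differ by
a holomorphic differential with zero a-periods (`eq_zero_of_periods`).

The limit wave. Splitting ϑ₃ into even and odd frequencies turns (ϑ₃ - ϑ₂)/(ϑ₃ + ϑ₂) at (2ξ | 4iy)
into d = ϑ₄/ϑ₃ at (ξ | iy), where 𝔟₊ = 2y at a = 0. Addition formulas give d'² = M² (d² - δ²)(1 - δ²
d²) with δ = d(0) (`exists_thetaQuot_deriv_sq`). To match M and y with elliptic integrals, y is
chosen so that δ² = (c - b)/(c + b). A Möbius map then carries the integrands of A₊ and B₊ to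
constants on a real and an imaginary segment, giving M = (b + c) A₊ and 𝔟₊ = 2y
(`exists_thetaQuot_periods`). The absence of zeros of ϑ₁ inside these segments makes the
substitutions monotone. The differentiated equation is that of dn after scaling, which identifies
the wave through uniqueness for ODEs (`onePhase_eq_dn`) and also verifies the NLS equation
(`solvesNLS_onePhase`). -/

noncomputable section

namespace TwoPhaseNLS

/-! ### Theta functions: shifts, product formulas -/

/-- `ϑ₄(u | τ) = ϑ₃(u + 1/2 | τ)`. -/
def theta4 (u τ : ℂ) : ℂ := jacobiTheta₂ (u + 1 / 2) τ

/-- `ϑ₁(u | τ) = ϑ₂(u - 1/2 | τ)`. -/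
def theta1 (u τ : ℂ) : ℂ := theta2 (u - 1 / 2) τ

lemma hasSum_theta2 (u : ℂ) {τ : ℂ} (hτ : 0 < τ.im) :
    HasSum (fun n : ℤ => Complex.exp (Real.pi * Complex.I * ((n : ℂ) + 1 / 2) ^ 2 * τ
      + 2 * Real.pi * Complex.I * ((n : ℂ) + 1 / 2) * u)) (theta2 u τ) := by
  have h := (hasSum_jacobiTheta₂_term (u + τ / 2) hτ).mul_left
    (Complex.exp (Real.pi * Complex.I * (τ / 4 + u)))
  refine (congrArg (fun f => HasSum f (theta2 u τ)) (funext fun n => ?_)).mpr h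
  rw [jacobiTheta₂_term, ← Complex.exp_add]
  congr 1
  ring

lemma theta2_neg (u τ : ℂ) : theta2 (-u) τ = theta2 u τ := by
  unfold theta2
  have h1 : -u + τ / 2 = -((u + τ / 2) - τ) := by ring
  have h2 := jacobiTheta₂_add_left' (u + τ / 2 - τ) τ
  rw [sub_add_cancel] at h2
  rw [h1, jacobiTheta₂_neg_left, h2, ← mul_assoc, ← Complex.exp_add]
  congr 2
  ring

lemma theta2_add_one (u τ : ℂ) : theta2 (u + 1) τ = -theta2 u τ := by
  unfold theta2
  have h1 : u + 1 + τ / 2 = u + τ / 2 + 1 := by ring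
  have h2 : (Real.pi : ℂ) * Complex.I * (τ / 4 + (u + 1))
      = Real.pi * Complex.I * (τ / 4 + u) + Real.pi * Complex.I := by ring
  rw [h1, jacobiTheta₂_add_left, h2, Complex.exp_add, Complex.exp_pi_mul_I]
  ring

lemma theta2_sub_one (u τ : ℂ) : theta2 (u - 1) τ = -theta2 u τ := by
  have := theta2_add_one (u - 1) τ
  rw [sub_add_cancel] at this
  rw [this, neg_neg]

lemma jacobiTheta₂_sub_one (u τ : ℂ) : jacobiTheta₂ (u - 1) τ = jacobiTheta₂ u τ := by
  have := jacobiTheta₂_add_left (u - 1) τ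
  rw [sub_add_cancel] at this
  exact this.symm

/-- The product formula for `ϑ₃(x | τ) ϑ₃(y | τ)`. -/
lemma jacobiTheta₂_mul (x y : ℂ) {τ : ℂ} (hτ : 0 < τ.im) :
    jacobiTheta₂ x τ * jacobiTheta₂ y τ =
      jacobiTheta₂ (x + y) (2 * τ) * jacobiTheta₂ (x - y) (2 * τ)
        + theta2 (x + y) (2 * τ) * theta2 (x - y) (2 * τ) := by
  have hτ2 : 0 < (2 * τ).im := by simp [hτ]
  have key : ∀ {f g : ℤ → ℂ} {a b : ℂ}, HasSum f a → HasSum g b →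
      HasSum (fun p : ℤ × ℤ => f p.1 * g p.2) (a * b) := fun hf hg =>
    hf.mul hg (summable_mul_of_summable_norm hf.summable.norm hg.summable.norm)
  have h0 := key (hasSum_jacobiTheta₂_term x hτ) (hasSum_jacobiTheta₂_term y hτ)
  have h1 := key (hasSum_jacobiTheta₂_term (x + y) hτ2) (hasSum_jacobiTheta₂_term (x - y) hτ2)
  have h2 := key (hasSum_theta2 (x + y) hτ2) (hasSum_theta2 (x - y) hτ2)
  -- The pairs (m, n) are split by the parity of m + n. In the new indices m² + n² becomes 2p² + 2q²
  -- on the even class and 2(p + 1/2)² + 2(q + 1/2)² on the odd one, hence the doubled parameter and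
  -- the ϑ₂ terms.
  set e1 : ℤ × ℤ → ℤ × ℤ := fun p => (p.1 + p.2, p.1 - p.2) with he1
  set e2 : ℤ × ℤ → ℤ × ℤ := fun p => (p.1 + p.2 + 1, p.1 - p.2) with he2
  have i1 : Function.Injective e1 := by
    rintro ⟨a, b⟩ ⟨c, d⟩ h
    simp only [he1, Prod.mk.injEq] at h ⊢
    omega
  have i2 : Function.Injective e2 := by
    rintro ⟨a, b⟩ ⟨c, d⟩ h
    simp only [he2, Prod.mk.injEq] at h ⊢
    omega
  have hc : IsCompl (range e1) (range e2) := by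
    rw [isCompl_iff, Set.disjoint_iff, codisjoint_iff_le_sup]
    constructor
    · rintro ⟨m, n⟩ ⟨⟨⟨a, b⟩, h⟩, ⟨⟨c, d⟩, h'⟩⟩
      simp only [he1, he2, Prod.mk.injEq] at h h'
      omega
    · rintro ⟨m, n⟩ -
      rcases Int.even_or_odd' (m + n) with ⟨k, hk | hk⟩
      · left
        exact ⟨(k, m - k), by simp only [he1, Prod.mk.injEq]; omega⟩
      · right
        exact ⟨(k, m - k - 1), by simp only [he2, Prod.mk.injEq]; omega⟩
  refine h0.unique (HasSum.add_isCompl hc ?_ ?_)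
  · refine (i1.hasSum_range_iff (f := fun p : ℤ × ℤ =>
      jacobiTheta₂_term p.1 x τ * jacobiTheta₂_term p.2 y τ)).mpr ?_
    convert h1 using 1
    funext p
    simp only [he1, jacobiTheta₂_term, ← Complex.exp_add, Function.comp]
    congr 1
    push_cast
    ring
  · refine (i2.hasSum_range_iff (f := fun p : ℤ × ℤ =>
      jacobiTheta₂_term p.1 x τ * jacobiTheta₂_term p.2 y τ)).mpr ?_
    convert h2 using 1
    funext p
    simp only [he2, jacobiTheta₂_term, ← Complex.exp_add, Function.comp]
    congr 1
    push_cast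
    ring

lemma theta4_neg (u τ : ℂ) : theta4 (-u) τ = theta4 u τ := by
  unfold theta4
  rw [← jacobiTheta₂_neg_left (-u + 1 / 2), ← jacobiTheta₂_add_left (-(-u + 1 / 2))]
  congr 1
  ring

/-- The product formula with y shifted by 1/2. With x = z + h and y = z - h the factors in x + y are
constant in h, which is the form needed for the Wronskian. -/
lemma jacobiTheta₂_mul_theta4 (x y : ℂ) {τ : ℂ} (hτ : 0 < τ.im) :
    jacobiTheta₂ x τ * theta4 y τ =
      theta4 (x + y) (2 * τ) * theta4 (x - y) (2 * τ)
        - theta1 (x + y) (2 * τ) * theta1 (x - y) (2 * τ) := by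
  have h := jacobiTheta₂_mul x (y + 1 / 2) hτ
  have h1 : x + (y + 1 / 2) = (x + y) + 1 / 2 := by ring
  have h2 : x - (y + 1 / 2) = (x - y + 1 / 2) - 1 := by ring
  have h3 : x - y + 1 / 2 - 1 = x - y - 1 / 2 := by ring
  have h4 : theta2 (x + y + 1 / 2) (2 * τ) = - theta2 (x + y - 1 / 2) (2 * τ) := by
    rw [← theta2_add_one]; congr 1; ring
  rw [h1, h2, jacobiTheta₂_sub_one, h3, h4] at h
  unfold theta4 theta1
  rw [h]
  ring

lemma jacobiTheta₂_sq (z : ℂ) {τ : ℂ} (hτ : 0 < τ.im) :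
    jacobiTheta₂ z τ ^ 2 = jacobiTheta₂ (2 * z) (2 * τ) * jacobiTheta₂ 0 (2 * τ)
      + theta2 (2 * z) (2 * τ) * theta2 0 (2 * τ) := by
  have h := jacobiTheta₂_mul z z hτ
  rw [sub_self, ← two_mul] at h
  rw [sq, h]

lemma theta4_sq (z : ℂ) {τ : ℂ} (hτ : 0 < τ.im) :
    theta4 z τ ^ 2 = jacobiTheta₂ (2 * z) (2 * τ) * jacobiTheta₂ 0 (2 * τ)
      - theta2 (2 * z) (2 * τ) * theta2 0 (2 * τ) := by
  have h := jacobiTheta₂_sq (z + 1 / 2) hτ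
  have h1 : 2 * (z + 1 / 2) = 2 * z + 1 := by ring
  rw [h1, jacobiTheta₂_add_left, theta2_add_one] at h
  rw [theta4, h]
  ring

/-- Shifting z by τ/2 shifts 2z by half the quasi-period 2τ, which interchanges ϑ₃ and ϑ₂ of
parameter 2τ up to exponential factors. -/
lemma theta2_sq (z : ℂ) {τ : ℂ} (hτ : 0 < τ.im) :
    theta2 z τ ^ 2 = jacobiTheta₂ 0 (2 * τ) * theta2 (2 * z) (2 * τ)
      + theta2 0 (2 * τ) * jacobiTheta₂ (2 * z) (2 * τ) := by
  have h := jacobiTheta₂_sq (z + τ / 2) hτ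
  have h1 : 2 * (z + τ / 2) = 2 * z + τ := by ring
  have h2 := jacobiTheta₂_add_left' (2 * z) (2 * τ)
  have h4 : theta2 (2 * z + τ) (2 * τ) =
      Complex.exp (-(Real.pi * Complex.I * (τ / 2 + 2 * z))) * jacobiTheta₂ (2 * z) (2 * τ) := by
    unfold theta2
    have h3 : 2 * z + τ + 2 * τ / 2 = 2 * z + 2 * τ := by ring
    rw [h3, h2, ← mul_assoc, ← Complex.exp_add]
    congr 2
    ring
  have h5 : theta2 (2 * z) (2 * τ) =
      Complex.exp (Real.pi * Complex.I * (τ / 2 + 2 * z)) * jacobiTheta₂ (2 * z + τ) (2 * τ) := by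
    unfold theta2
    have h3 : 2 * z + 2 * τ / 2 = 2 * z + τ := by ring
    rw [h3]
    congr 2
    ring
  rw [h1, h4] at h
  have h6 : Complex.exp (Real.pi * Complex.I * (τ / 4 + z)) ^ 2
      = Complex.exp (Real.pi * Complex.I * (τ / 2 + 2 * z)) := by
    rw [← Complex.exp_nat_mul]
    congr 1
    push_cast
    ring
  rw [h5, theta2, mul_pow, h, h6, Complex.exp_neg]
  have := Complex.exp_ne_zero (Real.pi * Complex.I * (τ / 2 + 2 * z))
  field_simp

lemma theta1_sq (z : ℂ) {τ : ℂ} (hτ : 0 < τ.im) :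
    theta1 z τ ^ 2 = theta2 0 (2 * τ) * jacobiTheta₂ (2 * z) (2 * τ)
      - jacobiTheta₂ 0 (2 * τ) * theta2 (2 * z) (2 * τ) := by
  have h := theta2_sq (z - 1 / 2) hτ
  have h1 : 2 * (z - 1 / 2) = 2 * z - 1 := by ring
  rw [h1, jacobiTheta₂_sub_one, theta2_sub_one] at h
  rw [theta1, h]
  ring

/-- All squares are linear in ϑ₃(2z | 2τ) and ϑ₂(2z | 2τ), so this is a polynomial identity in those
two values and the theta constants. -/
lemma theta1_sq_mul_theta4_zero_sq (z : ℂ) {τ : ℂ} (hτ : 0 < τ.im) :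
    theta1 z τ ^ 2 * theta4 0 τ ^ 2 =
      jacobiTheta₂ z τ ^ 2 * theta2 0 τ ^ 2 - theta2 z τ ^ 2 * jacobiTheta₂ 0 τ ^ 2 := by
  rw [theta1_sq z hτ, theta4_sq 0 hτ, jacobiTheta₂_sq z hτ, theta2_sq 0 hτ, theta2_sq z hτ,
    jacobiTheta₂_sq 0 hτ, mul_zero]
  ring

/-- A duplication formula, squared to avoid fixing a sign. It transfers nonvanishing of ϑ₁ from
parameter 2τ to parameter τ. -/
lemma theta1_sq_mul_theta2_sq (z : ℂ) {τ : ℂ} (hτ : 0 < τ.im) :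
    theta1 z τ ^ 2 * theta2 z τ ^ 2 = theta1 (2 * z) (2 * τ) ^ 2 * theta4 0 (2 * τ) ^ 2 := by
  have hτ2 : 0 < (2 * τ).im := by simp [hτ]
  rw [theta1_sq_mul_theta4_zero_sq _ hτ2, theta1_sq z hτ, theta2_sq z hτ]
  ring

/-! ### Derivatives -/

lemma differentiableAt_theta4 (z : ℂ) {τ : ℂ} (hτ : 0 < τ.im) :
    DifferentiableAt ℂ (fun u => theta4 u τ) z :=
  DifferentiableAt.comp (f := fun u : ℂ => u + 1 / 2) z
    (differentiableAt_jacobiTheta₂_fst (z + 1 / 2) hτ) (by fun_prop)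

lemma differentiableAt_theta2 (z : ℂ) {τ : ℂ} (hτ : 0 < τ.im) :
    DifferentiableAt ℂ (fun u => theta2 u τ) z := by
  have : DifferentiableAt ℂ (fun u => jacobiTheta₂ (u + τ / 2) τ) z :=
    DifferentiableAt.comp (f := fun u : ℂ => u + τ / 2) z
      (differentiableAt_jacobiTheta₂_fst (z + τ / 2) hτ) (by fun_prop)
  unfold theta2
  fun_prop

lemma differentiableAt_theta1 (z : ℂ) {τ : ℂ} (hτ : 0 < τ.im) :
    DifferentiableAt ℂ (fun u => theta1 u τ) z :=
  DifferentiableAt.comp (f := fun u : ℂ => u - 1 / 2) z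
    (differentiableAt_theta2 (z - 1 / 2) hτ) (by fun_prop)

/-- Differentiate the product formula for ϑ₃(z + h) ϑ₄(z - h) in h at h = 0. The result makes the
derivative of ϑ₄/ϑ₃ explicit. -/
lemma jacobiTheta₂_wronskian (z : ℂ) {τ : ℂ} (hτ : 0 < τ.im) :
    jacobiTheta₂ z τ * deriv (fun u => theta4 u τ) z
        - deriv (fun u => jacobiTheta₂ u τ) z * theta4 z τ
      = 2 * deriv (fun u => theta1 u (2 * τ)) 0 * theta1 (2 * z) (2 * τ) := by
  have hτ2 : 0 < (2 * τ).im := by simp [hτ]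
  have d3 := (differentiableAt_jacobiTheta₂_fst z hτ).hasDerivAt
  have d4 := (differentiableAt_theta4 z hτ).hasDerivAt
  have e40 := (differentiableAt_theta4 0 hτ2).hasDerivAt
  have e42 := (differentiableAt_theta4 (2 * z) hτ2).hasDerivAt
  have e10 := (differentiableAt_theta1 0 hτ2).hasDerivAt
  have e12 := (differentiableAt_theta1 (2 * z) hτ2).hasDerivAt
  have p3 : HasDerivAt (fun h : ℂ => jacobiTheta₂ (z + h) τ)
      (deriv (fun u => jacobiTheta₂ u τ) z) 0 := by
    have : HasDerivAt (fun u => jacobiTheta₂ u τ) (deriv (fun u => jacobiTheta₂ u τ) z) (z + 0) := by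
      rw [add_zero]; exact d3
    exact this.comp_const_add z 0
  have p4 : HasDerivAt (fun h : ℂ => theta4 (z - h) τ)
      (-deriv (fun u => theta4 u τ) z) 0 := by
    have : HasDerivAt (fun u => theta4 u τ) (deriv (fun u => theta4 u τ) z) (z - 0) := by
      rw [sub_zero]; exact d4
    exact this.comp_const_sub z 0
  have q4 : HasDerivAt (fun h : ℂ => theta4 (2 * h) (2 * τ))
      (deriv (fun u => theta4 u (2 * τ)) 0 * 2) 0 := by
    have : HasDerivAt (fun u => theta4 u (2 * τ)) (deriv (fun u => theta4 u (2 * τ)) 0)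
      (2 * (0 : ℂ)) := by rw [mul_zero]; exact e40
    exact this.comp 0 (by simpa using (hasDerivAt_id (0 : ℂ)).const_mul 2)
  have q1 : HasDerivAt (fun h : ℂ => theta1 (2 * h) (2 * τ))
      (deriv (fun u => theta1 u (2 * τ)) 0 * 2) 0 := by
    have : HasDerivAt (fun u => theta1 u (2 * τ)) (deriv (fun u => theta1 u (2 * τ)) 0)
      (2 * (0 : ℂ)) := by rw [mul_zero]; exact e10
    exact this.comp 0 (by simpa using (hasDerivAt_id (0 : ℂ)).const_mul 2)
  -- ϑ₄ is even, so only the ϑ₁ product contributes to the derivative.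
  have z4 : deriv (fun u => theta4 u (2 * τ)) 0 = 0 := by
    have h : HasDerivAt (fun h : ℂ => theta4 (-h) (2 * τ))
        (-deriv (fun u => theta4 u (2 * τ)) 0) 0 := by
      have : HasDerivAt (fun u => theta4 u (2 * τ)) (deriv (fun u => theta4 u (2 * τ)) 0)
        (0 - 0) := by rw [sub_zero]; exact e40
      simpa using this.comp_const_sub 0 0
    simp only [theta4_neg] at h
    exact self_eq_neg.mp (e40.unique h)
  have hL := p3.mul p4
  have hR := (q4.const_mul (theta4 (2 * z) (2 * τ))).sub
    (q1.const_mul (theta1 (2 * z) (2 * τ)))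
  have hfun : (fun h : ℂ => jacobiTheta₂ (z + h) τ * theta4 (z - h) τ) =
      fun h => theta4 (2 * z) (2 * τ) * theta4 (2 * h) (2 * τ)
        - theta1 (2 * z) (2 * τ) * theta1 (2 * h) (2 * τ) := by
    funext h
    rw [jacobiTheta₂_mul_theta4 _ _ hτ]
    congr 3 <;> ring_nf
  have hL' : HasDerivAt (fun h : ℂ => jacobiTheta₂ (z + h) τ * theta4 (z - h) τ) _ 0 := hL
  rw [hfun] at hL'
  have := hL'.unique hR
  rw [z4, add_zero, sub_zero] at this
  linear_combination -this

/-! ### Theta functions with purely imaginary parameter -/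

lemma im_I_mul_pos {y : ℝ} (hy : 0 < y) : 0 < (Complex.I * (y : ℂ)).im := by simpa using hy

lemma two_mul_I_mul (y : ℝ) : 2 * (Complex.I * (y : ℂ)) = Complex.I * ((2 * y : ℝ) : ℂ) := by
  push_cast; ring

/-- Splitting of `ϑ₃(z | τ)` into its even and odd parts. -/
lemma jacobiTheta₂_eq_add_theta2 (z : ℂ) {τ : ℂ} (hτ : 0 < τ.im) :
    jacobiTheta₂ z τ = jacobiTheta₂ (2 * z) (4 * τ) + theta2 (2 * z) (4 * τ) := by
  have hτ4 : 0 < (4 * τ).im := by simp [hτ]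
  have i1 : Function.Injective fun n : ℤ => 2 * n := fun a b h => by simp only at h; omega
  have i2 : Function.Injective fun n : ℤ => 2 * n + 1 := fun a b h => by simp only at h; omega
  refine (hasSum_jacobiTheta₂_term z hτ).unique (HasSum.add_isCompl Int.isCompl_even_odd ?_ ?_)
  · rw [show {n : ℤ | Even n} = range fun n : ℤ => 2 * n by
      ext n; simp [even_iff_exists_two_mul]]
    refine (i1.hasSum_range_iff (f := fun n => jacobiTheta₂_term n z τ)).mpr ?_
    refine (congrArg (fun f => HasSum f _) (funext fun n => ?_)).mpr
      (hasSum_jacobiTheta₂_term (2 * z) hτ4)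
    simp only [Function.comp, jacobiTheta₂_term]
    congr 1
    push_cast
    ring
  · rw [show {n : ℤ | Odd n} = range fun n : ℤ => 2 * n + 1 by
      ext n; simp [Odd]]
    refine (i2.hasSum_range_iff (f := fun n => jacobiTheta₂_term n z τ)).mpr ?_
    refine (congrArg (fun f => HasSum f _) (funext fun n => ?_)).mpr
      (hasSum_theta2 (2 * z) hτ4)
    simp only [Function.comp, jacobiTheta₂_term]
    congr 1
    push_cast
    ring

lemma theta4_eq_sub_theta2 (z : ℂ) {τ : ℂ} (hτ : 0 < τ.im) :
    theta4 z τ = jacobiTheta₂ (2 * z) (4 * τ) - theta2 (2 * z) (4 * τ) := by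
  have h1 : 2 * (z + 1 / 2) = 2 * z + 1 := by ring
  rw [theta4, jacobiTheta₂_eq_add_theta2 _ hτ, h1, jacobiTheta₂_add_left, theta2_add_one]
  ring

lemma hasSum_ofReal_pos {f : ℤ → ℝ} {s : ℂ} (hf : ∀ n, 0 < f n)
    (h : HasSum (fun n => (f n : ℂ)) s) : ∃ r : ℝ, 0 < r ∧ s = r := by
  have hs : Summable f := Complex.summable_ofReal.mp h.summable
  refine ⟨∑' n, f n, hs.tsum_pos (fun n => (hf n).le) 0 (hf 0), ?_⟩
  rw [← h.tsum_eq, Complex.ofReal_tsum]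

lemma jacobiTheta₂_imaginary_pos (s : ℝ) {y : ℝ} (hy : 0 < y) :
    ∃ r : ℝ, 0 < r ∧ jacobiTheta₂ (Complex.I * s) (Complex.I * y) = r := by
  refine hasSum_ofReal_pos (f := fun n : ℤ => Real.exp (-2 * Real.pi * n * s - Real.pi * n ^ 2 * y))
    (fun n => Real.exp_pos _) ?_
  refine (congrArg (fun f => HasSum f _) (funext fun n => ?_)).mpr
    (hasSum_jacobiTheta₂_term (Complex.I * s) (im_I_mul_pos hy))
  rw [jacobiTheta₂_term, Complex.ofReal_exp]
  congr 1
  push_cast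
  linear_combination (-(2 * Real.pi * n * s) - Real.pi * n ^ 2 * y : ℂ) * Complex.I_sq

lemma theta2_imaginary_pos (s : ℝ) {y : ℝ} (hy : 0 < y) :
    ∃ r : ℝ, 0 < r ∧ theta2 (Complex.I * s) (Complex.I * y) = r := by
  refine hasSum_ofReal_pos
    (f := fun n : ℤ => Real.exp (-2 * Real.pi * (n + 1 / 2) * s - Real.pi * (n + 1 / 2) ^ 2 * y))
    (fun n => Real.exp_pos _) ?_
  refine (congrArg (fun f => HasSum f _) (funext fun n => ?_)).mpr
    (hasSum_theta2 (Complex.I * s) (im_I_mul_pos hy))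
  rw [Complex.ofReal_exp]
  congr 1
  push_cast
  linear_combination (-(2 * Real.pi * (n + 1 / 2) * s) - Real.pi * (n + 1 / 2) ^ 2 * y : ℂ)
    * Complex.I_sq

/-- Jacobi's imaginary transformation for real `y`. -/
lemma jacobiTheta₂_I_mul (z : ℂ) {y : ℝ} (hy : 0 < y) :
    jacobiTheta₂ z (Complex.I * y) = ((1 / √y : ℝ) : ℂ) * Complex.exp (-Real.pi * z ^ 2 / y) *
      jacobiTheta₂ (Complex.I * (z / y)) (Complex.I * ((1 / y : ℝ) : ℂ)) := by
  have hy' : (y : ℂ) ≠ 0 := by exact_mod_cast hy.ne'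
  rw [jacobiTheta₂_functional_equation, ← jacobiTheta₂_neg_left (Complex.I * (z / y))]
  have h1 : -Complex.I * (Complex.I * (y : ℂ)) = (y : ℂ) := by
    linear_combination (-y : ℂ) * Complex.I_sq
  have h2 : ((y : ℂ)) ^ (1 / 2 : ℂ) = ((√y : ℝ) : ℂ) := by
    rw [Real.sqrt_eq_rpow, Complex.ofReal_cpow hy.le]
    norm_num
  have h3 : -(Real.pi : ℂ) * Complex.I * z ^ 2 / (Complex.I * y) = -Real.pi * z ^ 2 / y := by
    have := Complex.I_ne_zero
    field_simp
  have h4 : z / (Complex.I * y) = -(Complex.I * (z / y)) := by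
    have := Complex.I_ne_zero
    field_simp
    linear_combination z * Complex.I_sq
  have h5 : -1 / (Complex.I * (y : ℂ)) = Complex.I * ((1 / y : ℝ) : ℂ) := by
    have := Complex.I_ne_zero
    push_cast
    field_simp
    linear_combination - Complex.I_sq
  rw [h1, h2, h3, h4, h5]
  push_cast
  rfl

/-- On the real axis the series has terms of both signs; the imaginary transformation moves the
point to the imaginary axis, where every term is positive. -/
lemma jacobiTheta₂_real_pos (x : ℝ) {y : ℝ} (hy : 0 < y) :
    ∃ r : ℝ, 0 < r ∧ jacobiTheta₂ x (Complex.I * y) = r := by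
  obtain ⟨r, hr, h⟩ := jacobiTheta₂_imaginary_pos (x / y) (y := 1 / y) (by positivity)
  refine ⟨1 / √y * Real.exp (-Real.pi * x ^ 2 / y) * r, by positivity, ?_⟩
  rw [jacobiTheta₂_I_mul _ hy]
  push_cast at h ⊢
  rw [h]

lemma theta4_real_pos (x : ℝ) {y : ℝ} (hy : 0 < y) :
    ∃ r : ℝ, 0 < r ∧ theta4 x (Complex.I * y) = r := by
  obtain ⟨r, hr, h⟩ := jacobiTheta₂_real_pos (x + 1 / 2) hy
  refine ⟨r, hr, ?_⟩
  rw [theta4, ← h]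
  push_cast
  rfl

lemma conj_ofNat_two : (starRingEnd ℂ) 2 = 2 := map_ofNat _ 2

lemma conj_ofNat_four : (starRingEnd ℂ) 4 = 4 := map_ofNat _ 4

lemma theta2_conj (z : ℂ) (y : ℝ) :
    (starRingEnd ℂ) (theta2 z (Complex.I * y)) = theta2 ((starRingEnd ℂ) z) (Complex.I * y) := by
  have h := jacobiTheta₂_conj (z + Complex.I * y / 2) (Complex.I * y)
  have h2 := jacobiTheta₂_add_left' ((starRingEnd ℂ) z - Complex.I * y / 2) (Complex.I * y)
  have e1 : (starRingEnd ℂ) (z + Complex.I * y / 2)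
      = (starRingEnd ℂ) z - Complex.I * y / 2 := by simp [conj_ofNat_two]; ring
  have e2 : -(starRingEnd ℂ) (Complex.I * y) = Complex.I * y := by simp
  have e3 : (starRingEnd ℂ) z - Complex.I * y / 2 + Complex.I * y
      = (starRingEnd ℂ) z + Complex.I * y / 2 := by ring
  rw [e1, e2] at h
  rw [e3] at h2
  rw [theta2, theta2, map_mul, h, h2, ← mul_assoc, ← Complex.exp_conj, ← Complex.exp_add]
  congr 2
  simp [conj_ofNat_four]
  ring

lemma theta2_ofReal (x y : ℝ) : ∃ r : ℝ, theta2 x (Complex.I * y) = r := by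
  have h := theta2_conj x y
  rw [Complex.conj_ofReal] at h
  obtain ⟨r, hr⟩ := Complex.conj_eq_iff_real.mp h
  exact ⟨r, hr⟩

lemma theta1_ofReal (x y : ℝ) : ∃ r : ℝ, theta1 x (Complex.I * y) = r := by
  obtain ⟨r, hr⟩ := theta2_ofReal (x - 1 / 2) y
  refine ⟨r, ?_⟩
  rw [theta1, ← hr]
  push_cast
  rfl

/-- Conjugation sends is + 1/2 to its negative up to the period 1, and ϑ₃ is even. -/
lemma theta4_imaginary_real (s y : ℝ) :
    ∃ r : ℝ, theta4 (Complex.I * s) (Complex.I * y) = r := by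
  have h := jacobiTheta₂_conj (Complex.I * s + 1 / 2) (Complex.I * y)
  have e1 : (starRingEnd ℂ) (Complex.I * s + 1 / 2) = -(Complex.I * s + 1 / 2 - 1) := by
    simp [conj_ofNat_two]; ring
  have e2 : -(starRingEnd ℂ) (Complex.I * y) = Complex.I * y := by simp
  rw [e1, e2, jacobiTheta₂_neg_left, jacobiTheta₂_sub_one] at h
  obtain ⟨r, hr⟩ := Complex.conj_eq_iff_real.mp h
  exact ⟨r, hr⟩

/-! ### Limits as the imaginary parameter tends to infinity -/

/-- The real part of the exponent is -π m² B - 2π m Im u, so bounded Im u suffices. The index m is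
real in order to serve both ϑ₃ (integers) and ϑ₂ (half-integers). -/
lemma norm_exp_term_tendsto {ι : Type*} {l : Filter ι} {B : ι → ℝ} {u : ι → ℂ} {S m : ℝ}
    (hB : Tendsto B l atTop) (hu : ∀ᶠ i in l, |(u i).im| ≤ S) (hm : m ≠ 0) :
    Tendsto (fun i => Complex.exp (Real.pi * Complex.I * (m : ℂ) ^ 2 * (Complex.I * (B i : ℂ))
      + 2 * Real.pi * Complex.I * (m : ℂ) * u i)) l (𝓝 0) := by
  rw [tendsto_zero_iff_norm_tendsto_zero]
  have h1 : Tendsto (fun i => Real.exp (-(Real.pi * m ^ 2 * B i) + 2 * Real.pi * |m| * S)) l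
      (𝓝 0) := by
    refine Real.tendsto_exp_atBot.comp (tendsto_atBot_add_const_right _ _ ?_)
    exact tendsto_neg_atTop_atBot.comp (hB.const_mul_atTop (by positivity))
  refine squeeze_zero' (Eventually.of_forall fun i => norm_nonneg _) ?_ h1
  filter_upwards [hu] with i hi
  rw [Complex.norm_exp, Real.exp_le_exp]
  have e : (Real.pi * Complex.I * (m : ℂ) ^ 2 * (Complex.I * (B i : ℂ))
      + 2 * Real.pi * Complex.I * (m : ℂ) * u i).re
      = -(Real.pi * m ^ 2 * B i) - 2 * Real.pi * (m * (u i).im) := by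
    have : Real.pi * Complex.I * (m : ℂ) ^ 2 * (Complex.I * (B i : ℂ))
      + 2 * Real.pi * Complex.I * (m : ℂ) * u i
      = ((-(Real.pi * m ^ 2 * B i) : ℝ) : ℂ) + ((2 * Real.pi * m : ℝ) : ℂ) * (Complex.I * u i) := by
      push_cast
      linear_combination (Real.pi * m ^ 2 * B i : ℂ) * Complex.I_sq
    rw [this, Complex.add_re, Complex.ofReal_re, Complex.re_ofReal_mul]
    simp
    ring
  rw [e]
  have h2 : -(m * (u i).im) ≤ |m| * S := by
    calc -(m * (u i).im) ≤ |m * (u i).im| := neg_le_abs _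
      _ = |m| * |(u i).im| := abs_mul _ _
      _ ≤ |m| * S := by gcongr
  have := Real.pi_pos
  nlinarith

/-- A summable majorant independent of B and u: the terms at B = 1 with Im u = ±S. Adding both signs
avoids separating the cases m ≥ 0 and m ≤ 0 in the bound. -/
lemma norm_exp_term_le {B S m : ℝ} {u : ℂ} (hB : 1 ≤ B) (hu : |u.im| ≤ S) :
    ‖Complex.exp (Real.pi * Complex.I * (m : ℂ) ^ 2 * (Complex.I * (B : ℂ))
      + 2 * Real.pi * Complex.I * (m : ℂ) * u)‖ ≤
    ‖Complex.exp (Real.pi * Complex.I * (m : ℂ) ^ 2 * (Complex.I * ((1 : ℝ) : ℂ))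
      + 2 * Real.pi * Complex.I * (m : ℂ) * (Complex.I * (S : ℂ)))‖ +
    ‖Complex.exp (Real.pi * Complex.I * (m : ℂ) ^ 2 * (Complex.I * ((1 : ℝ) : ℂ))
      + 2 * Real.pi * Complex.I * (m : ℂ) * (Complex.I * ((-S : ℝ) : ℂ)))‖ := by
  have e : ∀ (B : ℝ) (u : ℂ), (Real.pi * Complex.I * (m : ℂ) ^ 2 * (Complex.I * (B : ℂ))
      + 2 * Real.pi * Complex.I * (m : ℂ) * u).re
      = -(Real.pi * m ^ 2 * B) - 2 * Real.pi * (m * u.im) := by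
    intro B u
    have : Real.pi * Complex.I * (m : ℂ) ^ 2 * (Complex.I * (B : ℂ))
      + 2 * Real.pi * Complex.I * (m : ℂ) * u
      = ((-(Real.pi * m ^ 2 * B) : ℝ) : ℂ) + ((2 * Real.pi * m : ℝ) : ℂ) * (Complex.I * u) := by
      push_cast
      linear_combination (Real.pi * m ^ 2 * B : ℂ) * Complex.I_sq
    rw [this, Complex.add_re, Complex.ofReal_re, Complex.re_ofReal_mul]
    simp
    ring
  rw [Complex.norm_exp, Complex.norm_exp, Complex.norm_exp, e, e, e]
  have hpi := Real.pi_pos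
  have h1 : (Complex.I * (S : ℂ)).im = S := by simp
  have h2 : (Complex.I * ((-S : ℝ) : ℂ)).im = -S := by simp
  rw [h1, h2]
  have h3 : Real.pi * m ^ 2 * 1 ≤ Real.pi * m ^ 2 * B := by gcongr
  obtain ⟨h4, h5⟩ := abs_le.mp hu
  rcases le_total 0 m with hm | hm
  · refine le_add_of_nonneg_of_le (Real.exp_pos _).le (Real.exp_le_exp.mpr ?_)
    have : m * -S ≤ m * u.im := by gcongr
    nlinarith
  · refine le_add_of_le_of_nonneg (Real.exp_le_exp.mpr ?_) (Real.exp_pos _).le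
    have : m * S ≤ m * u.im := mul_le_mul_of_nonpos_left h5 hm
    nlinarith

lemma tendsto_jacobiTheta₂_one {ι : Type*} {l : Filter ι} {B : ι → ℝ} {u : ι → ℂ} {S : ℝ}
    (hB : Tendsto B l atTop) (hu : ∀ᶠ i in l, |(u i).im| ≤ S) :
    Tendsto (fun i => jacobiTheta₂ (u i) (Complex.I * (B i : ℂ))) l (𝓝 1) := by
  have h1 : ∀ s : ℝ, Summable fun n : ℤ => ‖Complex.exp (Real.pi * Complex.I * ((n : ℝ) : ℂ) ^ 2 *
      (Complex.I * ((1 : ℝ) : ℂ)) + 2 * Real.pi * Complex.I * ((n : ℝ) : ℂ) * (Complex.I * (s : ℂ)))‖ := by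
    intro s
    refine (congrArg Summable (funext fun n => ?_)).mpr
      (hasSum_jacobiTheta₂_term (Complex.I * s) (im_I_mul_pos one_pos)).summable.norm
    rw [jacobiTheta₂_term]
    congr 2
    push_cast
    ring
  have key := tendsto_tsum_of_dominated_convergence (𝓕 := l)
    (f := fun i (n : ℤ) => Complex.exp (Real.pi * Complex.I * ((n : ℝ) : ℂ) ^ 2 *
      (Complex.I * (B i : ℂ)) + 2 * Real.pi * Complex.I * ((n : ℝ) : ℂ) * u i))
    (g := fun n => if n = 0 then 1 else 0) ((h1 S).add (h1 (-S))) ?_ ?_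
  · rw [tsum_ite_eq] at key
    refine key.congr fun i => tsum_congr fun n => ?_
    rw [jacobiTheta₂_term]
    congr 1
    push_cast
    ring
  · intro n
    split_ifs with hn
    · subst hn
      simp [tendsto_const_nhds]
    · exact norm_exp_term_tendsto hB hu (by exact_mod_cast hn)
  · filter_upwards [hu, hB.eventually_ge_atTop 1] with i hi hBi n
    exact norm_exp_term_le hBi hi

lemma tendsto_theta2_zero {ι : Type*} {l : Filter ι} {B : ι → ℝ} {u : ι → ℂ} {S : ℝ}
    (hB : Tendsto B l atTop) (hu : ∀ᶠ i in l, |(u i).im| ≤ S) :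
    Tendsto (fun i => theta2 (u i) (Complex.I * (B i : ℂ))) l (𝓝 0) := by
  have h1 : ∀ s : ℝ, Summable fun n : ℤ => ‖Complex.exp (Real.pi * Complex.I *
      ((n + 1 / 2 : ℝ) : ℂ) ^ 2 * (Complex.I * ((1 : ℝ) : ℂ)) +
      2 * Real.pi * Complex.I * ((n + 1 / 2 : ℝ) : ℂ) * (Complex.I * (s : ℂ)))‖ := by
    intro s
    refine (congrArg Summable (funext fun n => ?_)).mpr
      (hasSum_theta2 (Complex.I * s) (im_I_mul_pos one_pos)).summable.norm
    congr 2
    push_cast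
    ring
  have key := tendsto_tsum_of_dominated_convergence (𝓕 := l)
    (f := fun i (n : ℤ) => Complex.exp (Real.pi * Complex.I * ((n + 1 / 2 : ℝ) : ℂ) ^ 2 *
      (Complex.I * (B i : ℂ)) + 2 * Real.pi * Complex.I * ((n + 1 / 2 : ℝ) : ℂ) * u i))
    (g := fun n => 0) ((h1 S).add (h1 (-S))) ?_ ?_
  · rw [tsum_zero] at key
    refine Tendsto.congr' ?_ key
    filter_upwards [hB.eventually_gt_atTop 0] with i hi
    rw [← (hasSum_theta2 (u i) (im_I_mul_pos hi)).tsum_eq]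
    refine tsum_congr fun n => ?_
    push_cast
    rfl
  · intro n
    refine norm_exp_term_tendsto hB hu ?_
    -- No half-integer is zero, so unlike ϑ₃ the series has no constant term that survives.
    intro h
    have : (2 * n + 1 : ℝ) = 0 := by linarith
    have : 2 * n + 1 = 0 := by exact_mod_cast this
    omega
  · filter_upwards [hu, hB.eventually_ge_atTop 1] with i hi hBi n
    exact norm_exp_term_le hBi hi

/-! ### Zeros of `ϑ₁` -/

lemma theta1_one_sub (x τ : ℂ) : theta1 (1 - x) τ = theta1 x τ := by
  unfold theta1
  rw [← theta2_neg]
  congr 1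
  ring

lemma abs_sin_int_mul_le (n : ℤ) (x : ℝ) : |Real.sin (n * x)| ≤ |(n : ℝ)| * |Real.sin x| := by
  have hnat : ∀ k : ℕ, |Real.sin (k * x)| ≤ k * |Real.sin x| := by
    intro k
    induction k with
    | zero => simp
    | succ k ih =>
      have h : Real.sin ((k + 1 : ℕ) * x) =
          Real.sin (k * x) * Real.cos x + Real.cos (k * x) * Real.sin x := by
        rw [← Real.sin_add]; congr 1; push_cast; ring
      rw [h]
      calc _ ≤ |Real.sin (k * x)| * |Real.cos x| + |Real.cos (k * x)| * |Real.sin x| := by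
            rw [← abs_mul, ← abs_mul]; exact abs_add_le _ _
        _ ≤ |Real.sin (k * x)| * 1 + 1 * |Real.sin x| := by
            gcongr
            · exact Real.abs_cos_le_one x
            · exact Real.abs_cos_le_one _
        _ ≤ ((k + 1 : ℕ) : ℝ) * |Real.sin x| := by push_cast; linarith
  obtain ⟨k, rfl | rfl⟩ := n.eq_nat_or_neg
  · simpa using hnat k
  · simpa using hnat k

/-- Evaluated at x - 1/2, the cosines of ϑ₂ become the odd-frequency sines of ϑ₁, which can be
compared with sin πx. -/
lemma cos_odd_mul_shift (n : ℤ) (x : ℝ) :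
    Real.cos (2 * Real.pi * (n + 1 / 2) * (x - 1 / 2))
      = (-1) ^ n * Real.sin ((2 * n + 1 : ℤ) * (Real.pi * x)) := by
  have h : 2 * Real.pi * (n + 1 / 2) * (x - 1 / 2)
      = (2 * n + 1 : ℤ) * (Real.pi * x) - Real.pi / 2 - n * Real.pi := by push_cast; ring
  rw [h, Real.cos_sub_int_mul_pi, Real.cos_sub_pi_div_two]

lemma summable_theta1_majorant {y : ℝ} (hy : 0 < y) :
    Summable fun n : ℤ => |(2 * n + 1 : ℝ)| * Real.exp (-(Real.pi * (n ^ 2 + n) * y)) := by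
  have h0 := summable_pow_mul_jacobiTheta₂_term_bound (y / 2) hy 0
  have h1 := summable_pow_mul_jacobiTheta₂_term_bound (y / 2) hy 1
  refine Summable.of_nonneg_of_le (fun n => by positivity) (fun n => ?_)
    ((h1.mul_left 2).add h0)
  have hn : -(|(n : ℝ)|) ≤ n := neg_abs_le _
  have hexp : Real.exp (-(Real.pi * (n ^ 2 + n) * y))
      ≤ Real.exp (-Real.pi * (y * (n : ℝ) ^ 2 - 2 * (y / 2) * |(n : ℝ)|)) := by
    rw [Real.exp_le_exp]
    have : Real.pi * y * -(|(n : ℝ)|) ≤ Real.pi * y * n := by gcongr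
    nlinarith
  have habs : |(2 * n + 1 : ℝ)| ≤ 2 * |(n : ℝ)| + 1 := by
    calc |(2 * n + 1 : ℝ)| ≤ |(2 * n : ℝ)| + |(1 : ℝ)| := abs_add_le _ _
      _ = _ := by rw [abs_mul]; norm_num
  calc _ ≤ (2 * |(n : ℝ)| + 1) * Real.exp (-Real.pi * (y * (n : ℝ) ^ 2 - 2 * (y / 2) * |(n : ℝ)|)) := by
        gcongr
    _ = _ := by push_cast; ring

/-- Only n = 0 and n = -1 have n² + n = 0; each contributes 1 to the limit. -/
lemma tendsto_theta1_majorant :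
    Tendsto (fun y : ℝ => ∑' n : ℤ, |(2 * n + 1 : ℝ)| * Real.exp (-(Real.pi * (n ^ 2 + n) * y)))
      atTop (𝓝 2) := by
  have hnn : ∀ n : ℤ, (0 : ℝ) ≤ (n : ℝ) ^ 2 + n := by
    intro n
    have : 0 ≤ n ^ 2 + n := by
      rcases le_or_gt 0 n with h | h
      · positivity
      · nlinarith
    exact_mod_cast this
  have key := tendsto_tsum_of_dominated_convergence (𝓕 := atTop)
    (f := fun (y : ℝ) (n : ℤ) => |(2 * n + 1 : ℝ)| * Real.exp (-(Real.pi * (n ^ 2 + n) * y)))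
    (g := fun n => if n ∈ ({0, -1} : Finset ℤ) then 1 else 0)
    (summable_theta1_majorant one_pos) ?_ ?_
  · rw [tsum_eq_sum (s := {0, -1}) (fun n hn => if_neg hn)] at key
    rw [Finset.sum_pair (by norm_num)] at key
    norm_num at key
    exact key
  · intro n
    split_ifs with hn
    · simp only [Finset.mem_insert, Finset.mem_singleton] at hn
      rcases hn with rfl | rfl <;> norm_num [tendsto_const_nhds]
    · simp only [Finset.mem_insert, Finset.mem_singleton, not_or] at hn
      have hpos : (0 : ℝ) < (n : ℝ) ^ 2 + n := by
        have : 0 < n ^ 2 + n := by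
          have h1 := hn.1
          have h2 := hn.2
          rcases lt_or_ge 0 n with h | h
          · positivity
          · have : n ≤ -2 := by omega
            nlinarith
        exact_mod_cast this
      have : Tendsto (fun y : ℝ => -(Real.pi * ((n : ℝ) ^ 2 + n) * y)) atTop atBot :=
        tendsto_neg_atTop_atBot.comp (tendsto_id.const_mul_atTop (by positivity))
      simpa using (Real.tendsto_exp_atBot.comp this).const_mul |(2 * n + 1 : ℝ)|
  · filter_upwards [eventually_ge_atTop (1 : ℝ)] with y hy n
    rw [Real.norm_of_nonneg (by positivity)]
    have := hnn n
    gcongr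

/-- After scaling by exp(πy/4), the terms n = 0 and n = -1 of ϑ₁ contribute 2 sin πx, while |sin((2n
+ 1)πx)| ≤ |2n + 1| sin πx bounds the others. The threshold 4 counts the two leading terms once in
the series and once in the majorant. -/
lemma theta1_ne_zero_of_majorant {y : ℝ} (hy : 0 < y)
    (h : ∑' n : ℤ, |(2 * n + 1 : ℝ)| * Real.exp (-(Real.pi * (n ^ 2 + n) * y)) < 4)
    {x : ℝ} (hx : x ∈ Ioo (0 : ℝ) 1) : theta1 x (Complex.I * y) ≠ 0 := by
  intro h0
  have hsin : 0 < Real.sin (Real.pi * x) :=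
    Real.sin_pos_of_pos_of_lt_pi (by have := Real.pi_pos; have := hx.1; positivity)
      (by have := Real.pi_pos; have := hx.2; nlinarith)
  have hs := hasSum_theta2 ((x : ℂ) - 1 / 2) (im_I_mul_pos hy)
  rw [← theta1, h0] at hs
  have hre := (Complex.hasSum_re hs).mul_left (Real.exp (Real.pi * y / 4))
  have hterm : ∀ n : ℤ, Real.exp (Real.pi * y / 4) *
      (Complex.exp (Real.pi * Complex.I * ((n : ℂ) + 1 / 2) ^ 2 * (Complex.I * y)
      + 2 * Real.pi * Complex.I * ((n : ℂ) + 1 / 2) * (x - 1 / 2))).re =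
      Real.exp (-(Real.pi * (n ^ 2 + n) * y)) *
        ((-1) ^ n * Real.sin ((2 * n + 1 : ℤ) * (Real.pi * x))) := by
    intro n
    have e : Real.pi * Complex.I * ((n : ℂ) + 1 / 2) ^ 2 * (Complex.I * y)
      + 2 * Real.pi * Complex.I * ((n : ℂ) + 1 / 2) * (x - 1 / 2)
      = ((-(Real.pi * (n + 1 / 2) ^ 2 * y) : ℝ) : ℂ)
        + ((2 * Real.pi * (n + 1 / 2) * (x - 1 / 2) : ℝ) : ℂ) * Complex.I := by
      push_cast
      linear_combination (Real.pi * (n + 1 / 2) ^ 2 * y : ℂ) * Complex.I_sq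
    rw [e, Complex.exp_add, ← Complex.ofReal_exp, Complex.re_ofReal_mul,
      Complex.exp_ofReal_mul_I_re, cos_odd_mul_shift, ← mul_assoc, ← Real.exp_add]
    congr 2
    ring
  simp only [hterm, Complex.zero_re, mul_zero] at hre
  have hmaj := (summable_theta1_majorant hy).hasSum.mul_right (Real.sin (Real.pi * x))
  have hsum := hre.add hmaj
  have hnonneg : ∀ n : ℤ, 0 ≤ Real.exp (-(Real.pi * (n ^ 2 + n) * y)) *
        ((-1) ^ n * Real.sin ((2 * n + 1 : ℤ) * (Real.pi * x))) +
        |(2 * n + 1 : ℝ)| * Real.exp (-(Real.pi * (n ^ 2 + n) * y)) * Real.sin (Real.pi * x) := by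
    intro n
    have h1 := abs_sin_int_mul_le (2 * n + 1) (Real.pi * x)
    rw [abs_of_pos hsin] at h1
    have h2 : |((-1 : ℝ)) ^ n * Real.sin ((2 * n + 1 : ℤ) * (Real.pi * x))|
        ≤ |((2 * n + 1 : ℤ) : ℝ)| * Real.sin (Real.pi * x) := by
      rw [abs_mul, abs_zpow, abs_neg, abs_one, one_zpow, one_mul]
      exact h1
    have h3 := (abs_le.mp h2).1
    push_cast at h3 ⊢
    have h4 := mul_le_mul_of_nonneg_left h3 (Real.exp_pos (-(Real.pi * (n ^ 2 + n) * y))).le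
    linarith
  -- At a zero of ϑ₁ the series plus the majorant sums to the majorant times sin πx alone; its two
  -- leading nonnegative terms already give 4 sin πx.
  have hle := sum_le_hasSum {0, -1} (fun n _ => hnonneg n) hsum
  rw [Finset.sum_pair (by norm_num)] at hle
  have e1 : Real.sin (-(Real.pi * x)) = -Real.sin (Real.pi * x) := Real.sin_neg _
  norm_num [e1] at hle
  nlinarith

/-- On (0, 1/2) a zero would contradict the duplication formula, since 2x lies in (0, 1). The
symmetry x ↦ 1 - x covers (1/2, 1), and ϑ₁(1/2) = ϑ₂(0) > 0. -/
lemma theta1_double_ne_zero {y : ℝ} (hy : 0 < y)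
    (h : ∀ x ∈ Ioo (0 : ℝ) 1, theta1 x (Complex.I * ((2 * y : ℝ) : ℂ)) ≠ 0) :
    ∀ x ∈ Ioo (0 : ℝ) 1, theta1 x (Complex.I * y) ≠ 0 := by
  have half : ∀ x ∈ Ioo (0 : ℝ) (1 / 2), theta1 x (Complex.I * y) ≠ 0 := by
    intro x hx h0
    have hd := theta1_sq_mul_theta2_sq (x : ℂ) (im_I_mul_pos hy)
    rw [h0, two_mul_I_mul] at hd
    obtain ⟨r, hr, h4⟩ := theta4_real_pos 0 (y := 2 * y) (by positivity)
    have h1 := h (2 * x) ⟨by linarith [hx.1], by linarith [hx.2]⟩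
    rw [Complex.ofReal_zero] at h4
    rw [h4] at hd
    push_cast at hd h1
    have hr' : (r : ℂ) ≠ 0 := by exact_mod_cast hr.ne'
    simp [h1, hr'] at hd
  intro x hx
  rcases lt_trichotomy x (1 / 2) with h1 | h1 | h1
  · exact half x ⟨hx.1, h1⟩
  · obtain ⟨r, hr, h2⟩ := theta2_imaginary_pos 0 hy
    subst h1
    rw [theta1]
    simp only [Complex.ofReal_zero, mul_zero] at h2
    norm_num [h2, hr.ne']
  · have := half (1 - x) ⟨by linarith [hx.2], by linarith⟩
    push_cast at this
    rwa [theta1_one_sub] at this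

/-- `ϑ₁(x | i y)` has no zeros with `0 < x < 1`. -/
lemma theta1_ne_zero {y : ℝ} (hy : 0 < y) :
    ∀ x ∈ Ioo (0 : ℝ) 1, theta1 x (Complex.I * y) ≠ 0 := by
  have hev := tendsto_theta1_majorant.eventually_lt_const (show (2 : ℝ) < 4 by norm_num)
  obtain ⟨Y, hY⟩ := eventually_atTop.mp hev
  -- For large y the majorant criterion applies; smaller y are reached by halving the parameter k
  -- times.
  have hk : ∀ k : ℕ, ∀ y : ℝ, 0 < y → Y ≤ 2 ^ k * y →
      ∀ x ∈ Ioo (0 : ℝ) 1, theta1 x (Complex.I * y) ≠ 0 := by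
    intro k
    induction k with
    | zero =>
      intro y hy h x hx
      exact theta1_ne_zero_of_majorant hy (hY y (by simpa using h)) hx
    | succ k ih =>
      intro y hy h
      refine theta1_double_ne_zero hy (ih (2 * y) (by positivity) ?_)
      rw [pow_succ] at h
      linarith
  obtain ⟨k, hk'⟩ := pow_unbounded_of_one_lt (Y / y) (show (1 : ℝ) < 2 by norm_num)
  exact hk k y hy ((div_le_iff₀ hy).mp hk'.le)

lemma theta1_eq_zero_iff (z τ : ℂ) :
    theta1 z τ = 0 ↔ jacobiTheta₂ (z + 1 / 2 + τ / 2) τ = 0 := by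
  have e : z + 1 / 2 + τ / 2 = (z - 1 / 2 + τ / 2) + 1 := by ring
  rw [e, jacobiTheta₂_add_left, theta1, theta2]
  simp [Complex.exp_ne_zero]

/-- `ϑ₁(i s | i y)` has no zeros with `0 < s < y`. -/
lemma theta1_imaginary_ne_zero {y s : ℝ} (hs : s ∈ Ioo 0 y) :
    theta1 (Complex.I * s) (Complex.I * y) ≠ 0 := by
  have hy : 0 < y := hs.1.trans hs.2
  have hy' : (y : ℂ) ≠ 0 := by exact_mod_cast hy.ne'
  have h := theta1_ne_zero (y := 1 / y) (by positivity) (s / y)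
    ⟨div_pos hs.1 hy, (div_lt_one hy).mpr hs.2⟩
  rw [Ne, theta1_eq_zero_iff] at h ⊢
  intro h0
  apply h
  -- The imaginary transformation turns a zero at is for parameter iy into one at s/y for parameter
  -- i/y, up to quasi-periods, and 0 < s/y < 1.
  rw [jacobiTheta₂_I_mul _ hy] at h0
  have hc : ((1 / √y : ℝ) : ℂ) ≠ 0 := by
    have : 1 / √y ≠ 0 := by positivity
    exact_mod_cast this
  simp only [mul_eq_zero, hc, Complex.exp_ne_zero, false_or] at h0
  rw [← jacobiTheta₂_neg_left, ← jacobiTheta₂_sub_one] at h0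
  have h2 := jacobiTheta₂_add_left' ((s / y : ℝ) + 1 / 2 + (Complex.I * ((1 / y : ℝ) : ℂ)) / 2 -
    (Complex.I * ((1 / y : ℝ) : ℂ))) (Complex.I * ((1 / y : ℝ) : ℂ))
  rw [sub_add_cancel] at h2
  rw [h2]
  refine mul_eq_zero_of_right _ ?_
  rw [← jacobiTheta₂_sub_one, ← h0]
  congr 1
  have := Complex.I_sq
  push_cast
  field_simp
  linear_combination (2 * s + y) * Complex.I_sq

/-! ### The quotient `ϑ₄ / ϑ₃` -/

/-- `ϑ₄(z | i y) / ϑ₃(z | i y)`. -/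
def thetaQuot (y : ℝ) (z : ℂ) : ℂ :=
  theta4 z (Complex.I * y) / jacobiTheta₂ z (Complex.I * y)

/-- The restriction of `thetaQuot y` to the real axis. -/
def thetaQuotReal (y x : ℝ) : ℝ := (thetaQuot y x).re

/-- The restriction of `thetaQuot y` to the imaginary axis. -/
def thetaQuotImag (y s : ℝ) : ℝ := (thetaQuot y (Complex.I * s)).re

/-- A complex derivative of a function that is real on the real axis is itself real there, so
complex identities for it can be read as real ones. -/
lemma hasDerivAt_re_of_real {f : ℂ → ℂ} {g : ℝ → ℝ} (hfg : ∀ x : ℝ, f x = g x) {v : ℂ} {x : ℝ}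
    (h : HasDerivAt f v x) : HasDerivAt g v.re x ∧ v = v.re := by
  have h1 : HasDerivAt g v.re x := by
    have := h.real_of_complex
    simpa only [hfg, Complex.ofReal_re] using this
  refine ⟨h1, ?_⟩
  have h2 := h.comp_ofReal
  simp only [hfg] at h2
  exact h2.unique h1.ofReal_comp

variable {y : ℝ}

lemma jacobiTheta₂_real_ne_zero (hy : 0 < y) (x : ℝ) :
    jacobiTheta₂ x (Complex.I * y) ≠ 0 := by
  obtain ⟨r, hr, h⟩ := jacobiTheta₂_real_pos x hy
  rw [h]
  exact_mod_cast hr.ne'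

lemma jacobiTheta₂_imaginary_ne_zero (hy : 0 < y) (s : ℝ) :
    jacobiTheta₂ (Complex.I * s) (Complex.I * y) ≠ 0 := by
  obtain ⟨r, hr, h⟩ := jacobiTheta₂_imaginary_pos s hy
  rw [h]
  exact_mod_cast hr.ne'

lemma thetaQuot_ofReal (hy : 0 < y) (x : ℝ) : thetaQuot y x = thetaQuotReal y x := by
  obtain ⟨r, -, h⟩ := jacobiTheta₂_real_pos x hy
  obtain ⟨q, -, h'⟩ := theta4_real_pos x hy
  rw [thetaQuotReal, thetaQuot, h, h', ← Complex.ofReal_div, Complex.ofReal_re]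

lemma thetaQuotReal_pos (hy : 0 < y) (x : ℝ) : 0 < thetaQuotReal y x := by
  obtain ⟨r, hr, h⟩ := jacobiTheta₂_real_pos x hy
  obtain ⟨q, hq, h'⟩ := theta4_real_pos x hy
  rw [thetaQuotReal, thetaQuot, h, h', ← Complex.ofReal_div, Complex.ofReal_re]
  positivity

lemma thetaQuot_I_mul (hy : 0 < y) (s : ℝ) :
    thetaQuot y (Complex.I * s) = thetaQuotImag y s := by
  obtain ⟨r, -, h⟩ := jacobiTheta₂_imaginary_pos s hy
  obtain ⟨q, h'⟩ := theta4_imaginary_real s y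
  rw [thetaQuotImag, thetaQuot, h, h', ← Complex.ofReal_div, Complex.ofReal_re]

/-- The half-period shift exchanges ϑ₃ and ϑ₄, so it inverts the quotient. -/
lemma thetaQuotReal_half (hy : 0 < y) : thetaQuotReal y (1 / 2) = (thetaQuotReal y 0)⁻¹ := by
  have h1 : thetaQuot y ((1 / 2 : ℝ) : ℂ) = (thetaQuot y ((0 : ℝ) : ℂ))⁻¹ := by
    have e : (1 / 2 : ℂ) + 1 / 2 = 0 + 1 := by norm_num
    simp only [thetaQuot, theta4]
    push_cast
    rw [e, jacobiTheta₂_add_left, inv_div, zero_add]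
  rw [thetaQuot_ofReal hy, thetaQuot_ofReal hy] at h1
  exact_mod_cast h1

lemma thetaQuotImag_zero (y : ℝ) : thetaQuotImag y 0 = thetaQuotReal y 0 := by
  simp [thetaQuotImag, thetaQuotReal]

/-- Under the quasi-period iy the multipliers of ϑ₃ and ϑ₄ differ by the factor exp(-πi) = -1. -/
lemma thetaQuotImag_self (hy : 0 < y) : thetaQuotImag y y = -thetaQuotReal y 0 := by
  have h1 : thetaQuot y (Complex.I * y) = -(thetaQuot y ((0 : ℝ) : ℂ)) := by
    have a1 := jacobiTheta₂_add_left' (1 / 2) (Complex.I * y)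
    have a0 := jacobiTheta₂_add_left' 0 (Complex.I * y)
    have e : -(Real.pi : ℂ) * Complex.I * (Complex.I * y + 2 * (1 / 2)) =
      -(Real.pi : ℂ) * Complex.I * (Complex.I * y + 2 * 0) + -(Real.pi * Complex.I) := by ring
    have e2 : Complex.exp (-(Real.pi * Complex.I)) = -1 := by
      rw [Complex.exp_neg, Complex.exp_pi_mul_I]; norm_num
    rw [e, Complex.exp_add, e2, add_comm] at a1
    rw [zero_add] at a0
    simp only [thetaQuot, theta4]
    rw [a0, a1, Complex.ofReal_zero, zero_add]
    have := Complex.exp_ne_zero (-(Real.pi : ℂ) * Complex.I * (Complex.I * y + 2 * 0))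
    have h3 := jacobiTheta₂_real_ne_zero hy 0
    rw [Complex.ofReal_zero] at h3
    field_simp
  rw [thetaQuot_ofReal hy, thetaQuot_I_mul hy] at h1
  exact_mod_cast h1

/-- The difference of the squares of the theta constants ϑ₃ and ϑ₄ is 2 ϑ₂(0 | 2τ)² > 0. -/
lemma thetaQuotReal_zero_lt_one (hy : 0 < y) : thetaQuotReal y 0 < 1 := by
  have hpos := thetaQuotReal_pos hy 0
  have h3 := jacobiTheta₂_real_ne_zero hy 0
  have e3 := jacobiTheta₂_sq 0 (im_I_mul_pos hy)
  have e4 := theta4_sq 0 (im_I_mul_pos hy)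
  obtain ⟨β, hβ, hb⟩ := theta2_imaginary_pos 0 (y := 2 * y) (by positivity)
  obtain ⟨r, hr, h⟩ := jacobiTheta₂_real_pos 0 hy
  obtain ⟨q, hq, h'⟩ := theta4_real_pos 0 hy
  simp only [Complex.ofReal_zero, mul_zero] at hb h h' e3 e4
  rw [two_mul_I_mul, hb] at e3 e4
  rw [h] at e3
  rw [h'] at e4
  have e : ((r ^ 2 - q ^ 2 : ℝ) : ℂ) = ((2 * (β * β) : ℝ) : ℂ) := by
    push_cast
    linear_combination e3 - e4
  have e' := Complex.ofReal_injective e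
  have hlt : q < r := by
    have : 0 < β * β := by positivity
    nlinarith
  have hD : thetaQuotReal y 0 = q / r := by
    rw [thetaQuotReal, thetaQuot, Complex.ofReal_zero, h, h', ← Complex.ofReal_div,
      Complex.ofReal_re]
  rw [hD]
  exact (div_lt_one hr).mpr hlt

lemma hasDerivAt_thetaQuot (hy : 0 < y) {z : ℂ} (hz : jacobiTheta₂ z (Complex.I * y) ≠ 0) :
    HasDerivAt (thetaQuot y)
      (2 * deriv (fun u => theta1 u (2 * (Complex.I * y))) 0 * theta1 (2 * z) (2 * (Complex.I * y))
        / jacobiTheta₂ z (Complex.I * y) ^ 2) z := by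
  have hτ := im_I_mul_pos hy
  have h : HasDerivAt (thetaQuot y) _ z := (differentiableAt_theta4 z hτ).hasDerivAt.div
    (differentiableAt_jacobiTheta₂_fst z hτ).hasDerivAt hz
  have e := jacobiTheta₂_wronskian z hτ
  rw [← e]
  convert h using 2
  ring

/-- By the Wronskian the derivative is a multiple of ϑ₁(2z | 2τ)/ϑ₃(z)². The square of ϑ₁ is a
difference of squares in ϑ₃(2z | 2τ) and ϑ₂(2z | 2τ), whose two linear factors are the two factors
on the right. -/
lemma exists_thetaQuot_deriv_sq (hy : 0 < y) : ∃ M : ℝ,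
    ∀ z : ℂ, jacobiTheta₂ z (Complex.I * y) ≠ 0 →
      (2 * deriv (fun u => theta1 u (2 * (Complex.I * y))) 0 * theta1 (2 * z) (2 * (Complex.I * y))
        / jacobiTheta₂ z (Complex.I * y) ^ 2) ^ 2 =
      (M : ℂ) ^ 2 * (thetaQuot y z ^ 2 - (thetaQuotReal y 0 : ℂ) ^ 2) *
        (1 - (thetaQuotReal y 0 : ℂ) ^ 2 * thetaQuot y z ^ 2) := by
  have hτ := im_I_mul_pos hy
  have hy2 : 0 < 2 * y := by positivity
  obtain ⟨w, hw⟩ : ∃ w : ℝ, deriv (fun u => theta1 u (2 * (Complex.I * y))) 0 = w := by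
    choose g hg using fun x : ℝ => theta1_ofReal x (2 * y)
    have hd := (differentiableAt_theta1 ((0 : ℝ) : ℂ) (im_I_mul_pos hy2)).hasDerivAt
    rw [two_mul_I_mul]
    exact ⟨_, (hasDerivAt_re_of_real hg hd).2⟩
  obtain ⟨α, hα, ha⟩ := jacobiTheta₂_imaginary_pos 0 hy2
  obtain ⟨β, hβ, hb⟩ := theta2_imaginary_pos 0 hy2
  obtain ⟨k, hk, hk4⟩ := theta4_real_pos 0 hy2
  simp only [Complex.ofReal_zero, mul_zero] at ha hb hk4
  rw [← two_mul_I_mul] at ha hb hk4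
  have hδ : (thetaQuotReal y 0 : ℂ) ^ 2 * (α ^ 2 + β ^ 2) = α ^ 2 - β ^ 2 := by
    have h3 := jacobiTheta₂_sq 0 hτ
    have h4 := theta4_sq 0 hτ
    have hne := jacobiTheta₂_real_ne_zero hy 0
    rw [mul_zero, ha, hb] at h3 h4
    rw [← thetaQuot_ofReal hy, thetaQuot, Complex.ofReal_zero]
    rw [Complex.ofReal_zero] at hne
    have : (α : ℂ) ^ 2 + β ^ 2 = jacobiTheta₂ 0 (Complex.I * y) ^ 2 := by rw [h3]; ring
    rw [this, div_pow, div_mul_cancel₀ _ (pow_ne_zero 2 hne), h4]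
    ring
  refine ⟨w * (α ^ 2 + β ^ 2) / (k * α * β), fun z hz => ?_⟩
  have hτ2 : 0 < (2 * (Complex.I * (y : ℂ))).im := by simpa using hy
  have h1 := theta1_sq_mul_theta4_zero_sq (2 * z) hτ2
  have h3 := jacobiTheta₂_sq z hτ
  have h4 := theta4_sq z hτ
  rw [ha, hb] at h3 h4 h1
  rw [hk4] at h1
  rw [hw, thetaQuot]
  set t := jacobiTheta₂ z (Complex.I * y)
  set f := theta4 z (Complex.I * y)
  set A := jacobiTheta₂ (2 * z) (2 * (Complex.I * y))
  set B := theta2 (2 * z) (2 * (Complex.I * y))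
  set θ := theta1 (2 * z) (2 * (Complex.I * y))
  set δ : ℂ := (thetaQuotReal y 0 : ℂ)
  have hα' : (α : ℂ) ≠ 0 := by exact_mod_cast hα.ne'
  have hβ' : (β : ℂ) ≠ 0 := by exact_mod_cast hβ.ne'
  have hk' : (k : ℂ) ≠ 0 := by exact_mod_cast hk.ne'
  -- These are the linear factors Aβ - Bα and Aβ + Bα of A²β² - B²α² = θ²k².
  have p1 : ((α : ℂ) ^ 2 + β ^ 2) * (f ^ 2 - δ ^ 2 * t ^ 2) = 2 * α * β * (A * β - B * α) := by
    rw [h3, h4]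
    linear_combination (-(A * α + B * β)) * hδ
  have p2 : ((α : ℂ) ^ 2 + β ^ 2) * (t ^ 2 - δ ^ 2 * f ^ 2) = 2 * α * β * (A * β + B * α) := by
    rw [h3, h4]
    linear_combination (-(A * α - B * β)) * hδ
  push_cast
  have q1 : (f / t) ^ 2 - δ ^ 2 = (f ^ 2 - δ ^ 2 * t ^ 2) / t ^ 2 := by field_simp
  have q2 : 1 - δ ^ 2 * (f / t) ^ 2 = (t ^ 2 - δ ^ 2 * f ^ 2) / t ^ 2 := by field_simp
  rw [q1, q2]
  have : (w * ((α : ℂ) ^ 2 + β ^ 2) / (k * α * β)) ^ 2 * ((f ^ 2 - δ ^ 2 * t ^ 2) / t ^ 2) *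
      ((t ^ 2 - δ ^ 2 * f ^ 2) / t ^ 2)
      = w ^ 2 / (k * α * β) ^ 2 / t ^ 4 * ((((α : ℂ) ^ 2 + β ^ 2) * (f ^ 2 - δ ^ 2 * t ^ 2)) *
        (((α : ℂ) ^ 2 + β ^ 2) * (t ^ 2 - δ ^ 2 * f ^ 2))) := by
    field_simp
  rw [this, p1, p2]
  field_simp
  linear_combination (w : ℂ) ^ 2 * h1

/-- The differential equations of `ϑ₄ / ϑ₃` on the real and on the imaginary axis. -/
lemma exists_thetaQuot_frequency (hy : 0 < y) : ∃ M : ℝ, 0 < M ∧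
    (∀ x, (deriv (thetaQuotReal y) x) ^ 2 = M ^ 2 * (thetaQuotReal y x ^ 2 - thetaQuotReal y 0 ^ 2) *
      (1 - thetaQuotReal y 0 ^ 2 * thetaQuotReal y x ^ 2)) ∧
    (∀ x ∈ Ioo (0 : ℝ) (1 / 2), deriv (thetaQuotReal y) x ≠ 0) ∧
    (∀ s, DifferentiableAt ℝ (thetaQuotImag y) s) ∧
    (∀ s, (deriv (thetaQuotImag y) s) ^ 2 = M ^ 2 * (thetaQuotReal y 0 ^ 2 - thetaQuotImag y s ^ 2) *
      (1 - thetaQuotReal y 0 ^ 2 * thetaQuotImag y s ^ 2)) ∧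
    (∀ s ∈ Ioo (0 : ℝ) y, deriv (thetaQuotImag y) s ≠ 0) := by
  obtain ⟨M, hM⟩ := exists_thetaQuot_deriv_sq hy
  have hr : ∀ x : ℝ, _ := fun x => hasDerivAt_re_of_real (thetaQuot_ofReal hy)
    (hasDerivAt_thetaQuot hy (jacobiTheta₂_real_ne_zero hy x))
  have hi : ∀ s : ℝ, _ := fun s => hasDerivAt_re_of_real (f := fun u => thetaQuot y (Complex.I * u))
    (thetaQuot_I_mul hy) ((hasDerivAt_thetaQuot hy (jacobiTheta₂_imaginary_ne_zero hy s)).comp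
      (s : ℂ) (by simpa using (hasDerivAt_id (s : ℂ)).const_mul Complex.I))
  have hr2 : ∀ x, (deriv (thetaQuotReal y) x) ^ 2 =
      M ^ 2 * (thetaQuotReal y x ^ 2 - thetaQuotReal y 0 ^ 2) *
      (1 - thetaQuotReal y 0 ^ 2 * thetaQuotReal y x ^ 2) := by
    intro x
    have h := hM x (jacobiTheta₂_real_ne_zero hy x)
    rw [(hr x).2, ← (hr x).1.deriv, thetaQuot_ofReal hy] at h
    exact_mod_cast h
  -- If this theta constant vanished, the quotient would be constant on the real axis, although it
  -- goes from δ < 1 at 0 to 1/δ > 1 at 1/2.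
  have hw : deriv (fun u => theta1 u (2 * (Complex.I * y))) 0 ≠ 0 := by
    intro hw
    have hconst : ∀ x, deriv (thetaQuotReal y) x = 0 := by
      intro x
      rw [(hr x).1.deriv, hw]
      simp
    have := is_const_of_deriv_eq_zero (fun x => (hr x).1.differentiableAt) hconst 0 (1 / 2)
    rw [thetaQuotReal_half hy] at this
    have h0 := thetaQuotReal_pos hy 0
    have h1 := thetaQuotReal_zero_lt_one hy
    have := one_lt_inv₀ h0 |>.mpr h1
    linarith
  have hy2 : 0 < 2 * y := by positivity
  have hrne : ∀ x ∈ Ioo (0 : ℝ) (1 / 2), deriv (thetaQuotReal y) x ≠ 0 := by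
    intro x hx h0
    have h1 := theta1_ne_zero hy2 (2 * x) ⟨by linarith [hx.1], by linarith [hx.2]⟩
    have h2 := (hr x).2
    rw [← (hr x).1.deriv, h0, two_mul_I_mul] at h2
    rw [two_mul_I_mul] at hw
    push_cast at h1 h2 hw
    have h3 := jacobiTheta₂_real_ne_zero hy x
    simp [h1, h3, hw] at h2
  have hM0 : M ≠ 0 := by
    intro hM0
    have := hr2 (1 / 4)
    rw [hM0] at this
    exact hrne (1 / 4) (by norm_num) (by simpa using this)
  refine ⟨|M|, abs_pos.mpr hM0, ?_, hrne, fun s => (hi s).1.differentiableAt, ?_, ?_⟩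
  · simpa only [sq_abs] using hr2
  · intro s
    have h := hM (Complex.I * s) (jacobiTheta₂_imaginary_ne_zero hy s)
    have h2 := (hi s).2
    rw [← (hi s).1.deriv] at h2
    rw [thetaQuot_I_mul hy] at h
    -- The chain rule along z = is contributes I² = -1, which reverses one factor.
    have h3 : ((deriv (thetaQuotImag y) s : ℝ) : ℂ) ^ 2 =
        -((M : ℂ) ^ 2 * ((thetaQuotImag y s : ℂ) ^ 2 - (thetaQuotReal y 0 : ℂ) ^ 2) *
        (1 - (thetaQuotReal y 0 : ℂ) ^ 2 * (thetaQuotImag y s : ℂ) ^ 2)) := by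
      rw [← h, ← h2, mul_pow, Complex.I_sq]
      ring
    rw [sq_abs]
    have h4 : (deriv (thetaQuotImag y) s) ^ 2 = -(M ^ 2 * (thetaQuotImag y s ^ 2
        - thetaQuotReal y 0 ^ 2) * (1 - thetaQuotReal y 0 ^ 2 * thetaQuotImag y s ^ 2)) := by
      exact_mod_cast h3
    rw [h4]
    ring
  · intro s hs h0
    have h1 := theta1_imaginary_ne_zero (y := 2 * y) (s := 2 * s)
      ⟨by linarith [hs.1], by linarith [hs.2]⟩
    have h2 := (hi s).2
    rw [← (hi s).1.deriv, h0, two_mul_I_mul] at h2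
    rw [two_mul_I_mul] at hw
    have e : Complex.I * ((2 * s : ℝ) : ℂ) = 2 * (Complex.I * s) := by push_cast; ring
    rw [e] at h1
    have h3 := jacobiTheta₂_imaginary_ne_zero hy s
    push_cast at h1 h2 hw
    simp [h1, h3, hw] at h2

lemma analyticAt_thetaQuotReal (hy : 0 < y) (x : ℝ) : AnalyticAt ℝ (thetaQuotReal y) x := by
  have h4 : Differentiable ℂ fun u => theta4 u (Complex.I * y) :=
    fun u => differentiableAt_theta4 u (im_I_mul_pos hy)
  have h3 : Differentiable ℂ fun u => jacobiTheta₂ u (Complex.I * y) :=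
    fun u => differentiableAt_jacobiTheta₂_fst u (im_I_mul_pos hy)
  exact ((h4.analyticAt x).div (h3.analyticAt x) (jacobiTheta₂_real_ne_zero hy x)).re_ofReal

/-- Differentiating the first-order equation and cancelling 2d' is legitimate only where d' ≠ 0, for
instance on (0, 1/2). Both sides are analytic, so the identity extends to the whole line. -/
lemma deriv_deriv_thetaQuotReal (hy : 0 < y) {M : ℝ}
    (h1 : ∀ x, (deriv (thetaQuotReal y) x) ^ 2 =
      M ^ 2 * (thetaQuotReal y x ^ 2 - thetaQuotReal y 0 ^ 2) *
      (1 - thetaQuotReal y 0 ^ 2 * thetaQuotReal y x ^ 2))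
    (h2 : ∀ x ∈ Ioo (0 : ℝ) (1 / 2), deriv (thetaQuotReal y) x ≠ 0) (x : ℝ) :
    deriv (deriv (thetaQuotReal y)) x = M ^ 2 * ((1 + thetaQuotReal y 0 ^ 4) * thetaQuotReal y x
      - 2 * thetaQuotReal y 0 ^ 2 * thetaQuotReal y x ^ 3) := by
  set d := thetaQuotReal y with hd
  set δ := d 0
  have ha : ∀ x, AnalyticAt ℝ d x := analyticAt_thetaQuotReal hy
  have key : ∀ x ∈ Ioo (0 : ℝ) (1 / 2), deriv (deriv d) x =
      M ^ 2 * ((1 + δ ^ 4) * d x - 2 * δ ^ 2 * d x ^ 3) := by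
    intro x hx
    have e1 := (ha x).differentiableAt.hasDerivAt
    have e2 := (ha x).deriv.differentiableAt.hasDerivAt
    have l := e2.pow 2
    have r := (((e1.pow 2).sub_const (δ ^ 2)).const_mul (M ^ 2)).mul
      (((e1.pow 2).const_mul (δ ^ 2)).const_sub 1)
    have := l.unique (r.congr_of_eventuallyEq (Eventually.of_forall h1))
    apply mul_left_cancel₀ (mul_ne_zero two_ne_zero (h2 x hx))
    norm_num at this
    linear_combination this
  have heq : EqOn (deriv (deriv d)) (fun x => M ^ 2 * ((1 + δ ^ 4) * d x - 2 * δ ^ 2 * d x ^ 3))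
      univ := by
    refine AnalyticOnNhd.eqOn_of_preconnected_of_eventuallyEq (z₀ := 1 / 4)
      (fun x _ => (ha x).deriv.deriv) (fun x _ => ?_) isPreconnected_univ (mem_univ _) ?_
    · have := ha x
      fun_prop
    · filter_upwards [Ioo_mem_nhds (show (0 : ℝ) < 1 / 4 by norm_num)
        (show (1 / 4 : ℝ) < 1 / 2 by norm_num)] with x hx
      exact key x hx
  exact heq (mem_univ x)

/-! ### The inversion problem -/

lemma continuousOn_thetaQuotReal_zero : ContinuousOn (fun y => thetaQuotReal y 0) (Ioi 0) := by
  intro y hy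
  refine ContinuousAt.continuousWithinAt ?_
  have hc : ∀ z : ℂ, ContinuousAt (fun y : ℝ => jacobiTheta₂ z (Complex.I * y)) y := fun z =>
    ContinuousAt.comp (f := fun y : ℝ => (z, Complex.I * (y : ℂ)))
      (continuousAt_jacobiTheta₂ z (im_I_mul_pos hy)) (by fun_prop)
  have h3 := jacobiTheta₂_real_ne_zero hy 0
  exact Complex.continuous_re.continuousAt.comp ((hc _).div (hc _) h3)

lemma tendsto_thetaQuotReal_zero_atTop : Tendsto (fun y => thetaQuotReal y 0) atTop (𝓝 1) := by
  have hc : ∀ z : ℂ, Tendsto (fun y : ℝ => jacobiTheta₂ z (Complex.I * (y : ℂ))) atTop (𝓝 1) :=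
    fun z => tendsto_jacobiTheta₂_one (u := fun _ => z) (S := |z.im|) tendsto_id
      (Eventually.of_forall fun _ => le_rfl)
  have := (hc (((0 : ℝ) : ℂ) + 1 / 2)).div (hc ((0 : ℝ) : ℂ)) one_ne_zero
  rw [div_one] at this
  exact (Complex.continuous_re.tendsto _).comp this

/-- The imaginary transformation sends ϑ₄/ϑ₃ to ϑ₂/ϑ₃ at the reciprocal parameter, so the limit y →
0 becomes a limit at infinity. -/
lemma thetaQuot_zero_eq (hy : 0 < y) : thetaQuot y 0 =
    theta2 0 (Complex.I * ((1 / y : ℝ) : ℂ)) / jacobiTheta₂ 0 (Complex.I * ((1 / y : ℝ) : ℂ)) := by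
  have hy' : (y : ℂ) ≠ 0 := by exact_mod_cast hy.ne'
  have hc : ((1 / √y : ℝ) : ℂ) ≠ 0 := by
    have : 1 / √y ≠ 0 := by positivity
    exact_mod_cast this
  rw [thetaQuot, theta4, jacobiTheta₂_I_mul _ hy, jacobiTheta₂_I_mul 0 hy, theta2]
  have e1 : Complex.I * ((0 + 1 / 2) / (y : ℂ)) = 0 + Complex.I * ((1 / y : ℝ) : ℂ) / 2 := by
    push_cast; ring
  have e2 : Complex.I * (0 / (y : ℂ)) = 0 := by ring
  have e3 : (-Real.pi * (0 + 1 / 2) ^ 2 / y : ℂ)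
      = Real.pi * Complex.I * (Complex.I * ((1 / y : ℝ) : ℂ) / 4 + 0) := by
    push_cast
    linear_combination (-Real.pi / (4 * y) : ℂ) * Complex.I_sq
  have e4 : Complex.exp (-Real.pi * 0 ^ 2 / y) = 1 := by simp
  rw [e1, e2, e3, e4, mul_one, mul_assoc, mul_div_mul_left _ _ hc]

lemma tendsto_thetaQuotReal_zero_nhdsGT :
    Tendsto (fun y => thetaQuotReal y 0) (𝓝[>] 0) (𝓝 0) := by
  have hinv : Tendsto (fun y : ℝ => 1 / y) (𝓝[>] 0) atTop := by
    simpa only [one_div] using tendsto_inv_nhdsGT_zero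
  have h2 := tendsto_theta2_zero (u := fun _ => 0) (S := 0) hinv (by simp)
  have h3 := tendsto_jacobiTheta₂_one (u := fun _ => 0) (S := 0) hinv (by simp)
  have := h2.div h3 one_ne_zero
  rw [zero_div] at this
  refine ((Complex.continuous_re.tendsto _).comp this).congr' ?_
  filter_upwards [self_mem_nhdsWithin] with y hy
  rw [thetaQuotReal, Complex.ofReal_zero, thetaQuot_zero_eq hy]
  rfl

/-- Intermediate values between the limits 0 at y → 0 and 1 at y → ∞. -/
lemma exists_thetaQuotReal_zero_eq {v : ℝ} (hv : v ∈ Ioo (0 : ℝ) 1) :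
    ∃ y, 0 < y ∧ thetaQuotReal y 0 = v := by
  obtain ⟨y₁, h₁, hy₁⟩ := ((tendsto_thetaQuotReal_zero_nhdsGT.eventually_lt_const hv.1).and
    self_mem_nhdsWithin).exists
  obtain ⟨y₂, h₂, hy₂⟩ := ((tendsto_thetaQuotReal_zero_atTop.eventually_const_lt hv.2).and
    (eventually_gt_atTop 0)).exists
  obtain ⟨y, hy, h⟩ := isPreconnected_Ioi.intermediate_value hy₁ hy₂
    continuousOn_thetaQuotReal_zero ⟨h₁.le, h₂.le⟩
  exact ⟨y, hy, h⟩

/-! ### Substitution in possibly improper integrals -/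

-- Differentiability is required only inside the interval and nothing is assumed of g, so the
-- formula applies to integrands with endpoint singularities.
open MeasureTheory in
lemma setIntegral_image_of_strictMonoOn {f : ℝ → ℝ} {p q : ℝ} (hpq : p < q)
    (hc : ContinuousOn f (Icc p q)) (hd : ∀ x ∈ Ioo p q, DifferentiableAt ℝ f x)
    (hm : StrictMonoOn f (Icc p q)) (g : ℝ → ℝ) :
    ∫ t in Ioo (f p) (f q), g t = ∫ x in Ioo p q, |deriv f x| * g (f x) := by
  have himg : f '' Ioo p q = Ioo (f p) (f q) := by
    refine Subset.antisymm ?_ (intermediate_value_Ioo hpq.le hc)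
    rintro _ ⟨x, hx, rfl⟩
    exact ⟨hm (left_mem_Icc.mpr hpq.le) (Ioo_subset_Icc_self hx) hx.1,
      hm (Ioo_subset_Icc_self hx) (right_mem_Icc.mpr hpq.le) hx.2⟩
  rw [← himg]
  exact integral_image_eq_integral_abs_deriv_smul measurableSet_Ioo
    (fun x hx => (hd x hx).hasDerivAt.hasDerivWithinAt) (hm.injOn.mono Ioo_subset_Icc_self) g

open MeasureTheory in
lemma setIntegral_image_of_strictAntiOn {f : ℝ → ℝ} {p q : ℝ} (hpq : p < q)
    (hc : ContinuousOn f (Icc p q)) (hd : ∀ x ∈ Ioo p q, DifferentiableAt ℝ f x)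
    (hm : StrictAntiOn f (Icc p q)) (g : ℝ → ℝ) :
    ∫ t in Ioo (f q) (f p), g t = ∫ x in Ioo p q, |deriv f x| * g (f x) := by
  have himg : f '' Ioo p q = Ioo (f q) (f p) := by
    refine Subset.antisymm ?_ (intermediate_value_Ioo' hpq.le hc)
    rintro _ ⟨x, hx, rfl⟩
    exact ⟨hm (Ioo_subset_Icc_self hx) (right_mem_Icc.mpr hpq.le) hx.2,
      hm (left_mem_Icc.mpr hpq.le) (Ioo_subset_Icc_self hx) hx.1⟩
  rw [← himg]
  exact integral_image_eq_integral_abs_deriv_smul measurableSet_Ioo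
    (fun x hx => (hd x hx).hasDerivAt.hasDerivWithinAt) (hm.injOn.mono Ioo_subset_Icc_self) g

/-- By Darboux's theorem a derivative without zeros has constant sign; its continuity is not needed.
-/
lemma strictMonoOn_or_strictAntiOn_of_deriv_ne_zero {f : ℝ → ℝ} {p q : ℝ}
    (hc : ContinuousOn f (Icc p q)) (hd : ∀ x ∈ Ioo p q, DifferentiableAt ℝ f x)
    (hne : ∀ x ∈ Ioo p q, deriv f x ≠ 0) :
    StrictMonoOn f (Icc p q) ∨ StrictAntiOn f (Icc p q) := by
  rcases hasDerivWithinAt_forall_lt_or_forall_gt_of_forall_ne (convex_Ioo p q)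
    (fun x hx => (hd x hx).hasDerivAt.hasDerivWithinAt) hne with h | h
  · right
    refine strictAntiOn_of_deriv_neg (convex_Icc p q) hc fun x hx => h x ?_
    rwa [interior_Icc] at hx
  · left
    refine strictMonoOn_of_deriv_pos (convex_Icc p q) hc fun x hx => h x ?_
    rwa [interior_Icc] at hx

/-- If T is the derivative of a substitution and satisfies T² = K² X, the pulled-back elliptic
integrand is the constant K, and the integral is K times a length. -/
lemma abs_mul_one_div_sqrt {T X K : ℝ} (hK : 0 < K) (hT : T ≠ 0) (h : T ^ 2 = K ^ 2 * X) :
    |T| * (1 / √X) = K := by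
  have h1 : |T| = K * √X := by
    rw [← Real.sqrt_sq_eq_abs, h, Real.sqrt_mul (by positivity), Real.sqrt_sq hK.le]
  have h2 : √X ≠ 0 := by
    intro h0
    rw [h0, mul_zero, abs_eq_zero] at h1
    exact hT h1
  rw [h1]
  field_simp

/-- The map d ↦ bc(1 - δd)/(1 + δd) sends δ, 1/δ, -δ to b², 0, c². This is where δ² = (c - b)/(c +
b) enters. -/
lemma sq_sub_mobius_left {b c δ d : ℝ} (hδ : δ ^ 2 * (b + c) = c - b) (hd : 1 + δ * d ≠ 0) :
    b ^ 2 - b * c * (1 - δ * d) / (1 + δ * d) = b * ((b + c) * δ * (d - δ)) / (1 + δ * d) := by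
  field_simp
  linear_combination (b : ℝ) * hδ

lemma sq_sub_mobius_right {b c δ d : ℝ} (hδ : δ ^ 2 * (b + c) = c - b) (hd : 1 + δ * d ≠ 0) :
    c ^ 2 - b * c * (1 - δ * d) / (1 + δ * d) = c * ((b + c) * δ * (d + δ)) / (1 + δ * d) := by
  field_simp
  linear_combination (-c : ℝ) * hδ

/-- The Möbius map under which the elliptic differential of modulus `b / c` pulls back to that of
`ϑ₄ / ϑ₃`. -/
lemma mobius_differential {b c δ d e M : ℝ} (hbc : 0 < b + c) (hδ : δ ^ 2 * (b + c) = c - b)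
    (he : e ^ 2 = M ^ 2 * (d ^ 2 - δ ^ 2) * (1 - δ ^ 2 * d ^ 2)) (hd : 1 + δ * d ≠ 0) :
    (-(2 * b * c * δ * e) / (1 + δ * d) ^ 2) ^ 2 = (2 * M / (b + c)) ^ 2 *
      ((b * c * (1 - δ * d) / (1 + δ * d)) * (b ^ 2 - b * c * (1 - δ * d) / (1 + δ * d)) *
        (c ^ 2 - b * c * (1 - δ * d) / (1 + δ * d))) := by
  rw [sq_sub_mobius_left hδ hd, sq_sub_mobius_right hδ hd, div_pow, neg_sq, mul_pow, he]
  field_simp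
  ring

lemma hasDerivAt_mobius {b c δ : ℝ} {f : ℝ → ℝ} {e x : ℝ} (hf : HasDerivAt f e x)
    (hd : 1 + δ * f x ≠ 0) :
    HasDerivAt (fun x => b * c * (1 - δ * f x) / (1 + δ * f x))
      (-(2 * b * c * δ * e) / (1 + δ * f x) ^ 2) x := by
  have h := (((hf.const_mul δ).const_sub 1).const_mul (b * c)).div ((hf.const_mul δ).const_add 1) hd
  refine h.congr_deriv ?_
  field_simp
  ring

lemma setIntegral_Ioo_const {p q K : ℝ} (hpq : p ≤ q) {g : ℝ → ℝ} (hg : ∀ x ∈ Ioo p q, g x = K) :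
    ∫ x in Ioo p q, g x = K * (q - p) := by
  rw [MeasureTheory.setIntegral_congr_fun measurableSet_Ioo hg]
  simp [hpq, mul_comm]

/-- The periods `A₊`, `B₊` at `a = 0` in terms of theta functions. -/
lemma exists_thetaQuot_periods {b c : ℝ} (hb : 0 < b) (hbc : b < c) : ∃ y : ℝ, 0 < y ∧
    frbPlus 0 b c = 2 * y ∧ 0 < Aplus 0 b c ∧ 0 < Bplus 0 b c ∧
    thetaQuotReal y 0 ^ 2 * (b + c) = c - b ∧
    (∀ x, (deriv (thetaQuotReal y) x) ^ 2 = ((b + c) * Aplus 0 b c) ^ 2 *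
      (thetaQuotReal y x ^ 2 - thetaQuotReal y 0 ^ 2) *
      (1 - thetaQuotReal y 0 ^ 2 * thetaQuotReal y x ^ 2)) ∧
    (∀ x, deriv (deriv (thetaQuotReal y)) x = ((b + c) * Aplus 0 b c) ^ 2 *
      ((1 + thetaQuotReal y 0 ^ 4) * thetaQuotReal y x
      - 2 * thetaQuotReal y 0 ^ 2 * thetaQuotReal y x ^ 3)) := by
  have hc : 0 < c := hb.trans hbc
  have hs : 0 < b + c := by positivity
  have hr : (c - b) / (c + b) ∈ Ioo (0 : ℝ) 1 :=
    ⟨div_pos (by linarith) (by linarith), by rw [div_lt_one (by linarith)]; linarith⟩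
  -- This choice of δ makes the four zeros ±δ, ±1/δ of the theta equation correspond to the branch
  -- points b², c², 0, ∞.
  obtain ⟨y, hy, hyδ⟩ := exists_thetaQuotReal_zero_eq (v := √((c - b) / (c + b)))
    ⟨Real.sqrt_pos.mpr hr.1, by rw [Real.sqrt_lt' one_pos]; simpa using hr.2⟩
  obtain ⟨M, hM, h1, h2, h3, h4, h5⟩ := exists_thetaQuot_frequency hy
  have h6 := deriv_deriv_thetaQuotReal hy h1 h2
  have hδpos := thetaQuotReal_pos hy 0
  have hδlt := thetaQuotReal_zero_lt_one hy
  have hδ : thetaQuotReal y 0 ^ 2 * (b + c) = c - b := by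
    rw [hyδ, Real.sq_sqrt hr.1.le, add_comm b c]
    field_simp
  set d := thetaQuotReal y with hd
  set h := thetaQuotImag y with hh
  set δ := d 0 with hδdef
  have hdd : ∀ x, DifferentiableAt ℝ d x := fun x => (analyticAt_thetaQuotReal hy x).differentiableAt
  have hdhalf : d (1 / 2) = δ⁻¹ := thetaQuotReal_half hy
  have hh0 : h 0 = δ := thetaQuotImag_zero y
  have hhy : h y = -δ := thetaQuotImag_self hy
  have hK : 0 < 2 * M / (b + c) := by positivity
  have t0 : b * c * (1 - δ * δ) / (1 + δ * δ) = b ^ 2 := by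
    rw [div_eq_iff (by positivity)]
    linear_combination (-b : ℝ) * hδ
  -- the real period
  have dmono : StrictMonoOn d (Icc 0 (1 / 2)) := by
    rcases strictMonoOn_or_strictAntiOn_of_deriv_ne_zero
      (fun x _ => (hdd x).continuousAt.continuousWithinAt) (fun x _ => hdd x) h2 with hm | hm
    · exact hm
    · exfalso
      have := hm (left_mem_Icc.mpr (by norm_num)) (right_mem_Icc.mpr (by norm_num))
        (show (0 : ℝ) < 1 / 2 by norm_num)
      rw [hdhalf] at this
      have := one_lt_inv₀ hδpos |>.mpr hδlt
      linarith
  have hne : ∀ x, 1 + δ * d x ≠ 0 := fun x => by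
    have := thetaQuotReal_pos hy x
    positivity
  set T : ℝ → ℝ := fun x => b * c * (1 - δ * d x) / (1 + δ * d x) with hT
  have hTd : ∀ x, HasDerivAt T (-(2 * b * c * δ * deriv d x) / (1 + δ * d x) ^ 2) x := fun x =>
    hasDerivAt_mobius (hdd x).hasDerivAt (hne x)
  have hTne : ∀ x ∈ Ioo (0 : ℝ) (1 / 2), deriv T x ≠ 0 := fun x hx => by
    rw [(hTd x).deriv]
    have := h2 x hx
    have := hne x
    simp only [ne_eq, div_eq_zero_iff, neg_eq_zero, mul_eq_zero, pow_eq_zero_iff, OfNat.ofNat_ne_zero,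
      not_false_eq_true, not_or]
    exact ⟨⟨⟨⟨⟨trivial, hb.ne'⟩, hc.ne'⟩, hδpos.ne'⟩, h2 x hx⟩, hne x⟩
  have hT0 : T 0 = b ^ 2 := t0
  have hThalf : T (1 / 2) = 0 := by
    simp only [hT]
    rw [hdhalf, mul_inv_cancel₀ hδpos.ne']
    simp
  have hTanti : StrictAntiOn T (Icc 0 (1 / 2)) := by
    rcases strictMonoOn_or_strictAntiOn_of_deriv_ne_zero
      (fun x _ => (hTd x).continuousAt.continuousWithinAt)
      (fun x _ => (hTd x).differentiableAt) hTne with hm | hm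
    · exfalso
      have := hm (left_mem_Icc.mpr (by norm_num)) (right_mem_Icc.mpr (by norm_num))
        (show (0 : ℝ) < 1 / 2 by norm_num)
      rw [hT0, hThalf] at this
      nlinarith
    · exact hm
  -- On [0, 1/2] d runs from δ to 1/δ, so T runs from b² to 0; the interval has length 1/2.
  have hA : Aplus 0 b c = M / (b + c) := by
    have := setIntegral_image_of_strictAntiOn (by norm_num)
      (fun x _ => (hTd x).continuousAt.continuousWithinAt)
      (fun x _ => (hTd x).differentiableAt) hTanti
      (fun t => 1 / √((t - 0 ^ 2) * (b ^ 2 - t) * (c ^ 2 - t)))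
    rw [hT0, hThalf] at this
    rw [Aplus, intervalIntegral.integral_of_le (by nlinarith), MeasureTheory.integral_Ioc_eq_integral_Ioo,
      zero_pow two_ne_zero]
    rw [zero_pow two_ne_zero] at this
    rw [this, setIntegral_Ioo_const (K := 2 * M / (b + c)) (by norm_num)]
    · ring
    · intro x hx
      refine abs_mul_one_div_sqrt hK (hTne x hx) ?_
      rw [(hTd x).deriv, mobius_differential hs hδ (h1 x) (hne x), sub_zero]
  -- the imaginary period
  have hanti : StrictAntiOn h (Icc 0 y) := by
    rcases strictMonoOn_or_strictAntiOn_of_deriv_ne_zero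
      (fun x _ => (h3 x).continuousAt.continuousWithinAt) (fun x _ => h3 x) h5 with hm | hm
    · exfalso
      have := hm (left_mem_Icc.mpr hy.le) (right_mem_Icc.mpr hy.le) hy
      rw [hh0, hhy] at this
      linarith
    · exact hm
  have hne' : ∀ s ∈ Icc 0 y, 1 + δ * h s ≠ 0 := fun s hs => by
    have : h y ≤ h s := hanti.antitoneOn hs (right_mem_Icc.mpr hy.le) hs.2
    rw [hhy] at this
    nlinarith
  set S : ℝ → ℝ := fun x => b * c * (1 - δ * h x) / (1 + δ * h x) with hS
  have hSd : ∀ x ∈ Icc 0 y, HasDerivAt S (-(2 * b * c * δ * deriv h x) / (1 + δ * h x) ^ 2) x :=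
    fun x hx => hasDerivAt_mobius (h3 x).hasDerivAt (hne' x hx)
  have hSne : ∀ x ∈ Ioo (0 : ℝ) y, deriv S x ≠ 0 := fun x hx => by
    rw [(hSd x (Ioo_subset_Icc_self hx)).deriv]
    simp only [ne_eq, div_eq_zero_iff, neg_eq_zero, mul_eq_zero, pow_eq_zero_iff, OfNat.ofNat_ne_zero,
      not_false_eq_true, not_or]
    exact ⟨⟨⟨⟨⟨trivial, hb.ne'⟩, hc.ne'⟩, hδpos.ne'⟩, h5 x hx⟩, hne' x (Ioo_subset_Icc_self hx)⟩
  have hS0 : S 0 = b ^ 2 := by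
    simp only [hS]
    rw [hh0, t0]
  have hSy : S y = c ^ 2 := by
    simp only [hS]
    rw [hhy, div_eq_iff (by nlinarith)]
    linear_combination (c : ℝ) * hδ
  have hSmono : StrictMonoOn S (Icc 0 y) := by
    rcases strictMonoOn_or_strictAntiOn_of_deriv_ne_zero
      (fun x hx => (hSd x hx).continuousAt.continuousWithinAt)
      (fun x hx => (hSd x (Ioo_subset_Icc_self hx)).differentiableAt) hSne with hm | hm
    · exact hm
    · exfalso
      have := hm (left_mem_Icc.mpr hy.le) (right_mem_Icc.mpr hy.le) hy
      rw [hS0, hSy] at this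
      nlinarith
  -- On the imaginary segment h runs from δ to -δ, so S runs from b² to c². The segment has length
  -- y, with the same constant as for A₊, whence the ratio 2y.
  have hB : Bplus 0 b c = 2 * M / (b + c) * y := by
    have := setIntegral_image_of_strictMonoOn hy
      (fun x hx => (hSd x hx).continuousAt.continuousWithinAt)
      (fun x hx => (hSd x (Ioo_subset_Icc_self hx)).differentiableAt) hSmono
      (fun t => 1 / √((t - 0 ^ 2) * (t - b ^ 2) * (c ^ 2 - t)))
    rw [hS0, hSy] at this
    rw [Bplus, intervalIntegral.integral_of_le (by nlinarith), MeasureTheory.integral_Ioc_eq_integral_Ioo,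
      this, setIntegral_Ioo_const (K := 2 * M / (b + c)) hy.le]
    · ring
    · intro x hx
      refine abs_mul_one_div_sqrt hK (hSne x hx) ?_
      have hx' := Ioo_subset_Icc_self hx
      rw [(hSd x hx').deriv]
      have e2 : c ^ 2 - S x = c * ((b + c) * δ * (h x + δ)) / (1 + δ * h x) :=
        sq_sub_mobius_right hδ (hne' x hx')
      have e3 : S x - b ^ 2 = -(b * ((b + c) * δ * (h x - δ)) / (1 + δ * h x)) := by
        rw [← sq_sub_mobius_left hδ (hne' x hx')]; ring
      rw [e2, e3, div_pow, neg_sq, mul_pow, h4 x]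
      have := hne' x hx'
      simp only [hS]
      field_simp
      ring
  have hM' : (b + c) * Aplus 0 b c = M := by rw [hA]; field_simp
  refine ⟨y, hy, ?_, by rw [hA]; positivity, by rw [hB]; positivity, hδ, ?_, ?_⟩
  · rw [frbPlus, hA, hB]
    field_simp
  · rw [hM']; exact h1
  · rw [hM']; exact h6

/-! ### The Jacobi function `dn` -/

section JacobiDn

variable {k : ℝ}

lemma one_sub_sq_mul_sin_sq_pos (hk : k ^ 2 < 1) (φ : ℝ) : 0 < 1 - k ^ 2 * Real.sin φ ^ 2 := by
  have h1 := Real.sin_sq_le_one φ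
  nlinarith [sq_nonneg k, sq_nonneg (Real.sin φ)]

lemma hasDerivAt_ellipticF (hk : k ^ 2 < 1) (φ : ℝ) :
    HasDerivAt (ellipticF k) (1 / √(1 - k ^ 2 * Real.sin φ ^ 2)) φ := by
  have hc : Continuous fun θ => 1 / √(1 - k ^ 2 * Real.sin θ ^ 2) :=
    Continuous.div (by fun_prop) (by fun_prop)
      fun θ => (Real.sqrt_pos.mpr (one_sub_sq_mul_sin_sq_pos hk θ)).ne'
  exact (hc.integral_hasStrictDerivAt 0 φ).hasDerivAt

lemma one_le_deriv_ellipticF (hk : k ^ 2 < 1) (φ : ℝ) : 1 ≤ 1 / √(1 - k ^ 2 * Real.sin φ ^ 2) := by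
  have h := one_sub_sq_mul_sin_sq_pos hk φ
  rw [le_div_iff₀ (Real.sqrt_pos.mpr h), one_mul, Real.sqrt_le_one]
  nlinarith [sq_nonneg (k * Real.sin φ)]

lemma strictMono_ellipticF (hk : k ^ 2 < 1) : StrictMono (ellipticF k) :=
  strictMono_of_deriv_pos fun φ => by
    rw [(hasDerivAt_ellipticF hk φ).deriv]
    exact zero_lt_one.trans_le (one_le_deriv_ellipticF hk φ)

lemma ellipticF_zero (k : ℝ) : ellipticF k 0 = 0 := intervalIntegral.integral_same

/-- The derivative is at least 1, so the function outgrows the identity in both directions. -/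
lemma surjective_ellipticF (hk : k ^ 2 < 1) : Function.Surjective (ellipticF k) := by
  have hmono : Monotone fun φ => ellipticF k φ - φ := by
    refine monotone_of_deriv_nonneg
      (fun φ => ((hasDerivAt_ellipticF hk φ).sub (hasDerivAt_id φ)).differentiableAt) fun φ => ?_
    have h : HasDerivAt (fun φ => ellipticF k φ - φ) _ φ :=
      (hasDerivAt_ellipticF hk φ).sub (hasDerivAt_id φ)
    rw [h.deriv]
    linarith [one_le_deriv_ellipticF hk φ]
  have hcont : Continuous (ellipticF k) :=
    continuous_iff_continuousAt.mpr fun φ => (hasDerivAt_ellipticF hk φ).continuousAt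
  refine hcont.surjective ?_ ?_
  · refine tendsto_atTop_mono' _ ?_ tendsto_id
    filter_upwards [eventually_ge_atTop 0] with φ hφ
    have := hmono hφ
    simp only [ellipticF_zero, sub_zero] at this
    simpa using this
  · refine tendsto_atBot_mono' _ ?_ tendsto_id
    filter_upwards [eventually_le_atBot 0] with φ hφ
    have := hmono hφ
    simp only [ellipticF_zero, sub_zero] at this
    simpa using this

lemma ellipticF_jacobiAm (hk : k ^ 2 < 1) (u : ℝ) : ellipticF k (jacobiAm k u) = u :=
  Function.rightInverse_invFun (surjective_ellipticF hk) u

lemma jacobiAm_zero (hk : k ^ 2 < 1) : jacobiAm k 0 = 0 :=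
  (strictMono_ellipticF hk).injective (by rw [ellipticF_jacobiAm hk, ellipticF_zero])

lemma dn_pos (hk : k ^ 2 < 1) (u : ℝ) : 0 < dn u k :=
  Real.sqrt_pos.mpr (one_sub_sq_mul_sin_sq_pos hk _)

lemma dn_sq (hk : k ^ 2 < 1) (u : ℝ) : dn u k ^ 2 = 1 - k ^ 2 * Real.sin (jacobiAm k u) ^ 2 :=
  Real.sq_sqrt (one_sub_sq_mul_sin_sq_pos hk _).le

lemma dn_zero (hk : k ^ 2 < 1) : dn 0 k = 1 := by
  rw [dn, jacobiAm_zero hk]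
  simp

lemma hasDerivAt_jacobiAm (hk : k ^ 2 < 1) (u : ℝ) : HasDerivAt (jacobiAm k) (dn u k) u := by
  have hmono : Monotone (jacobiAm k) := fun u v huv => by
    rw [← (strictMono_ellipticF hk).le_iff_le, ellipticF_jacobiAm hk, ellipticF_jacobiAm hk]
    exact huv
  have hsurj : Function.Surjective (jacobiAm k) := fun φ =>
    ⟨ellipticF k φ, (strictMono_ellipticF hk).injective (ellipticF_jacobiAm hk _)⟩
  have h := HasDerivAt.of_local_left_inverse (hmono.continuous_of_surjective hsurj).continuousAt
    (hasDerivAt_ellipticF hk (jacobiAm k u))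
    (zero_lt_one.trans_le (one_le_deriv_ellipticF hk _)).ne'
    (Eventually.of_forall (ellipticF_jacobiAm hk))
  rwa [one_div, inv_inv] at h

lemma hasDerivAt_dn (hk : k ^ 2 < 1) (u : ℝ) : HasDerivAt (fun u => dn u k)
    (-(k ^ 2 * Real.sin (jacobiAm k u) * Real.cos (jacobiAm k u))) u := by
  have h := (((((hasDerivAt_jacobiAm hk u).sin).pow 2).const_mul (k ^ 2)).const_sub 1).sqrt
    (one_sub_sq_mul_sin_sq_pos hk _).ne'
  refine h.congr_deriv ?_
  have hd := dn_pos hk u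
  change _ / (2 * dn u k) = _
  rw [div_eq_iff (by positivity)]
  norm_num
  ring

lemma hasDerivAt_deriv_dn (hk : k ^ 2 < 1) (u : ℝ) :
    HasDerivAt (fun u => -(k ^ 2 * Real.sin (jacobiAm k u) * Real.cos (jacobiAm k u)))
      ((2 - k ^ 2) * dn u k - 2 * dn u k ^ 3) u := by
  have ha := hasDerivAt_jacobiAm hk u
  have h := ((ha.sin.const_mul (k ^ 2)).mul ha.cos).neg
  refine h.congr_deriv ?_
  have h1 := dn_sq hk u
  have h2 := Real.sin_sq_add_cos_sq (jacobiAm k u)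
  linear_combination (-k ^ 2 * dn u k) * h2 + (2 * dn u k) * h1

/-- `dn` is determined by its second-order differential equation. -/
lemma eq_dn_of_second_order (hk : k ^ 2 < 1) {g g' : ℝ → ℝ} (hg : ∀ u, HasDerivAt g (g' u) u)
    (hg' : ∀ u, HasDerivAt g' ((2 - k ^ 2) * g u - 2 * g u ^ 3) u)
    (hbound : ∀ u, |g u| ≤ 1) (hbound' : ∀ u, |g' u| ≤ 1) (h0 : g 0 = 1) (h0' : g' 0 = 0) (u : ℝ) :
    g u = dn u k := by
  set v : ℝ × ℝ → ℝ × ℝ := fun p => (p.2, (2 - k ^ 2) * p.1 - 2 * p.1 ^ 3) with hv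
  have hvc : ContDiff ℝ 1 v := by
    rw [hv]
    fun_prop
  -- The cubic field is not globally Lipschitz; the bounds confine both trajectories to a compact
  -- convex ball on which it is.
  obtain ⟨K, hK⟩ := hvc.contDiffOn.exists_lipschitzOnWith one_ne_zero
    (convex_closedBall (0 : ℝ × ℝ) 1) (isCompact_closedBall _ _)
  have hmem : ∀ p : ℝ × ℝ, |p.1| ≤ 1 → |p.2| ≤ 1 → p ∈ Metric.closedBall (0 : ℝ × ℝ) 1 := by
    intro p h1 h2
    rw [mem_closedBall_zero_iff, Prod.norm_def]
    exact max_le h1 h2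
  have huniq := ODE_solution_unique_univ (v := fun _ => v) (s := fun _ => Metric.closedBall 0 1)
    (f := fun u => (g u, g' u))
    (g := fun u => (dn u k, -(k ^ 2 * Real.sin (jacobiAm k u) * Real.cos (jacobiAm k u))))
    (t₀ := 0) (fun _ => hK)
    (fun u => ⟨(hg u).prodMk (hg' u), hmem _ (hbound u) (hbound' u)⟩)
    (fun u => ⟨(hasDerivAt_dn hk u).prodMk (hasDerivAt_deriv_dn hk u), hmem _ ?_ ?_⟩) ?_
  · exact congrArg Prod.fst (congrFun huniq u)
  · rw [abs_of_pos (dn_pos hk u), dn, Real.sqrt_le_one]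
    nlinarith [sq_nonneg (k * Real.sin (jacobiAm k u))]
  · rw [abs_neg, abs_mul, abs_mul, abs_of_nonneg (sq_nonneg k)]
    have h1 := Real.abs_sin_le_one (jacobiAm k u)
    have h2 := Real.abs_cos_le_one (jacobiAm k u)
    calc k ^ 2 * |Real.sin (jacobiAm k u)| * |Real.cos (jacobiAm k u)| ≤ 1 * 1 * 1 := by gcongr
      _ = 1 := by norm_num
  · simp [h0, h0', dn_zero hk, jacobiAm_zero hk]

end JacobiDn

/-! ### The one-phase wave -/

/-- At a = 0 the parameter is 4iy and the argument 2ξ, so ϑ₃ ∓ ϑ₂ recombine into ϑ₄(ξ | iy) and ϑ₃(ξ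
| iy). The amplitude is √(c² - b²) = (b + c)δ. -/
lemma onePhase_eq_thetaQuotReal {b c y : ℝ} (hb : 0 < b) (hbc : b < c) (hy : 0 < y)
    (hfrb : frbPlus 0 b c = 2 * y) (hδ : thetaQuotReal y 0 ^ 2 * (b + c) = c - b)
    (lam0 Z₂ : ℝ) (K₁ K₂ : ℂ) (x t : ℝ) :
    onePhase b c lam0 Z₂ K₁ K₂ x t =
      (((b + c) * thetaQuotReal y 0 *
        thetaQuotReal y ((x + 4 * lam0 * t) / Aplus 0 b c + Z₂) : ℝ) : ℂ) *
        Complex.exp (2 * Complex.I * (K₁ * x + K₂ * t)) := by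
  have hs : √(c ^ 2 - b ^ 2) = (b + c) * thetaQuotReal y 0 := by
    have := thetaQuotReal_pos hy 0
    have := hb.trans hbc
    rw [show c ^ 2 - b ^ 2 = ((b + c) * thetaQuotReal y 0) ^ 2 by linear_combination (-(b + c)) * hδ]
    exact Real.sqrt_sq (by positivity)
  have hτ : 2 * Complex.I * (frbPlus 0 b c : ℂ) = 4 * (Complex.I * y) := by
    rw [hfrb]; push_cast; ring
  set ξ : ℝ := (x + 4 * lam0 * t) / Aplus 0 b c + Z₂ with hξ
  have hu : ((waveNumber 0 b c * x + kappa2 0 b c lam0 * t + 2 * Z₂ : ℝ) : ℂ) = 2 * (ξ : ℂ) := by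
    rw [hξ, waveNumber, kappa2]
    push_cast
    ring
  simp only [onePhase]
  rw [hτ, hu, hs]
  simp only [theta3]
  rw [← theta4_eq_sub_theta2 _ (im_I_mul_pos hy), ← jacobiTheta₂_eq_add_theta2 _ (im_I_mul_pos hy)]
  have := thetaQuot_ofReal hy ξ
  rw [thetaQuot] at this
  rw [this]
  push_cast
  ring

/-- The function δ d(v/M + 1/2), with M = (b + c)A₊, satisfies the equation and initial data of dn:
the shift by 1/2 moves the value δ · (1/δ) = 1, where d' = 0, to v = 0. This shift accounts for the
1/2 in x₀. -/
lemma onePhase_eq_dn {b c : ℝ} (hb : 0 < b) (hbc : b < c) (lam0 Z₂ : ℝ) (K₁ K₂ : ℂ) (x t : ℝ) :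
    onePhase b c lam0 Z₂ K₁ K₂ x t =
      (((b + c) * dn ((b + c) * (x + 4 * lam0 * t - (1 / 2 - Z₂) * Aplus 0 b c))
        (2 * √(b * c) / (b + c)) : ℝ) : ℂ) *
        Complex.exp (2 * Complex.I * (K₁ * x + K₂ * t)) := by
  obtain ⟨y, hy, hfrb, hA, -, hδ, h1, h2⟩ := exists_thetaQuot_periods hb hbc
  rw [onePhase_eq_thetaQuotReal hb hbc hy hfrb hδ]
  congr 2
  rw [mul_assoc]
  congr 1
  set δ := thetaQuotReal y 0
  set d := thetaQuotReal y with hd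
  set M := (b + c) * Aplus 0 b c with hM
  have hM0 : 0 < M := by have := hb.trans hbc; positivity
  have hδ0 : 0 < δ := thetaQuotReal_pos hy 0
  have hδ1 : δ < 1 := thetaQuotReal_zero_lt_one hy
  have hda : ∀ x, AnalyticAt ℝ d x := analyticAt_thetaQuotReal hy
  -- With δ² = (c - b)/(b + c), this is 4bc/(b + c)² = 1 - δ⁴.
  have hk2 : (2 * √(b * c) / (b + c)) ^ 2 = 1 - δ ^ 4 := by
    have hbc' : b + c ≠ 0 := by linarith
    have e : δ ^ 2 = (c - b) / (b + c) := by rw [eq_div_iff hbc', hδ]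
    rw [show δ ^ 4 = (δ ^ 2) ^ 2 by ring, e, div_pow, mul_pow,
      Real.sq_sqrt (by have := hb.trans hbc; positivity)]
    field_simp
    ring
  have hP : ∀ x, 0 ≤ (d x ^ 2 - δ ^ 2) * (1 - δ ^ 2 * d x ^ 2) := by
    intro x
    have h := h1 x
    have h3 : 0 ≤ M ^ 2 * ((d x ^ 2 - δ ^ 2) * (1 - δ ^ 2 * d x ^ 2)) := by
      rw [← mul_assoc, ← h]; positivity
    exact nonneg_of_mul_nonneg_right h3 (by positivity)
  -- If δ d > 1, then also d > δ, and the right side of the equation for d'² would be negative.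
  have hδd : ∀ x, δ * d x ≤ 1 := by
    intro x
    have hdx : 0 < d x := thetaQuotReal_pos hy x
    by_contra hcon
    push Not at hcon
    have h3 : 1 < δ * d x * (δ * d x) := by nlinarith
    have h4 : δ < d x := by nlinarith
    have h5 : 0 < d x ^ 2 - δ ^ 2 := by nlinarith
    have := hP x
    nlinarith
  have hmain := eq_dn_of_second_order (k := 2 * √(b * c) / (b + c))
    (g := fun v => δ * d (v / M + 1 / 2)) (g' := fun v => δ * (deriv d (v / M + 1 / 2) * (1 / M)))
    ?_ ?_ ?_ ?_ ?_ ?_ ?_ ((b + c) * (x + 4 * lam0 * t - (1 / 2 - Z₂) * Aplus 0 b c))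
  · rw [← hmain]
    congr 2
    rw [hM]
    have : b + c ≠ 0 := by linarith
    field_simp
    ring
  · rw [hk2]
    have := pow_pos hδ0 4
    linarith
  · intro u
    have hi : HasDerivAt (fun v : ℝ => v / M + 1 / 2) (1 / M) u :=
      ((hasDerivAt_id u).div_const M).add_const _
    exact ((hda _).differentiableAt.hasDerivAt.comp u hi).const_mul δ
  · intro u
    have hi : HasDerivAt (fun v : ℝ => v / M + 1 / 2) (1 / M) u :=
      ((hasDerivAt_id u).div_const M).add_const _
    have h := (((hda _).deriv.differentiableAt.hasDerivAt.comp u hi).mul_const (1 / M)).const_mul δ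
    refine h.congr_deriv ?_
    rw [h2, hk2]
    field_simp
    ring
  · intro u
    have : 0 < d (u / M + 1 / 2) := thetaQuotReal_pos hy _
    rw [abs_of_pos (by positivity)]
    exact hδd _
  · intro u
    have h := h1 (u / M + 1 / 2)
    have h3 := hδd (u / M + 1 / 2)
    have h4 : 0 < d (u / M + 1 / 2) := thetaQuotReal_pos hy _
    set D := d (u / M + 1 / 2)
    rw [abs_le_one_iff_mul_self_le_one]
    have e : δ * (deriv d (u / M + 1 / 2) * (1 / M)) * (δ * (deriv d (u / M + 1 / 2) * (1 / M)))
        = ((δ * D) ^ 2 - δ ^ 4) * (1 - (δ * D) ^ 2) := by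
      have : δ * (deriv d (u / M + 1 / 2) * (1 / M)) * (δ * (deriv d (u / M + 1 / 2) * (1 / M)))
        = δ ^ 2 * (deriv d (u / M + 1 / 2)) ^ 2 / M ^ 2 := by field_simp
      rw [this, h]
      field_simp
    rw [e]
    have h5 : (δ * D) ^ 2 ≤ 1 := by
      have : 0 < δ * D := by positivity
      nlinarith
    have h6 : 0 < δ ^ 4 := by positivity
    have h7 := sq_nonneg (δ * D)
    nlinarith
  · have : d (1 / 2) = δ⁻¹ := thetaQuotReal_half hy
    simp only [zero_div, zero_add]
    rw [this, mul_inv_cancel₀ hδ0.ne']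
  · have h := h1 (1 / 2)
    have h3 : d (1 / 2) = δ⁻¹ := thetaQuotReal_half hy
    rw [h3, inv_pow, mul_inv_cancel₀ (by positivity), sub_self, mul_zero] at h
    simp only [zero_div, zero_add]
    rw [pow_eq_zero_iff two_ne_zero] at h
    rw [h]
    ring

/-- With K₁ = -lam0 the velocity 4 lam0 cancels the terms in f'; the phase terms reduce to -2C f,
and the cubic ODE remains. -/
lemma solvesNLS_of_travelling_wave {f f' f'' : ℝ → ℝ} {C lam0 : ℝ} {K₁ K₂ : ℂ}
    (hK₁ : K₁ = -lam0) (hK₂ : K₂ = C - 2 * lam0 ^ 2)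
    (hf : ∀ s, HasDerivAt f (f' s) s) (hf' : ∀ s, HasDerivAt f' (f'' s) s)
    (hode : ∀ s, f'' s = 2 * C * f s - 2 * f s ^ 3) :
    SolvesNLS fun x t => (f (x + 4 * lam0 * t) : ℂ) *
      Complex.exp (2 * Complex.I * (K₁ * x + K₂ * t)) := by
  intro x t
  have hx : ∀ (x t : ℝ), HasDerivAt (fun x : ℝ => Complex.exp (2 * Complex.I * (K₁ * x + K₂ * t)))
      (Complex.exp (2 * Complex.I * (K₁ * x + K₂ * t)) * (2 * Complex.I * K₁)) x := by
    intro x t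
    have h := ((((Complex.ofRealCLM.hasDerivAt (x := x)).const_mul K₁).add_const
      (K₂ * t)).const_mul (2 * Complex.I)).cexp
    simpa using h
  have ht : ∀ (x t : ℝ), HasDerivAt (fun t : ℝ => Complex.exp (2 * Complex.I * (K₁ * x + K₂ * t)))
      (Complex.exp (2 * Complex.I * (K₁ * x + K₂ * t)) * (2 * Complex.I * K₂)) t := by
    intro x t
    have h := ((((Complex.ofRealCLM.hasDerivAt (x := t)).const_mul K₂).const_add
      (K₁ * x)).const_mul (2 * Complex.I)).cexp
    simpa using h
  have sx : ∀ {g g' : ℝ → ℝ}, (∀ s, HasDerivAt g (g' s) s) → ∀ (x t : ℝ),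
      HasDerivAt (fun x : ℝ => (g (x + 4 * lam0 * t) : ℂ)) (g' (x + 4 * lam0 * t) : ℂ) x :=
    fun hg x t => ((hg _).comp_add_const x _).ofReal_comp
  have st : HasDerivAt (fun t : ℝ => (f (x + 4 * lam0 * t) : ℂ))
      ((f' (x + 4 * lam0 * t) * (4 * lam0) : ℝ) : ℂ) t := by
    have hi : HasDerivAt (fun t : ℝ => x + 4 * lam0 * t) (4 * lam0) t := by
      simpa using ((hasDerivAt_id t).const_mul (4 * lam0)).const_add x
    exact ((hf _).comp t hi).ofReal_comp
  have h1 := fun x => (sx hf x t).mul (hx x t)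
  have h2 := st.mul (ht x t)
  have h3 := ((sx hf' x t).mul (hx x t)).add ((sx hf x t).mul ((hx x t).mul_const (2 * Complex.I * K₁)))
  have hd1 : deriv (fun y : ℝ => (f (y + 4 * lam0 * t) : ℂ) *
      Complex.exp (2 * Complex.I * (K₁ * y + K₂ * t))) = fun y =>
      (f' (y + 4 * lam0 * t) : ℂ) * Complex.exp (2 * Complex.I * (K₁ * y + K₂ * t)) +
      (f (y + 4 * lam0 * t) : ℂ) *
        (Complex.exp (2 * Complex.I * (K₁ * y + K₂ * t)) * (2 * Complex.I * K₁)) :=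
    funext fun y => (h1 y).deriv
  refine ⟨h2.differentiableAt, (h1 x).differentiableAt, ?_, ?_⟩
  · rw [hd1]
    exact h3.differentiableAt
  have hnorm : (‖(f (x + 4 * lam0 * t) : ℂ) * Complex.exp (2 * Complex.I * (K₁ * x + K₂ * t))‖ : ℂ) ^ 2
      = (f (x + 4 * lam0 * t) : ℂ) ^ 2 := by
    have e : Complex.exp (2 * Complex.I * (K₁ * x + K₂ * t)) =
        Complex.exp (((2 * (-lam0 * x + (C - 2 * lam0 ^ 2) * t) : ℝ) : ℂ) * Complex.I) := by
      rw [hK₁, hK₂]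
      congr 1
      push_cast
      ring
    rw [norm_mul, e, Complex.norm_exp_ofReal_mul_I, mul_one, Complex.norm_real]
    norm_cast
    rw [Real.norm_eq_abs, sq_abs]
  have e1 : deriv (fun s : ℝ => (f (x + 4 * lam0 * s) : ℂ) *
      Complex.exp (2 * Complex.I * (K₁ * x + K₂ * s))) t = _ := h2.deriv
  have e2 := h3.deriv
  rw [e1, hd1]
  refine (congrArg₂ (· + ·) (congrArg₂ (· + ·) rfl e2) (by rw [hnorm])).trans ?_
  have ho := congrArg (fun r : ℝ => (r : ℂ)) (hode (x + 4 * lam0 * t))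
  rw [ho, hK₁, hK₂]
  push_cast
  linear_combination (2 * (C : ℂ) * f (x + 4 * lam0 * t) *
    Complex.exp (2 * Complex.I * (-lam0 * x + (C - 2 * lam0 ^ 2) * t))) * Complex.I_sq

lemma solvesNLS_onePhase {b c : ℝ} (hb : 0 < b) (hbc : b < c) (lam0 Z₂ : ℝ) :
    SolvesNLS (onePhase b c lam0 Z₂ (-lam0) (b ^ 2 + c ^ 2 - 2 * lam0 ^ 2)) := by
  obtain ⟨y, hy, hfrb, hA, -, hδ, h1, h2⟩ := exists_thetaQuot_periods hb hbc
  have hfun : onePhase b c lam0 Z₂ (-lam0) (b ^ 2 + c ^ 2 - 2 * lam0 ^ 2) = fun x t =>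
      (((b + c) * thetaQuotReal y 0 *
        thetaQuotReal y ((x + 4 * lam0 * t) / Aplus 0 b c + Z₂) : ℝ) : ℂ) *
        Complex.exp (2 * Complex.I * ((-lam0 : ℂ) * x + (b ^ 2 + c ^ 2 - 2 * lam0 ^ 2) * t)) := by
    funext x t
    exact onePhase_eq_thetaQuotReal hb hbc hy hfrb hδ lam0 Z₂ _ _ x t
  rw [hfun]
  have hda : ∀ x, AnalyticAt ℝ (thetaQuotReal y) x := analyticAt_thetaQuotReal hy
  have hi : ∀ s, HasDerivAt (fun s : ℝ => s / Aplus 0 b c + Z₂) (1 / Aplus 0 b c) s := fun s =>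
    ((hasDerivAt_id s).div_const _).add_const _
  refine solvesNLS_of_travelling_wave (C := b ^ 2 + c ^ 2)
    (f := fun s => (b + c) * thetaQuotReal y 0 * thetaQuotReal y (s / Aplus 0 b c + Z₂)) rfl
    (by push_cast; ring)
    (fun s => ((hda _).differentiableAt.hasDerivAt.comp s (hi s)).const_mul _)
    (fun s => (((hda _).deriv.differentiableAt.hasDerivAt.comp s (hi s)).mul_const _).const_mul _)
    fun s => ?_
  rw [h2]
  set δ := thetaQuotReal y 0
  set D := thetaQuotReal y (s / Aplus 0 b c + Z₂)
  field_simp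
  -- The linear coefficient matches because (b + c)²(1 + δ⁴) = (b + c)² + (c - b)² = 2(b² + c²).
  linear_combination ((b + c) * δ * D * ((b + c) * δ ^ 2 + c - b)) * hδ

open MeasureTheory

/-! ### Integrability of the elliptic integrands -/

/-- The integrand is the nonnegative derivative of a continuous arcsine. It models the singularities
at both ends of a segment between branch points. -/
lemma intervalIntegrable_one_div_sqrt_mul {p q : ℝ} (hpq : p < q) :
    IntervalIntegrable (fun y => 1 / √((y - p) * (q - y))) volume p q := by
  set g : ℝ → ℝ := fun y => Real.arcsin ((2 * y - p - q) / (q - p)) with hg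
  have hqp : 0 < q - p := sub_pos.mpr hpq
  have hd : ∀ y ∈ Ioo p q, HasDerivAt g (1 / √((y - p) * (q - y))) y := by
    intro y hy
    have h1 : (2 * y - p - q) / (q - p) < 1 := by rw [div_lt_one hqp]; linarith [hy.2]
    have h2 : -1 < (2 * y - p - q) / (q - p) := by rw [lt_div_iff₀ hqp]; linarith [hy.1]
    have hi : HasDerivAt (fun y : ℝ => (2 * y - p - q) / (q - p)) (2 / (q - p)) y := by
      simpa using ((((hasDerivAt_id y).const_mul 2).sub_const p).sub_const q).div_const (q - p)
    have h := (Real.hasDerivAt_arcsin h2.ne' h1.ne).comp y hi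
    refine h.congr_deriv ?_
    have e : 1 - ((2 * y - p - q) / (q - p)) ^ 2 = (2 / (q - p)) ^ 2 * ((y - p) * (q - y)) := by
      field_simp
      ring
    have hpos : 0 < (y - p) * (q - y) := mul_pos (by linarith [hy.1]) (by linarith [hy.2])
    have := Real.sqrt_pos.mpr hpos
    rw [e, Real.sqrt_mul (by positivity), Real.sqrt_sq (by positivity)]
    field_simp
  refine intervalIntegral.intervalIntegrable_deriv_of_nonneg (g := g) ?_ ?_ ?_
  · exact Continuous.continuousOn (by fun_prop)
  · rw [min_eq_left hpq.le, max_eq_right hpq.le]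
    exact hd
  · intro y _
    positivity

/-- The integrand `1 / (y √(y² - c²))` dominates all the integrands on `(c, ∞)`. -/
def arcsecDeriv (c y : ℝ) : ℝ := 1 / (y * √(y ^ 2 - c ^ 2))

lemma arcsecDeriv_nonneg {c y : ℝ} (hc : 0 < c) (hy : c < y) : 0 ≤ arcsecDeriv c y := by
  have := hc.trans hy
  unfold arcsecDeriv
  positivity

/-- An antiderivative is (1/c) arctan(√(y² - c²)/c), which is bounded. -/
lemma integrableOn_arcsecDeriv {c : ℝ} (hc : 0 < c) : IntegrableOn (arcsecDeriv c) (Ioi c) := by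
  have hlim : Tendsto (fun y : ℝ => 1 / c * Real.arctan (√(y ^ 2 - c ^ 2) / c)) atTop
      (𝓝 (1 / c * (Real.pi / 2))) := by
    have h1 : Tendsto (fun y : ℝ => √(y ^ 2 - c ^ 2) / c) atTop atTop :=
      (Real.tendsto_sqrt_atTop.comp
        (tendsto_atTop_add_const_right _ _ (tendsto_pow_atTop two_ne_zero))).atTop_div_const hc
    exact ((Real.tendsto_arctan_atTop.mono_right nhdsWithin_le_nhds).comp h1).const_mul _
  refine integrableOn_Ioi_deriv_of_nonneg (Continuous.continuousWithinAt (by fun_prop)) ?_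
    (fun y hy => arcsecDeriv_nonneg hc hy) hlim
  intro y hy
  have hy0 : 0 < y := hc.trans hy
  have hpos : 0 < y ^ 2 - c ^ 2 := by have : c < y := hy; nlinarith
  have hs := ((hasDerivAt_pow 2 y).sub_const (c ^ 2)).sqrt hpos.ne'
  have h := ((hs.div_const c).arctan).const_mul (1 / c)
  refine h.congr_deriv ?_
  have hsq := Real.sq_sqrt hpos.le
  have hp := Real.sqrt_pos.mpr hpos
  unfold arcsecDeriv
  rw [div_pow, hsq]
  have : 1 + (y ^ 2 - c ^ 2) / c ^ 2 = y ^ 2 / c ^ 2 := by field_simp; ring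
  rw [this]
  field_simp
  norm_num
  ring

lemma integrableOn_of_le_arcsecDeriv {c K : ℝ} (hc : 0 < c) {g : ℝ → ℝ}
    (hg : ContinuousOn g (Ioi c)) (h : ∀ y, c < y → |g y| ≤ K * arcsecDeriv c y) :
    IntegrableOn g (Ioi c) := by
  refine Integrable.mono' ((integrableOn_arcsecDeriv hc).const_mul K)
    (hg.aestronglyMeasurable measurableSet_Ioi) ?_
  filter_upwards [ae_restrict_mem measurableSet_Ioi] with y hy
  exact h y hy

/-- For y ≥ 2c the majorant is at most 2/y², so the tail beyond Y is O(1/Y). -/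
lemma isBigO_integral_tail {c K : ℝ} (hc : 0 < c) {g : ℝ → ℝ}
    (hg : ContinuousOn g (Ioi c)) (h : ∀ y, c < y → |g y| ≤ K * arcsecDeriv c y) :
    (fun Y => (∫ y in c..Y, g y) - ∫ y in Ioi c, g y) =O[atTop] fun Y => Y⁻¹ := by
  have hint := integrableOn_of_le_arcsecDeriv hc hg h
  have hK : 0 ≤ K := by
    have h1 := h (2 * c) (by linarith)
    have h2 : 0 < arcsecDeriv c (2 * c) := by
      have : 0 < (2 * c) ^ 2 - c ^ 2 := by nlinarith
      unfold arcsecDeriv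
      positivity
    by_contra hcon
    push Not at hcon
    nlinarith [abs_nonneg (g (2 * c))]
  refine IsBigO.of_bound (2 * K) ?_
  filter_upwards [eventually_ge_atTop (2 * c)] with Y hY
  have hcY : c ≤ Y := by linarith
  have hY0 : 0 < Y := by linarith
  have hsplit : (∫ y in c..Y, g y) - ∫ y in Ioi c, g y = -∫ y in Ioi Y, g y := by
    rw [intervalIntegral.integral_of_le hcY, ← Ioc_union_Ioi_eq_Ioi hcY,
      setIntegral_union (Ioc_disjoint_Ioi le_rfl) measurableSet_Ioi
        (hint.mono_set Ioc_subset_Ioi_self) (hint.mono_set (Ioi_subset_Ioi hcY))]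
    ring
  rw [hsplit, norm_neg]
  have hb : ∀ y ∈ Ioi Y, ‖g y‖ ≤ 2 * K * y ^ (-2 : ℝ) := by
    intro y hy
    have hy1 : Y < y := hy
    have hy0 : 0 < y := by linarith
    refine (h y (by linarith)).trans ?_
    have hs : y / 2 ≤ √(y ^ 2 - c ^ 2) := by
      apply Real.le_sqrt_of_sq_le
      nlinarith
    have : arcsecDeriv c y ≤ 2 * y ^ (-2 : ℝ) := by
      rw [Real.rpow_neg hy0.le, Real.rpow_two]
      unfold arcsecDeriv
      calc 1 / (y * √(y ^ 2 - c ^ 2)) ≤ 1 / (y * (y / 2)) := by gcongr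
        _ = 2 * (y ^ 2)⁻¹ := by field_simp
    calc K * arcsecDeriv c y ≤ K * (2 * y ^ (-2 : ℝ)) := by gcongr
      _ = _ := by ring
  have hi : IntegrableOn (fun y : ℝ => 2 * K * y ^ (-2 : ℝ)) (Ioi Y) :=
    (integrableOn_Ioi_rpow_of_lt (by norm_num) hY0).const_mul _
  calc ‖∫ y in Ioi Y, g y‖ ≤ ∫ y in Ioi Y, 2 * K * y ^ (-2 : ℝ) :=
        norm_integral_le_of_norm_le hi (by
          filter_upwards [ae_restrict_mem measurableSet_Ioi] with y hy
          exact hb y hy)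
    _ = 2 * K * ‖Y⁻¹‖ := by
        rw [integral_const_mul, integral_Ioi_rpow_of_lt (by norm_num) hY0,
          Real.norm_of_nonneg (by positivity)]
        norm_num
        left
        rw [Real.rpow_neg_one]

/-! ### Bounds and integrability for the square roots on the curve -/

section Curve

variable {a b c : ℝ}

/-- `√((y² - a²) (y² - b²) (y² - c²))` -/
def rootOuter (a b c y : ℝ) : ℝ := √((y ^ 2 - a ^ 2) * (y ^ 2 - b ^ 2) * (y ^ 2 - c ^ 2))

/-- `√((y² - a²) (b² - y²) (c² - y²))` -/
def rootGap (a b c y : ℝ) : ℝ := √((y ^ 2 - a ^ 2) * (b ^ 2 - y ^ 2) * (c ^ 2 - y ^ 2))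

/-- `√((a² - y²) (b² - y²) (c² - y²))` -/
def rootInner (a b c y : ℝ) : ℝ := √((a ^ 2 - y ^ 2) * (b ^ 2 - y ^ 2) * (c ^ 2 - y ^ 2))

lemma continuous_rootOuter : Continuous (rootOuter a b c) := by
  unfold rootOuter; fun_prop

lemma outer_radicand_pos (ha : 0 ≤ a) (hab : a < b) (hbc : b < c) {y : ℝ} (hy : c < y) :
    0 < y ^ 2 - a ^ 2 ∧ 0 < y ^ 2 - b ^ 2 ∧ 0 < y ^ 2 - c ^ 2 :=
  ⟨by nlinarith, by nlinarith, by nlinarith⟩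

lemma rootOuter_pos (ha : 0 ≤ a) (hab : a < b) (hbc : b < c) {y : ℝ} (hy : c < y) :
    0 < rootOuter a b c y := by
  obtain ⟨h1, h2, h3⟩ := outer_radicand_pos ha hab hbc hy
  unfold rootOuter
  positivity

/-- For y > c both y² - a² and y² - b² are at least (1 - b²/c²) y². The constant does not involve a,
so the bound is uniform as a → 0. -/
lemma div_rootOuter_le (ha : 0 ≤ a) (hab : a < b) (hbc : b < c) {y : ℝ} (hy : c < y) :
    y / rootOuter a b c y ≤ c ^ 2 / (c ^ 2 - b ^ 2) * arcsecDeriv c y := by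
  obtain ⟨h1, h2, h3⟩ := outer_radicand_pos ha hab hbc hy
  have hc : 0 < c := by linarith
  have hy0 : 0 < y := hc.trans hy
  have hcb : 0 < c ^ 2 - b ^ 2 := by nlinarith
  have hs : (c ^ 2 - b ^ 2) / c ^ 2 * y ^ 2 * √(y ^ 2 - c ^ 2) ≤ rootOuter a b c y := by
    unfold rootOuter
    rw [Real.sqrt_mul (by positivity)]
    gcongr
    apply Real.le_sqrt_of_sq_le
    have e1 : (c ^ 2 - b ^ 2) / c ^ 2 * y ^ 2 ≤ y ^ 2 - b ^ 2 := by
      rw [div_mul_eq_mul_div, div_le_iff₀ (by positivity)]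
      nlinarith [sq_nonneg b]
    have e2 : y ^ 2 - b ^ 2 ≤ y ^ 2 - a ^ 2 := by nlinarith
    calc ((c ^ 2 - b ^ 2) / c ^ 2 * y ^ 2) ^ 2 ≤ (y ^ 2 - b ^ 2) ^ 2 := by gcongr
      _ ≤ (y ^ 2 - a ^ 2) * (y ^ 2 - b ^ 2) := by nlinarith
  have hp : 0 < √(y ^ 2 - c ^ 2) := Real.sqrt_pos.mpr h3
  calc y / rootOuter a b c y ≤ y / ((c ^ 2 - b ^ 2) / c ^ 2 * y ^ 2 * √(y ^ 2 - c ^ 2)) := by gcongr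
    _ = c ^ 2 / (c ^ 2 - b ^ 2) * arcsecDeriv c y := by
      unfold arcsecDeriv
      field_simp

lemma integrableOn_div_rootOuter (ha : 0 ≤ a) (hab : a < b) (hbc : b < c) :
    IntegrableOn (fun y => y / rootOuter a b c y) (Ioi c) := by
  have hc : 0 < c := by linarith
  refine integrableOn_of_le_arcsecDeriv hc (K := c ^ 2 / (c ^ 2 - b ^ 2)) ?_ fun y hy => ?_
  · exact continuousOn_id.div continuous_rootOuter.continuousOn
      fun y hy => (rootOuter_pos ha hab hbc hy).ne'
  · have := rootOuter_pos ha hab hbc hy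
    rw [abs_of_nonneg (by have := hc.trans hy; positivity)]
    exact div_rootOuter_le ha hab hbc hy

lemma intervalIntegrable_one_div_rootOuter (ha : 0 ≤ a) (hab : a < b) (hbc : b < c) {Y : ℝ}
    (hY : c ≤ Y) : IntervalIntegrable (fun y => 1 / rootOuter a b c y) volume c Y := by
  have hc : 0 < c := by linarith
  have h : IntervalIntegrable (fun y => y / rootOuter a b c y) volume c Y := by
    rw [intervalIntegrable_iff_integrableOn_Ioc_of_le hY]
    exact (integrableOn_div_rootOuter ha hab hbc).mono_set Ioc_subset_Ioi_self
  have h2 : IntervalIntegrable (fun y => y⁻¹ * (y / rootOuter a b c y)) volume c Y := by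
    refine h.continuousOn_mul ?_
    refine continuousOn_id.inv₀ fun y hy => ?_
    rw [uIcc_of_le hY] at hy
    exact (hc.trans_le hy.1).ne'
  refine h2.congr ?_
  intro y hy
  rw [uIoc_of_le hY] at hy
  have : y ≠ 0 := (hc.trans hy.1).ne'
  simp only
  field_simp

/-- The factors (y - a)(b - y) carry both endpoint singularities; the rest is continuous on [a, b].
-/
lemma intervalIntegrable_one_div_rootGap (ha : 0 < a) (hab : a < b) (hbc : b < c) :
    IntervalIntegrable (fun y => 1 / rootGap a b c y) volume a b := by
  have h1 := intervalIntegrable_one_div_sqrt_mul hab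
  have h2 : ContinuousOn (fun y => 1 / √((y + a) * (b + y) * (c ^ 2 - y ^ 2))) (uIcc a b) := by
    rw [uIcc_of_le hab.le]
    refine continuousOn_const.div (Continuous.continuousOn (by fun_prop)) fun y hy => ?_
    refine (Real.sqrt_pos.mpr ?_).ne'
    have : 0 < y := ha.trans_le hy.1
    have h3 : 0 < c ^ 2 - y ^ 2 := by nlinarith [hy.2]
    have : 0 < b := ha.trans hab
    positivity
  refine (h1.mul_continuousOn h2).congr ?_
  intro y hy
  rw [uIoc_of_le hab.le] at hy
  simp only
  rw [one_div_mul_one_div, ← Real.sqrt_mul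
    (mul_nonneg (by linarith [hy.1]) (by linarith [hy.2])), rootGap]
  congr 2
  ring

lemma intervalIntegrable_one_div_rootInner (ha : 0 < a) (hab : a < b) (hbc : b < c) :
    IntervalIntegrable (fun y => 1 / rootInner a b c y) volume (-a) a := by
  have haa : -a < a := by linarith
  have h1 := intervalIntegrable_one_div_sqrt_mul haa
  have h2 : ContinuousOn (fun y => 1 / √((b ^ 2 - y ^ 2) * (c ^ 2 - y ^ 2))) (uIcc (-a) a) := by
    rw [uIcc_of_le haa.le]
    refine continuousOn_const.div (Continuous.continuousOn (by fun_prop)) fun y hy => ?_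
    refine (Real.sqrt_pos.mpr ?_).ne'
    have h3 : y ^ 2 ≤ a ^ 2 := sq_le_sq' hy.1 hy.2
    exact mul_pos (by nlinarith) (by nlinarith)
  refine (h1.mul_continuousOn h2).congr ?_
  intro y hy
  rw [uIoc_of_le haa.le] at hy
  simp only
  rw [one_div_mul_one_div, ← Real.sqrt_mul
    (mul_nonneg (by linarith [hy.1]) (by linarith [hy.2])), rootInner]
  congr 2
  ring

end Curve

section Expansions

variable {a b c : ℝ}

/-! ### The normalized integral with principal part `λ` -/

/-- The involution exchanging `(c, ∞)` and `(a, b)`. -/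
def gapInvolution (a b c y : ℝ) : ℝ :=
  √(a ^ 2 + (b ^ 2 - a ^ 2) * (c ^ 2 - a ^ 2) / (y ^ 2 - a ^ 2))

lemma gapInvolution_sq (ha : 0 ≤ a) (hab : a < b) (hbc : b < c) {y : ℝ} (hy : a < y) :
    gapInvolution a b c y ^ 2 = a ^ 2 + (b ^ 2 - a ^ 2) * (c ^ 2 - a ^ 2) / (y ^ 2 - a ^ 2) := by
  have h1 : 0 < y ^ 2 - a ^ 2 := by nlinarith
  have h2 : 0 < b ^ 2 - a ^ 2 := by nlinarith
  have h3 : 0 < c ^ 2 - a ^ 2 := by nlinarith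
  exact Real.sq_sqrt (by positivity)

lemma gapInvolution_pos (ha : 0 ≤ a) (hab : a < b) (hbc : b < c) {y : ℝ} (hy : a < y) :
    a < gapInvolution a b c y := by
  have h1 : 0 < y ^ 2 - a ^ 2 := by nlinarith
  have h2 : 0 < b ^ 2 - a ^ 2 := by nlinarith
  have h3 : 0 < c ^ 2 - a ^ 2 := by nlinarith
  apply Real.lt_sqrt_of_sq_lt
  have : 0 < (b ^ 2 - a ^ 2) * (c ^ 2 - a ^ 2) / (y ^ 2 - a ^ 2) := by positivity
  linarith

lemma gapInvolution_involutive (ha : 0 ≤ a) (hab : a < b) (hbc : b < c) {y : ℝ} (hy : a < y) :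
    gapInvolution a b c (gapInvolution a b c y) = y := by
  have h1 : 0 < y ^ 2 - a ^ 2 := by nlinarith
  have h2 : 0 < b ^ 2 - a ^ 2 := by nlinarith
  have h3 : 0 < c ^ 2 - a ^ 2 := by nlinarith
  have hpos := gapInvolution_pos ha hab hbc hy
  have e := gapInvolution_sq ha hab hbc hpos
  rw [gapInvolution_sq ha hab hbc hy] at e
  have e2 : gapInvolution a b c (gapInvolution a b c y) ^ 2 = y ^ 2 := by
    rw [e, add_sub_cancel_left]
    field_simp
    ring
  have h4 := gapInvolution_pos ha hab hbc hpos
  exact (sq_eq_sq₀ (by linarith) (by linarith)).mp e2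

lemma gapInvolution_image (ha : 0 ≤ a) (hab : a < b) (hbc : b < c) :
    gapInvolution a b c '' Ioi c = Ioo a b := by
  have h2 : 0 < b ^ 2 - a ^ 2 := by nlinarith
  have h3 : 0 < c ^ 2 - a ^ 2 := by nlinarith
  ext z
  constructor
  · rintro ⟨y, hy, rfl⟩
    have hy' : c < y := hy
    have hay : a < y := by linarith
    refine ⟨gapInvolution_pos ha hab hbc hay, ?_⟩
    rw [← sq_lt_sq₀ (by linarith [gapInvolution_pos ha hab hbc hay]) (by linarith),
      gapInvolution_sq ha hab hbc hay]
    have h1 : 0 < y ^ 2 - a ^ 2 := by nlinarith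
    have : (b ^ 2 - a ^ 2) * (c ^ 2 - a ^ 2) / (y ^ 2 - a ^ 2) < b ^ 2 - a ^ 2 := by
      rw [div_lt_iff₀ h1]
      exact mul_lt_mul_of_pos_left (by nlinarith) h2
    linarith
  · intro hz
    refine ⟨gapInvolution a b c z, ?_, gapInvolution_involutive ha hab hbc hz.1⟩
    have h4 := gapInvolution_pos ha hab hbc hz.1
    change c < _
    rw [← sq_lt_sq₀ (by linarith) (by linarith), gapInvolution_sq ha hab hbc hz.1]
    have h1 : 0 < z ^ 2 - a ^ 2 := by nlinarith [hz.1]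
    have : c ^ 2 - a ^ 2 < (b ^ 2 - a ^ 2) * (c ^ 2 - a ^ 2) / (z ^ 2 - a ^ 2) := by
      rw [lt_div_iff₀ h1, mul_comm]
      exact mul_lt_mul_of_pos_right (by nlinarith [hz.1, hz.2]) h3
    linarith

lemma hasDerivAt_gapInvolution (ha : 0 ≤ a) (hab : a < b) (hbc : b < c) {y : ℝ} (hy : a < y) :
    HasDerivAt (gapInvolution a b c) (-((b ^ 2 - a ^ 2) * (c ^ 2 - a ^ 2) * y) /
      ((y ^ 2 - a ^ 2) ^ 2 * gapInvolution a b c y)) y := by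
  have h1 : 0 < y ^ 2 - a ^ 2 := by nlinarith
  have h2 : 0 < b ^ 2 - a ^ 2 := by nlinarith
  have h3 : 0 < c ^ 2 - a ^ 2 := by nlinarith
  have hp := gapInvolution_pos ha hab hbc hy
  have hp' : 0 < gapInvolution a b c y := by linarith
  have hr : 0 < a ^ 2 + (b ^ 2 - a ^ 2) * (c ^ 2 - a ^ 2) / (y ^ 2 - a ^ 2) := by positivity
  have h := (((hasDerivAt_const y ((b ^ 2 - a ^ 2) * (c ^ 2 - a ^ 2))).div
    ((hasDerivAt_pow 2 y).sub_const (a ^ 2)) h1.ne').const_add (a ^ 2)).sqrt hr.ne'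
  refine h.congr_deriv ?_
  change _ / (2 * gapInvolution a b c y) = _
  field_simp
  norm_num
  ring

/-- Odd differentials descend to the elliptic curve in s = y² with branch points a², b², c², ∞. The
involution, (z² - a²)(y² - a²) = (b² - a²)(c² - a²), swaps b² with c² and a² with ∞, hence preserves
ds/√((s - a²)(s - b²)(s - c²)) up to sign. -/
lemma gapInvolution_pullback (ha : 0 ≤ a) (hab : a < b) (hbc : b < c) (q : ℝ) {y : ℝ}
    (hy : c < y) :
    |(-((b ^ 2 - a ^ 2) * (c ^ 2 - a ^ 2) * y) / ((y ^ 2 - a ^ 2) ^ 2 * gapInvolution a b c y))| *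
      ((gapInvolution a b c y ^ 3 + q * gapInvolution a b c y) /
        rootGap a b c (gapInvolution a b c y)) =
    ((b ^ 2 - a ^ 2) * (c ^ 2 - a ^ 2) / (y ^ 2 - a ^ 2) + (a ^ 2 + q)) *
      (y / rootOuter a b c y) := by
  have hay : a < y := by linarith
  obtain ⟨h1, h4, h5⟩ := outer_radicand_pos ha hab hbc hy
  have h2 : 0 < b ^ 2 - a ^ 2 := by nlinarith
  have h3 : 0 < c ^ 2 - a ^ 2 := by nlinarith
  have hy0 : 0 < y := by linarith
  have hp := gapInvolution_pos ha hab hbc hay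
  have hp' : 0 < gapInvolution a b c y := by linarith
  have hR := rootOuter_pos ha hab hbc hy
  have hsq := gapInvolution_sq ha hab hbc hay
  have hgap : rootGap a b c (gapInvolution a b c y) =
      (b ^ 2 - a ^ 2) * (c ^ 2 - a ^ 2) / (y ^ 2 - a ^ 2) ^ 2 * rootOuter a b c y := by
    unfold rootGap rootOuter
    rw [hsq, ← Real.sqrt_sq (show 0 ≤ (b ^ 2 - a ^ 2) * (c ^ 2 - a ^ 2) / (y ^ 2 - a ^ 2) ^ 2 by
      positivity), ← Real.sqrt_mul (by positivity)]
    congr 1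
    field_simp
    ring
  rw [hgap, neg_div, abs_neg, abs_of_pos (by positivity)]
  rw [show gapInvolution a b c y ^ 3 + q * gapInvolution a b c y
    = gapInvolution a b c y * (gapInvolution a b c y ^ 2 + q) by ring, hsq]
  field_simp
  ring

lemma setIntegral_outer_eq_gap (ha : 0 ≤ a) (hab : a < b) (hbc : b < c) (q : ℝ) :
    ∫ y in Ioi c, ((b ^ 2 - a ^ 2) * (c ^ 2 - a ^ 2) / (y ^ 2 - a ^ 2) + (a ^ 2 + q)) *
      (y / rootOuter a b c y) = ∫ y in a..b, (y ^ 3 + q * y) / rootGap a b c y := by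
  rw [intervalIntegral.integral_of_le hab.le, integral_Ioc_eq_integral_Ioo,
    ← gapInvolution_image ha hab hbc]
  have hinj : InjOn (gapInvolution a b c) (Ioi c) := by
    intro y hy z hz h
    have hy' : c < y := hy
    have hz' : c < z := hz
    rw [← gapInvolution_involutive ha hab hbc (show a < y by linarith), h,
      gapInvolution_involutive ha hab hbc (show a < z by linarith)]
  rw [integral_image_eq_integral_abs_deriv_smul measurableSet_Ioi (fun y hy =>
    (hasDerivAt_gapInvolution ha hab hbc
      (show a < y by have : c < y := hy; linarith)).hasDerivWithinAt) hinj]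
  exact setIntegral_congr_fun measurableSet_Ioi fun y hy =>
    (gapInvolution_pullback ha hab hbc q hy).symm

/-- The algebraic part of the integral. -/
def algPart (a b c y : ℝ) : ℝ := √((y ^ 2 - b ^ 2) * (y ^ 2 - c ^ 2) / (y ^ 2 - a ^ 2))

/-- Exactly the difference between the odd integrand and its image under the involution, so the
divergent part of the odd integral is algebraic. -/
lemma hasDerivAt_algPart (ha : 0 ≤ a) (hab : a < b) (hbc : b < c) {y : ℝ} (hy : c < y) :
    HasDerivAt (algPart a b c)
      (((y ^ 2 - a ^ 2) - (b ^ 2 - a ^ 2) * (c ^ 2 - a ^ 2) / (y ^ 2 - a ^ 2)) *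
        (y / rootOuter a b c y)) y := by
  obtain ⟨h1, h4, h5⟩ := outer_radicand_pos ha hab hbc hy
  have h := ((((hasDerivAt_pow 2 y).sub_const (b ^ 2)).mul
    ((hasDerivAt_pow 2 y).sub_const (c ^ 2))).div
    ((hasDerivAt_pow 2 y).sub_const (a ^ 2)) h1.ne').sqrt
      (show (y ^ 2 - b ^ 2) * (y ^ 2 - c ^ 2) / (y ^ 2 - a ^ 2) ≠ 0 by positivity)
  refine h.congr_deriv ?_
  have hR := rootOuter_pos ha hab hbc hy
  have e : √((y ^ 2 - b ^ 2) * (y ^ 2 - c ^ 2) / (y ^ 2 - a ^ 2))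
      = rootOuter a b c y / (y ^ 2 - a ^ 2) := by
    unfold rootOuter
    rw [← Real.sqrt_sq h1.le, ← Real.sqrt_div (by positivity), Real.sqrt_sq h1.le]
    congr 1
    field_simp
  change _ / (2 * √((y ^ 2 - b ^ 2) * (y ^ 2 - c ^ 2) / (y ^ 2 - a ^ 2))) = _
  rw [e]
  field_simp
  norm_num
  ring

lemma continuousOn_algPart (ha : 0 ≤ a) (hab : a < b) (hbc : b < c) :
    ContinuousOn (algPart a b c) (Ici c) := by
  refine (ContinuousOn.div (by fun_prop) (by fun_prop) fun y hy => ?_).sqrt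
  have : c ≤ y := hy
  nlinarith

/-- The difference E² - Y² stays bounded, and dividing by E + Y ≥ Y gives the decay; in particular
the algebraic part has no constant term. -/
lemma isBigO_algPart (ha : 0 ≤ a) (hab : a < b) (hbc : b < c) :
    (fun Y => algPart a b c Y - Y) =O[atTop] fun Y => Y⁻¹ := by
  have hc : 0 < c := by linarith
  have h2 : 0 < b ^ 2 - a ^ 2 := by nlinarith
  have h3 : 0 < c ^ 2 - a ^ 2 := by nlinarith
  refine IsBigO.of_bound (b ^ 2 + c ^ 2 + (b ^ 2 - a ^ 2)) ?_
  filter_upwards [eventually_gt_atTop c] with Y hY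
  obtain ⟨h1, h4, h5⟩ := outer_radicand_pos ha hab hbc hY
  have hY0 : 0 < Y := hc.trans hY
  have hE : 0 ≤ algPart a b c Y := Real.sqrt_nonneg _
  have hsq : algPart a b c Y ^ 2 = (Y ^ 2 - b ^ 2) * (Y ^ 2 - c ^ 2) / (Y ^ 2 - a ^ 2) :=
    Real.sq_sqrt (by positivity)
  have e : algPart a b c Y ^ 2 - Y ^ 2 = a ^ 2 - b ^ 2 - c ^ 2
      + (b ^ 2 - a ^ 2) * ((c ^ 2 - a ^ 2) / (Y ^ 2 - a ^ 2)) := by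
    rw [hsq]
    field_simp
    ring
  have hle1 : (c ^ 2 - a ^ 2) / (Y ^ 2 - a ^ 2) ≤ 1 := by rw [div_le_one h1]; nlinarith
  have hle0 : 0 ≤ (c ^ 2 - a ^ 2) / (Y ^ 2 - a ^ 2) := by positivity
  have hb : |algPart a b c Y ^ 2 - Y ^ 2| ≤ b ^ 2 + c ^ 2 + (b ^ 2 - a ^ 2) := by
    rw [e, abs_le]
    constructor <;> nlinarith [sq_nonneg a, sq_nonneg b, sq_nonneg c]
  have hf : algPart a b c Y - Y = (algPart a b c Y ^ 2 - Y ^ 2) / (algPart a b c Y + Y) := by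
    rw [eq_div_iff (by positivity)]
    ring
  rw [hf, norm_div, Real.norm_eq_abs, Real.norm_eq_abs, Real.norm_eq_abs,
    abs_of_pos (by positivity : 0 < algPart a b c Y + Y), abs_of_pos (by positivity : 0 < Y⁻¹),
    ← div_eq_mul_inv]
  gcongr
  linarith

lemma odd_coefficient_bound (ha : 0 ≤ a) (hab : a < b) (hbc : b < c) (q : ℝ) {y : ℝ} (hy : c < y) :
    |((b ^ 2 - a ^ 2) * (c ^ 2 - a ^ 2) / (y ^ 2 - a ^ 2) + (a ^ 2 + q)) *
      (y / rootOuter a b c y)| ≤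
    ((b ^ 2 - a ^ 2) + |a ^ 2 + q|) * (c ^ 2 / (c ^ 2 - b ^ 2)) * arcsecDeriv c y := by
  obtain ⟨h1, h4, h5⟩ := outer_radicand_pos ha hab hbc hy
  have h2 : 0 < b ^ 2 - a ^ 2 := by nlinarith
  have h3 : 0 < c ^ 2 - a ^ 2 := by nlinarith
  have hR := rootOuter_pos ha hab hbc hy
  have hy0 : 0 < y := by linarith
  rw [abs_mul, abs_of_pos (div_pos hy0 hR), mul_assoc]
  have h6 := div_rootOuter_le ha hab hbc hy
  have h7 : |(b ^ 2 - a ^ 2) * (c ^ 2 - a ^ 2) / (y ^ 2 - a ^ 2) + (a ^ 2 + q)| ≤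
      (b ^ 2 - a ^ 2) + |a ^ 2 + q| := by
    refine (abs_add_le _ _).trans ?_
    gcongr
    rw [abs_of_pos (by positivity), div_le_iff₀ h1]
    gcongr
    linarith
  gcongr

lemma continuousOn_odd_remainder (ha : 0 ≤ a) (hab : a < b) (hbc : b < c) (q : ℝ) :
    ContinuousOn (fun y => ((b ^ 2 - a ^ 2) * (c ^ 2 - a ^ 2) / (y ^ 2 - a ^ 2) + (a ^ 2 + q)) *
      (y / rootOuter a b c y)) (Ioi c) := by
  refine ((continuousOn_const.div (by fun_prop) fun y hy => ?_).add continuousOn_const).mul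
    (continuousOn_id.div continuous_rootOuter.continuousOn
      fun y hy => (rootOuter_pos ha hab hbc hy).ne')
  exact (outer_radicand_pos ha hab hbc hy).1.ne'

lemma integral_odd_eq (ha : 0 ≤ a) (hab : a < b) (hbc : b < c) (q : ℝ) {Y : ℝ} (hY : c ≤ Y) :
    ∫ y in c..Y, (y ^ 3 + q * y) / rootOuter a b c y = algPart a b c Y +
      ∫ y in c..Y, ((b ^ 2 - a ^ 2) * (c ^ 2 - a ^ 2) / (y ^ 2 - a ^ 2) + (a ^ 2 + q)) *
        (y / rootOuter a b c y) := by
  have hc : 0 < c := by linarith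
  have hint : IntervalIntegrable (fun y => ((b ^ 2 - a ^ 2) * (c ^ 2 - a ^ 2) / (y ^ 2 - a ^ 2) +
      (a ^ 2 + q)) * (y / rootOuter a b c y)) volume c Y := by
    rw [intervalIntegrable_iff_integrableOn_Ioc_of_le hY]
    exact (integrableOn_of_le_arcsecDeriv hc (continuousOn_odd_remainder ha hab hbc q)
      (fun y hy => odd_coefficient_bound ha hab hbc q hy)).mono_set Ioc_subset_Ioi_self
  have hint2 : IntervalIntegrable (fun y => (y ^ 3 + q * y) / rootOuter a b c y) volume c Y := by
    refine ((intervalIntegrable_one_div_rootOuter ha hab hbc hY).continuousOn_mul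
      (g := fun y => y ^ 3 + q * y) (by fun_prop)).congr fun y _ => ?_
    rw [mul_one_div]
  have h := intervalIntegral.integral_eq_sub_of_hasDerivAt_of_le hY (f := algPart a b c)
    (f' := fun y => (y ^ 3 + q * y) / rootOuter a b c y -
      ((b ^ 2 - a ^ 2) * (c ^ 2 - a ^ 2) / (y ^ 2 - a ^ 2) + (a ^ 2 + q)) *
        (y / rootOuter a b c y))
    ((continuousOn_algPart ha hab hbc).mono Icc_subset_Ici_self)
    (fun y hy => (hasDerivAt_algPart ha hab hbc hy.1).congr_deriv (by
      obtain ⟨h1, -, -⟩ := outer_radicand_pos ha hab hbc hy.1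
      have := rootOuter_pos ha hab hbc hy.1
      field_simp
      ring)) (hint2.sub hint)
  rw [intervalIntegral.integral_sub hint2 hint] at h
  have h0 : algPart a b c c = 0 := by simp [algPart]
  rw [h0] at h
  linarith

/-- The normalized Abelian integral with principal part `y` has no constant term. -/
lemma isBigO_integral_odd (ha : 0 ≤ a) (hab : a < b) (hbc : b < c) {q : ℝ}
    (hq : ∫ y in a..b, (y ^ 3 + q * y) / rootGap a b c y = 0) :
    (fun Y => (∫ y in c..Y, (y ^ 3 + q * y) / rootOuter a b c y) - Y) =O[atTop] fun Y => Y⁻¹ := by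
  have hc : 0 < c := by linarith
  have h1 := isBigO_integral_tail hc (continuousOn_odd_remainder ha hab hbc q)
    (fun y hy => odd_coefficient_bound ha hab hbc q hy)
  rw [setIntegral_outer_eq_gap ha hab hbc, hq] at h1
  refine ((isBigO_algPart ha hab hbc).add h1).congr' ?_ EventuallyEq.rfl
  filter_upwards [eventually_ge_atTop c] with Y hY
  rw [integral_odd_eq ha hab hbc q hY]
  ring

/-! ### The normalized integral with principal part `2 λ²` -/

/-- The numerator of the even differential is chosen to agree with this derivative in degrees 4 and
2, so that the remainder is integrable up to infinity. -/
lemma hasDerivAt_rootOuter_div (ha : 0 ≤ a) (hab : a < b) (hbc : b < c) {y : ℝ} (hy : c < y) :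
    HasDerivAt (fun y => 2 * rootOuter a b c y / y)
      ((4 * y ^ 4 - 2 * (a ^ 2 + b ^ 2 + c ^ 2) * y ^ 2 + 2 * (a ^ 2 * b ^ 2 * c ^ 2) / y ^ 2) /
        rootOuter a b c y) y := by
  obtain ⟨h1, h4, h5⟩ := outer_radicand_pos ha hab hbc hy
  have hy0 : 0 < y := by linarith
  have hr := ((((hasDerivAt_pow 2 y).sub_const (a ^ 2)).mul
    ((hasDerivAt_pow 2 y).sub_const (b ^ 2))).mul
    ((hasDerivAt_pow 2 y).sub_const (c ^ 2))).sqrt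
      (show (y ^ 2 - a ^ 2) * (y ^ 2 - b ^ 2) * (y ^ 2 - c ^ 2) ≠ 0 by positivity)
  have h := (hr.const_mul 2).div (hasDerivAt_id y) hy0.ne'
  refine h.congr_deriv ?_
  have hR := rootOuter_pos ha hab hbc hy
  have hR2 : rootOuter a b c y ^ 2 = (y ^ 2 - a ^ 2) * (y ^ 2 - b ^ 2) * (y ^ 2 - c ^ 2) :=
    Real.sq_sqrt (by positivity)
  change (2 * (_ / (2 * rootOuter a b c y)) * y - 2 * rootOuter a b c y * 1) / y ^ 2 = _
  field_simp
  rw [hR2]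
  norm_num
  ring

lemma even_remainder_bound (ha : 0 ≤ a) (hab : a < b) (hbc : b < c) (q : ℝ) {y : ℝ} (hy : c < y) :
    |(q - 2 * (a ^ 2 * b ^ 2 * c ^ 2) / y ^ 2) / rootOuter a b c y| ≤
    (|q| + 2 * (a ^ 2 * b ^ 2)) * (c / (c ^ 2 - b ^ 2)) * arcsecDeriv c y := by
  have hR := rootOuter_pos ha hab hbc hy
  have hc : 0 < c := by linarith
  have hy0 : 0 < y := by linarith
  have h6 := div_rootOuter_le ha hab hbc hy
  have h7 : |q - 2 * (a ^ 2 * b ^ 2 * c ^ 2) / y ^ 2| ≤ |q| + 2 * (a ^ 2 * b ^ 2) := by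
    refine (abs_sub _ _).trans ?_
    gcongr
    rw [abs_of_nonneg (by positivity), div_le_iff₀ (by positivity), ← mul_assoc]
    gcongr
  have h8 : 1 / rootOuter a b c y ≤ c / (c ^ 2 - b ^ 2) * arcsecDeriv c y := by
    calc 1 / rootOuter a b c y ≤ (y / c) * (1 / rootOuter a b c y) := by
          refine le_mul_of_one_le_left (by positivity) ?_
          rw [one_le_div hc]
          exact hy.le
      _ = (1 / c) * (y / rootOuter a b c y) := by ring
      _ ≤ (1 / c) * (c ^ 2 / (c ^ 2 - b ^ 2) * arcsecDeriv c y) := by gcongr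
      _ = c / (c ^ 2 - b ^ 2) * arcsecDeriv c y := by field_simp
  rw [abs_div, abs_of_pos hR]
  calc |q - 2 * (a ^ 2 * b ^ 2 * c ^ 2) / y ^ 2| / rootOuter a b c y
      = |q - 2 * (a ^ 2 * b ^ 2 * c ^ 2) / y ^ 2| * (1 / rootOuter a b c y) := by ring
    _ ≤ (|q| + 2 * (a ^ 2 * b ^ 2)) * (c / (c ^ 2 - b ^ 2) * arcsecDeriv c y) := by gcongr
    _ = _ := by ring

lemma continuousOn_even_remainder (ha : 0 ≤ a) (hab : a < b) (hbc : b < c) (q : ℝ) :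
    ContinuousOn (fun y => (q - 2 * (a ^ 2 * b ^ 2 * c ^ 2) / y ^ 2) / rootOuter a b c y)
      (Ioi c) := by
  refine ContinuousOn.div (continuousOn_const.sub (continuousOn_const.div (by fun_prop)
    fun y hy => ?_)) continuous_rootOuter.continuousOn fun y hy => (rootOuter_pos ha hab hbc hy).ne'
  have : c < y := hy
  exact pow_ne_zero 2 (by linarith)

lemma integral_even_eq (ha : 0 ≤ a) (hab : a < b) (hbc : b < c) (q : ℝ) {Y : ℝ} (hY : c ≤ Y) :
    ∫ y in c..Y, (4 * y ^ 4 - 2 * (a ^ 2 + b ^ 2 + c ^ 2) * y ^ 2 + q) / rootOuter a b c y =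
      2 * rootOuter a b c Y / Y +
      ∫ y in c..Y, (q - 2 * (a ^ 2 * b ^ 2 * c ^ 2) / y ^ 2) / rootOuter a b c y := by
  have hc : 0 < c := by linarith
  have hint : IntervalIntegrable (fun y => (q - 2 * (a ^ 2 * b ^ 2 * c ^ 2) / y ^ 2) /
      rootOuter a b c y) volume c Y := by
    rw [intervalIntegrable_iff_integrableOn_Ioc_of_le hY]
    exact (integrableOn_of_le_arcsecDeriv hc (continuousOn_even_remainder ha hab hbc q)
      (fun y hy => even_remainder_bound ha hab hbc q hy)).mono_set Ioc_subset_Ioi_self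
  have hint2 : IntervalIntegrable (fun y => (4 * y ^ 4 - 2 * (a ^ 2 + b ^ 2 + c ^ 2) * y ^ 2 + q) /
      rootOuter a b c y) volume c Y := by
    refine ((intervalIntegrable_one_div_rootOuter ha hab hbc hY).continuousOn_mul
      (g := fun y => 4 * y ^ 4 - 2 * (a ^ 2 + b ^ 2 + c ^ 2) * y ^ 2 + q)
      (by fun_prop)).congr fun y _ => ?_
    rw [mul_one_div]
  have h := intervalIntegral.integral_eq_sub_of_hasDerivAt_of_le hY
    (f := fun y => 2 * rootOuter a b c y / y)
    (f' := fun y => (4 * y ^ 4 - 2 * (a ^ 2 + b ^ 2 + c ^ 2) * y ^ 2 + q) / rootOuter a b c y -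
      (q - 2 * (a ^ 2 * b ^ 2 * c ^ 2) / y ^ 2) / rootOuter a b c y)
    ((continuous_const.mul continuous_rootOuter).continuousOn.div continuousOn_id
      fun y hy => (hc.trans_le hy.1).ne')
    (fun y hy => (hasDerivAt_rootOuter_div ha hab hbc hy.1).congr_deriv (by ring))
    (hint2.sub hint)
  rw [intervalIntegral.integral_sub hint2 hint] at h
  have h0 : rootOuter a b c c = 0 := by simp [rootOuter]
  rw [h0, mul_zero, zero_div] at h
  linarith

lemma isBigO_rootOuter_div (ha : 0 ≤ a) (hab : a < b) (hbc : b < c) :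
    (fun Y => 2 * rootOuter a b c Y / Y - (2 * Y ^ 2 - (a ^ 2 + b ^ 2 + c ^ 2))) =O[atTop]
      fun Y => Y⁻¹ := by
  have hc : 0 < c := by linarith
  set s := a ^ 2 + b ^ 2 + c ^ 2 with hs
  set s2 := a ^ 2 * b ^ 2 + a ^ 2 * c ^ 2 + b ^ 2 * c ^ 2 with hs2
  set s3 := a ^ 2 * b ^ 2 * c ^ 2 with hs3
  have hs0 : 0 ≤ s := by positivity
  have hs20 : 0 ≤ s2 := by positivity
  have hs30 : 0 ≤ s3 := by positivity
  refine IsBigO.of_bound (4 * s2 + s ^ 2 + 4 * s3) ?_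
  -- The bound Y ≥ s + 1 ensures 2Y² - s ≥ Y, a lower bound for the denominator after rationalizing.
  filter_upwards [eventually_gt_atTop c, eventually_ge_atTop 1, eventually_ge_atTop (s + 1)]
    with Y hY hY1 hYs
  obtain ⟨h1, h4, h5⟩ := outer_radicand_pos ha hab hbc hY
  have hY0 : 0 < Y := hc.trans hY
  have hR := rootOuter_pos ha hab hbc hY
  have hR2 : rootOuter a b c Y ^ 2 = (Y ^ 2 - a ^ 2) * (Y ^ 2 - b ^ 2) * (Y ^ 2 - c ^ 2) :=
    Real.sq_sqrt (by positivity)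
  have hden : Y ≤ 2 * rootOuter a b c Y / Y + (2 * Y ^ 2 - s) := by
    have : 0 ≤ 2 * rootOuter a b c Y / Y := by positivity
    nlinarith
  have e : (2 * rootOuter a b c Y / Y - (2 * Y ^ 2 - s)) =
      (4 * s2 - s ^ 2 - 4 * s3 / Y ^ 2) / (2 * rootOuter a b c Y / Y + (2 * Y ^ 2 - s)) := by
    rw [eq_div_iff (by linarith)]
    have : (2 * rootOuter a b c Y / Y - (2 * Y ^ 2 - s)) *
        (2 * rootOuter a b c Y / Y + (2 * Y ^ 2 - s)) =
        4 * rootOuter a b c Y ^ 2 / Y ^ 2 - (2 * Y ^ 2 - s) ^ 2 := by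
      field_simp
      ring
    rw [this, hR2]
    field_simp
    rw [hs, hs2, hs3]
    ring
  have hnum : |4 * s2 - s ^ 2 - 4 * s3 / Y ^ 2| ≤ 4 * s2 + s ^ 2 + 4 * s3 := by
    have h6 : 4 * s3 / Y ^ 2 ≤ 4 * s3 := div_le_self (by positivity) (by nlinarith)
    have h7 : 0 ≤ 4 * s3 / Y ^ 2 := by positivity
    rw [abs_le]
    constructor <;> nlinarith [sq_nonneg s]
  rw [e, norm_div, Real.norm_eq_abs, Real.norm_eq_abs, Real.norm_eq_abs,
    abs_of_pos (by linarith : 0 < 2 * rootOuter a b c Y / Y + (2 * Y ^ 2 - s)),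
    abs_of_pos (by positivity : 0 < Y⁻¹), ← div_eq_mul_inv]
  gcongr

lemma isBigO_integral_even (ha : 0 ≤ a) (hab : a < b) (hbc : b < c) (q : ℝ) :
    (fun Y => (∫ y in c..Y, (4 * y ^ 4 - 2 * (a ^ 2 + b ^ 2 + c ^ 2) * y ^ 2 + q) /
        rootOuter a b c y) - (2 * Y ^ 2 - (a ^ 2 + b ^ 2 + c ^ 2) +
        ∫ y in Ioi c, (q - 2 * (a ^ 2 * b ^ 2 * c ^ 2) / y ^ 2) / rootOuter a b c y)) =O[atTop]
      fun Y => Y⁻¹ := by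
  have hc : 0 < c := by linarith
  have h1 := isBigO_integral_tail hc (continuousOn_even_remainder ha hab hbc q)
    (fun y hy => even_remainder_bound ha hab hbc q hy)
  refine ((isBigO_rootOuter_div ha hab hbc).add h1).congr' ?_ EventuallyEq.rfl
  filter_upwards [eventually_ge_atTop c] with Y hY
  rw [integral_even_eq ha hab hbc q hY]
  ring

/-- The last integral does not depend on a, so the remainder vanishes in the limit once q → 0. -/
lemma abs_integral_even_remainder_le (ha : 0 ≤ a) (hab : a < b) (hbc : b < c) (q : ℝ) :
    |∫ y in Ioi c, (q - 2 * (a ^ 2 * b ^ 2 * c ^ 2) / y ^ 2) / rootOuter a b c y| ≤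
      (|q| + 2 * (a ^ 2 * b ^ 2)) * (c / (c ^ 2 - b ^ 2)) * ∫ y in Ioi c, arcsecDeriv c y := by
  have hc : 0 < c := by linarith
  rw [← integral_const_mul, ← Real.norm_eq_abs]
  refine norm_integral_le_of_norm_le ((integrableOn_arcsecDeriv hc).const_mul _) ?_
  filter_upwards [ae_restrict_mem measurableSet_Ioi] with y hy
  exact even_remainder_bound ha hab hbc q hy

end Expansions

/-! ### Uniqueness of the normalized Abelian integrals -/

/-- The polynomial `P(lam0 + i y)` in `y`. -/
def rayPoly (lam0 : ℝ) (P : Polynomial ℂ) : Polynomial ℂ :=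
  P.comp (Polynomial.C (lam0 : ℂ) + Polynomial.C Complex.I * Polynomial.X)

lemma eval_rayPoly (lam0 : ℝ) (P : Polynomial ℂ) (y : ℂ) :
    (rayPoly lam0 P).eval y = P.eval ((lam0 : ℂ) + Complex.I * y) := by
  simp [rayPoly, Polynomial.eval_comp]

lemma rayPoly_sub (lam0 : ℝ) (P P' : Polynomial ℂ) :
    rayPoly lam0 (P - P') = rayPoly lam0 P - rayPoly lam0 P' := by
  simp [rayPoly, Polynomial.sub_comp]

lemma exists_rayPoly_eq (lam0 : ℝ) (Q : Polynomial ℂ) : ∃ P, rayPoly lam0 P = Q := by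
  refine ⟨Q.comp (Polynomial.C (-Complex.I) * (Polynomial.X - Polynomial.C (lam0 : ℂ))), ?_⟩
  rw [rayPoly, Polynomial.comp_assoc]
  have : (Polynomial.C (-Complex.I) * (Polynomial.X - Polynomial.C (lam0 : ℂ))).comp
      (Polynomial.C (lam0 : ℂ) + Polynomial.C Complex.I * Polynomial.X) = Polynomial.X := by
    simp only [Polynomial.mul_comp, Polynomial.C_comp, Polynomial.sub_comp, Polynomial.X_comp,
      add_sub_cancel_left]
    rw [← mul_assoc, ← Polynomial.C_mul]
    simp
  rw [this, Polynomial.comp_X]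

section Abelian

variable {a b c : ℝ}

lemma periodA1_eq (lam0 : ℝ) (P : Polynomial ℂ) : periodA1 a b c lam0 P =
    ∫ y in (-a)..a, (rayPoly lam0 P).eval (y : ℂ) * ((1 / rootInner a b c y : ℝ) : ℂ) := by
  unfold periodA1 rootInner
  refine intervalIntegral.integral_congr fun y _ => ?_
  rw [eval_rayPoly]
  push_cast
  ring

lemma periodA2_eq (lam0 : ℝ) (P : Polynomial ℂ) : periodA2 a b c lam0 P =
    ∫ y in a..b, ((rayPoly lam0 P).eval (y : ℂ) - (rayPoly lam0 P).eval (-(y : ℂ))) *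
      ((1 / rootGap a b c y : ℝ) : ℂ) := by
  unfold periodA2 rootGap
  refine intervalIntegral.integral_congr fun y _ => ?_
  rw [eval_rayPoly, eval_rayPoly, mul_neg, ← sub_eq_add_neg]
  push_cast
  ring

lemma abelianIntegral_eq (lam0 : ℝ) (P : Polynomial ℂ) (Y : ℝ) : abelianIntegral a b c lam0 P Y =
    -∫ y in c..Y, (rayPoly lam0 P).eval (y : ℂ) * ((1 / rootOuter a b c y : ℝ) : ℂ) := by
  unfold abelianIntegral rootOuter
  rw [← intervalIntegral.integral_neg]
  refine intervalIntegral.integral_congr fun y _ => ?_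
  rw [eval_rayPoly, Complex.ofReal_div, Complex.ofReal_one]
  generalize ((√((y ^ 2 - a ^ 2) * (y ^ 2 - b ^ 2) * (y ^ 2 - c ^ 2)) : ℝ) : ℂ) = r
  rw [div_eq_mul_inv, mul_inv, neg_eq_neg_one_mul Complex.I, mul_inv, Complex.inv_I]
  norm_num
  linear_combination (Polynomial.eval ((lam0 : ℂ) + Complex.I * y) P * r⁻¹) * Complex.I_sq

lemma intervalIntegrable_eval_mul {w : ℝ → ℝ} {p q : ℝ} (hw : IntervalIntegrable w volume p q)
    {g : ℝ → ℂ} (hg : Continuous g) :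
    IntervalIntegrable (fun y => g y * ((w y : ℝ) : ℂ)) volume p q :=
  IntervalIntegrable.continuousOn_mul (f := fun y => ((w y : ℝ) : ℂ))
    ⟨hw.1.ofReal, hw.2.ofReal⟩ hg.continuousOn

lemma continuous_eval_ofReal (Q : Polynomial ℂ) : Continuous fun y : ℝ => Q.eval (y : ℂ) :=
  Q.continuous.comp Complex.continuous_ofReal

lemma continuous_eval_neg_ofReal (Q : Polynomial ℂ) : Continuous fun y : ℝ => Q.eval (-(y : ℂ)) :=
  Q.continuous.comp Complex.continuous_ofReal.neg

lemma periodA1_sub (ha : 0 < a) (hab : a < b) (hbc : b < c) (lam0 : ℝ) (P P' : Polynomial ℂ) :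
    periodA1 a b c lam0 (P - P') = periodA1 a b c lam0 P - periodA1 a b c lam0 P' := by
  have h := intervalIntegrable_one_div_rootInner ha hab hbc
  rw [periodA1_eq, periodA1_eq, periodA1_eq, ← intervalIntegral.integral_sub
    (intervalIntegrable_eval_mul h (continuous_eval_ofReal _))
    (intervalIntegrable_eval_mul h (continuous_eval_ofReal _))]
  refine intervalIntegral.integral_congr fun y _ => ?_
  simp only [rayPoly_sub, Polynomial.eval_sub]
  ring

lemma periodA2_sub (ha : 0 < a) (hab : a < b) (hbc : b < c) (lam0 : ℝ) (P P' : Polynomial ℂ) :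
    periodA2 a b c lam0 (P - P') = periodA2 a b c lam0 P - periodA2 a b c lam0 P' := by
  have h := intervalIntegrable_one_div_rootGap ha hab hbc
  rw [periodA2_eq, periodA2_eq, periodA2_eq, ← intervalIntegral.integral_sub
    (intervalIntegrable_eval_mul (g := fun y : ℝ => (rayPoly lam0 P).eval (y : ℂ) -
      (rayPoly lam0 P).eval (-(y : ℂ))) h
      ((continuous_eval_ofReal _).sub (continuous_eval_neg_ofReal _)))
    (intervalIntegrable_eval_mul (g := fun y : ℝ => (rayPoly lam0 P').eval (y : ℂ) -
      (rayPoly lam0 P').eval (-(y : ℂ))) h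
      ((continuous_eval_ofReal _).sub (continuous_eval_neg_ofReal _)))]
  refine intervalIntegral.integral_congr fun y _ => ?_
  simp only [rayPoly_sub, Polynomial.eval_sub]
  ring

lemma abelianIntegral_sub (ha : 0 < a) (hab : a < b) (hbc : b < c) (lam0 : ℝ)
    (P P' : Polynomial ℂ) {Y : ℝ} (hY : c ≤ Y) : abelianIntegral a b c lam0 (P - P') Y =
      abelianIntegral a b c lam0 P Y - abelianIntegral a b c lam0 P' Y := by
  have h := intervalIntegrable_one_div_rootOuter ha.le hab hbc hY
  rw [abelianIntegral_eq, abelianIntegral_eq, abelianIntegral_eq, ← neg_sub', neg_inj,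
    ← intervalIntegral.integral_sub
    (intervalIntegrable_eval_mul h (continuous_eval_ofReal _))
    (intervalIntegrable_eval_mul h (continuous_eval_ofReal _))]
  refine intervalIntegral.integral_congr fun y _ => ?_
  simp only [rayPoly_sub, Polynomial.eval_sub]
  ring

lemma tendsto_eval_div_pow_natDegree (Q : Polynomial ℂ) :
    Tendsto (fun y : ℝ => Q.eval (y : ℂ) / (y : ℂ) ^ Q.natDegree) atTop (𝓝 Q.leadingCoeff) := by
  set n := Q.natDegree with hn
  have hterm : ∀ i ∈ Finset.range n, Tendsto (fun y : ℝ => Q.coeff i * ((y : ℂ) ^ (n - i))⁻¹) atTop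
      (𝓝 0) := by
    intro i hi
    have hi' : n - i ≠ 0 := by have := Finset.mem_range.mp hi; omega
    have h1 : Tendsto (fun y : ℝ => (((y ^ (n - i))⁻¹ : ℝ) : ℂ)) atTop (𝓝 0) :=
      (Complex.continuous_ofReal.tendsto' 0 0 Complex.ofReal_zero).comp
        (tendsto_inv_atTop_zero.comp (tendsto_pow_atTop hi'))
    have h2 := h1.const_mul (Q.coeff i)
    rw [mul_zero] at h2
    refine h2.congr fun y => ?_
    push_cast
    rfl
  have h := (tendsto_finsetSum _ hterm).add_const (Q.leadingCoeff)
  rw [Finset.sum_const_zero, zero_add] at h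
  refine h.congr' ?_
  filter_upwards [eventually_gt_atTop 0] with y hy
  have hy' : (y : ℂ) ≠ 0 := by exact_mod_cast hy.ne'
  rw [Polynomial.eval_eq_sum_range, Finset.sum_range_succ, add_div, Finset.sum_div, ← hn,
    mul_div_assoc, div_self (pow_ne_zero n hy'), mul_one, Polynomial.leadingCoeff]
  congr 1
  refine Finset.sum_congr rfl fun i hi => ?_
  have hi' : i ≤ n := (Finset.mem_range.mp hi).le
  rw [mul_div_assoc, ← pow_sub_mul_pow (y : ℂ) hi', div_mul_cancel_right₀ (pow_ne_zero i hy')]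

lemma rootOuter_le_pow (hc : 0 ≤ c) (hab : a ^ 2 ≤ c ^ 2) (hbc : b ^ 2 ≤ c ^ 2) {y : ℝ}
    (hy : c ≤ y) : rootOuter a b c y ≤ y ^ 3 := by
  have hcy : c ^ 2 ≤ y ^ 2 := by nlinarith
  unfold rootOuter
  apply Real.sqrt_le_iff.mpr
  refine ⟨pow_nonneg (hc.trans hy) 3, ?_⟩
  calc (y ^ 2 - a ^ 2) * (y ^ 2 - b ^ 2) * (y ^ 2 - c ^ 2) ≤ y ^ 2 * y ^ 2 * y ^ 2 := by
        have h1 : 0 ≤ y ^ 2 - a ^ 2 := by linarith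
        have h2 : 0 ≤ y ^ 2 - b ^ 2 := by linarith
        have h3 : 0 ≤ y ^ 2 - c ^ 2 := by linarith
        gcongr <;> linarith [sq_nonneg a, sq_nonneg b, sq_nonneg c]
    _ = (y ^ 3) ^ 2 := by ring

/-- From degree 2 on, P dλ/w has at least a simple pole at infinity, so its integral grows at least
logarithmically. -/
lemma natDegree_le_one_of_bounded (ha : 0 ≤ a) (hab : a < b) (hbc : b < c) {Q : Polynomial ℂ}
    (h : (fun Y : ℝ => ∫ y in c..Y, Q.eval (y : ℂ) * ((1 / rootOuter a b c y : ℝ) : ℂ))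
      =O[atTop] fun _ => (1 : ℝ)) : Q.natDegree ≤ 1 := by
  by_contra hcon
  push Not at hcon
  have hc : 0 < c := by linarith
  have hq : Q.leadingCoeff ≠ 0 := by
    intro h0
    rw [Polynomial.leadingCoeff_eq_zero] at h0
    rw [h0, Polynomial.natDegree_zero] at hcon
    omega
  set q := Q.leadingCoeff with hqdef
  set n := Q.natDegree with hn
  set G : ℝ → ℂ := fun y => q⁻¹ * (Q.eval (y : ℂ) * ((1 / rootOuter a b c y : ℝ) : ℂ)) with hG
  have hGi : ∀ Y, c ≤ Y → IntervalIntegrable G volume c Y := fun Y hY =>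
    (intervalIntegrable_eval_mul (intervalIntegrable_one_div_rootOuter ha hab hbc hY)
      (continuous_eval_ofReal Q)).const_mul _
  have hre : Tendsto (fun y : ℝ => (q⁻¹ * (Q.eval (y : ℂ) / (y : ℂ) ^ n)).re) atTop (𝓝 1) := by
    have := (Complex.continuous_re.tendsto _).comp
      ((tendsto_eval_div_pow_natDegree Q).const_mul q⁻¹)
    rwa [inv_mul_cancel₀ hq, Complex.one_re] at this
  obtain ⟨C, hC⟩ := h.bound
  obtain ⟨y₀, hy₀⟩ := eventually_atTop.mp (((hre.eventually_const_lt (show (1 / 2 : ℝ) < 1 by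
    norm_num)).and (eventually_gt_atTop c)).and ((eventually_ge_atTop 1).and hC))
  -- After division by the leading coefficient the integrand has real part at least half of yⁿ / R,
  -- and R ≤ y³ ≤ yⁿ⁺¹ for n ≥ 2 and y ≥ 1.
  have hlow : ∀ y, y₀ ≤ y → 1 / 2 * (1 / y) ≤ (G y).re := by
    intro y hy
    obtain ⟨⟨h1, h2⟩, h3, -⟩ := hy₀ y hy
    have hy0 : 0 < y := by linarith
    have hy' : (y : ℂ) ≠ 0 := by exact_mod_cast hy0.ne'
    have hR := rootOuter_pos ha hab hbc h2
    have e : G y = ((y ^ n / rootOuter a b c y : ℝ) : ℂ) * (q⁻¹ * (Q.eval (y : ℂ) / (y : ℂ) ^ n)) := by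
      simp only [hG]
      push_cast
      field_simp
    rw [e, Complex.re_ofReal_mul]
    have h4 : 1 / y ≤ y ^ n / rootOuter a b c y := by
      rw [div_le_div_iff₀ hy0 hR, one_mul]
      calc rootOuter a b c y ≤ y ^ 3 := rootOuter_le_pow hc.le (by nlinarith) (by nlinarith) h2.le
        _ ≤ y ^ (n + 1) := pow_le_pow_right₀ h3 (by omega)
        _ = y ^ n * y := pow_succ _ _
    have h5 : 0 < 1 / y := by positivity
    nlinarith
  have hy₀c : c < y₀ := (hy₀ y₀ le_rfl).1.2
  have hy₀0 : 0 < y₀ := hc.trans hy₀c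
  have hnorm : ∀ Y, y₀ ≤ Y → (∫ y in c..Y, G y).re ≤ ‖q⁻¹‖ * C ∧
      -(‖q⁻¹‖ * C) ≤ (∫ y in c..Y, G y).re := by
    intro Y hY
    have h1 : ‖∫ y in c..Y, G y‖ ≤ ‖q⁻¹‖ * C := by
      rw [hG, intervalIntegral.integral_const_mul, norm_mul]
      have := (hy₀ Y hY).2.2
      rw [norm_one, mul_one] at this
      gcongr
    have := abs_le.mp ((Complex.abs_re_le_norm _).trans h1)
    exact ⟨this.2, this.1⟩
  have hgrow : ∀ Y, y₀ ≤ Y → 1 / 2 * Real.log (Y / y₀) ≤ 2 * (‖q⁻¹‖ * C) := by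
    intro Y hY
    have hiY : IntervalIntegrable G volume y₀ Y :=
      (hGi y₀ hy₀c.le).symm.trans (hGi Y (hy₀c.le.trans hY))
    have h1 : ∫ y in y₀..Y, 1 / 2 * (1 / y) ≤ ∫ y in y₀..Y, (G y).re := by
      refine intervalIntegral.integral_mono_on hY ?_ ?_ fun y hy => hlow y hy.1
      · refine ContinuousOn.intervalIntegrable ?_
        refine continuousOn_const.mul (continuousOn_const.div continuousOn_id fun y hy => ?_)
        rw [uIcc_of_le hY] at hy
        exact (hy₀0.trans_le hy.1).ne'
      · exact ⟨hiY.1.re, hiY.2.re⟩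
    rw [intervalIntegral.integral_const_mul, integral_one_div_of_pos hy₀0 (hy₀0.trans_le hY)] at h1
    have h2 : ∫ y in y₀..Y, (G y).re = (∫ y in y₀..Y, G y).re :=
      Complex.reCLM.intervalIntegral_comp_comm hiY
    have h3 := intervalIntegral.integral_add_adjacent_intervals (hGi y₀ hy₀c.le) hiY
    have h4 := congrArg Complex.re h3
    rw [Complex.add_re] at h4
    have h5 := hnorm Y hY
    have h6 := hnorm y₀ le_rfl
    linarith [h5.1, h6.2]
  have hlog : Tendsto (fun Y : ℝ => 1 / 2 * Real.log (Y / y₀)) atTop atTop :=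
    (Real.tendsto_log_atTop.comp (tendsto_id.atTop_div_const hy₀0)).const_mul_atTop (by norm_num)
  obtain ⟨Y, hY1, hY2⟩ := ((hlog.eventually_gt_atTop (2 * (‖q⁻¹‖ * C))).and
    (eventually_ge_atTop y₀)).exists
  exact absurd (hgrow Y hY2) (not_le.mpr hY1)

lemma integral_one_div_rootInner_pos (ha : 0 < a) (hab : a < b) (hbc : b < c) :
    0 < ∫ y in (-a)..a, 1 / rootInner a b c y := by
  refine intervalIntegral.intervalIntegral_pos_of_pos_on
    (intervalIntegrable_one_div_rootInner ha hab hbc) (fun y hy => ?_) (by linarith)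
  have h1 : y ^ 2 < a ^ 2 := sq_lt_sq' hy.1 hy.2
  have h2 : 0 < a ^ 2 - y ^ 2 := by linarith
  have h3 : 0 < b ^ 2 - y ^ 2 := by nlinarith
  have h4 : 0 < c ^ 2 - y ^ 2 := by nlinarith
  unfold rootInner
  positivity

lemma integral_div_rootGap_pos (ha : 0 < a) (hab : a < b) (hbc : b < c) :
    0 < ∫ y in a..b, y * (1 / rootGap a b c y) := by
  refine intervalIntegral.intervalIntegral_pos_of_pos_on
    ((intervalIntegrable_one_div_rootGap ha hab hbc).continuousOn_mul continuousOn_id)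
    (fun y hy => ?_) hab
  have h0 : 0 < y := ha.trans hy.1
  have h2 : 0 < y ^ 2 - a ^ 2 := by nlinarith [hy.1]
  have h3 : 0 < b ^ 2 - y ^ 2 := by nlinarith [hy.2]
  have h4 : 0 < c ^ 2 - y ^ 2 := by nlinarith [hy.2]
  unfold rootGap
  positivity

lemma integral_symm_eq (w : ℝ → ℝ) (hw : ∀ y, w (-y) = w y) (p : ℝ) (g : ℝ → ℂ) :
    ∫ y in (-p)..p, g (-y) * ((w y : ℝ) : ℂ) = ∫ y in (-p)..p, g y * ((w y : ℝ) : ℂ) := by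
  have h := intervalIntegral.integral_comp_neg (a := -p) (b := p)
    (fun y => g y * ((w y : ℝ) : ℂ))
  simp only [hw, neg_neg] at h
  exact h

lemma rootInner_neg (y : ℝ) : rootInner a b c (-y) = rootInner a b c y := by
  simp [rootInner]

/-- A holomorphic differential with vanishing `a`-periods is zero. -/
lemma eq_zero_of_periods (ha : 0 < a) (hab : a < b) (hbc : b < c) {lam0 : ℝ} {P : Polynomial ℂ}
    (hdeg : (rayPoly lam0 P).natDegree ≤ 1) (h1 : periodA1 a b c lam0 P = 0)
    (h2 : periodA2 a b c lam0 P = 0) : rayPoly lam0 P = 0 := by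
  obtain ⟨q₁, q₀, hQ⟩ := Polynomial.exists_eq_X_add_C_of_natDegree_le_one hdeg
  rw [periodA1_eq, hQ] at h1
  rw [periodA2_eq, hQ] at h2
  have hI1 := intervalIntegrable_one_div_rootInner ha hab hbc
  -- Averaging over y ↦ -y keeps only the constant coefficient, multiplied by a positive integral.
  have hq₀ : q₀ = 0 := by
    have hs := integral_symm_eq (fun y => 1 / rootInner a b c y)
      (fun y => by simp only [rootInner_neg]) a
      (fun y => (Polynomial.C q₁ * Polynomial.X + Polynomial.C q₀).eval (y : ℂ))
    rw [h1] at hs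
    have hsum := congrArg₂ (· + ·) h1 hs
    simp only [add_zero] at hsum
    have i1 := intervalIntegrable_eval_mul hI1
      (continuous_eval_ofReal (Polynomial.C q₁ * Polynomial.X + Polynomial.C q₀))
    have i2 : IntervalIntegrable (fun y : ℝ => (Polynomial.C q₁ * Polynomial.X +
        Polynomial.C q₀).eval ((-y : ℝ) : ℂ) * ((1 / rootInner a b c y : ℝ) : ℂ)) volume (-a) a :=
      intervalIntegrable_eval_mul hI1 ((continuous_eval_ofReal _).comp continuous_neg)
    rw [← intervalIntegral.integral_add i1 i2] at hsum
    have e : ∫ y in (-a)..a, ((Polynomial.C q₁ * Polynomial.X + Polynomial.C q₀).eval (y : ℂ) *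
        ((1 / rootInner a b c y : ℝ) : ℂ) +
        (Polynomial.C q₁ * Polynomial.X + Polynomial.C q₀).eval ((-y : ℝ) : ℂ) *
        ((1 / rootInner a b c y : ℝ) : ℂ)) =
        ∫ y in (-a)..a, 2 * q₀ * ((1 / rootInner a b c y : ℝ) : ℂ) := by
      refine intervalIntegral.integral_congr fun y _ => ?_
      simp only [Polynomial.eval_add, Polynomial.eval_mul, Polynomial.eval_C, Polynomial.eval_X]
      push_cast
      ring
    rw [e, intervalIntegral.integral_const_mul, intervalIntegral.integral_ofReal] at hsum
    have hpos := (integral_one_div_rootInner_pos ha hab hbc).ne'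
    have : (((∫ y in (-a)..a, 1 / rootInner a b c y) : ℝ) : ℂ) ≠ 0 := by exact_mod_cast hpos
    simpa using (mul_eq_zero.mp hsum).resolve_right this
  -- The a₂-period takes the odd part in y, so it isolates the linear coefficient.
  have hq₁ : q₁ = 0 := by
    have e : ∫ y in a..b, ((Polynomial.C q₁ * Polynomial.X + Polynomial.C q₀).eval (y : ℂ) -
        (Polynomial.C q₁ * Polynomial.X + Polynomial.C q₀).eval (-(y : ℂ))) *
        ((1 / rootGap a b c y : ℝ) : ℂ) =
        ∫ y in a..b, 2 * q₁ * ((y * (1 / rootGap a b c y) : ℝ) : ℂ) := by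
      refine intervalIntegral.integral_congr fun y _ => ?_
      simp only [Polynomial.eval_add, Polynomial.eval_mul, Polynomial.eval_C, Polynomial.eval_X]
      push_cast
      ring
    rw [e, intervalIntegral.integral_const_mul, intervalIntegral.integral_ofReal] at h2
    have hpos := (integral_div_rootGap_pos ha hab hbc).ne'
    have : (((∫ y in a..b, y * (1 / rootGap a b c y)) : ℝ) : ℂ) ≠ 0 := by exact_mod_cast hpos
    simpa using (mul_eq_zero.mp h2).resolve_right this
  rw [hQ, hq₀, hq₁]
  simp

/-- The principal parts cancel in the difference of two candidates, whose integral is then bounded: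
the difference is holomorphic, has zero a-periods, and vanishes. Only the difference of the
constants remains, and it is O(1/Y). -/
lemma IsAbelianConstant.unique (ha : 0 < a) (hab : a < b) (hbc : b < c) {lam0 : ℝ} {f : ℂ → ℂ}
    {K K' : ℂ} (h : IsAbelianConstant a b c lam0 f K) (h' : IsAbelianConstant a b c lam0 f K') :
    K = K' := by
  obtain ⟨P, p1, p2, hP⟩ := h
  obtain ⟨P', p1', p2', hP'⟩ := h'
  have hdiff : (fun Y : ℝ => abelianIntegral a b c lam0 (P - P') Y + Complex.I * (K - K'))
      =O[atTop] fun Y : ℝ => Y⁻¹ := by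
    refine (hP.sub hP').congr' ?_ EventuallyEq.rfl
    filter_upwards [eventually_ge_atTop c] with Y hY
    rw [abelianIntegral_sub ha hab hbc _ _ _ hY]
    ring
  have hinv : (fun Y : ℝ => Y⁻¹) =O[atTop] fun _ => (1 : ℝ) := by
    rw [isBigO_one_iff]
    exact tendsto_inv_atTop_zero.norm.isBoundedUnder_le
  have hbdd : (fun Y : ℝ => ∫ y in c..Y, (rayPoly lam0 (P - P')).eval (y : ℂ) *
      ((1 / rootOuter a b c y : ℝ) : ℂ)) =O[atTop] fun _ => (1 : ℝ) := by
    have hconst : (fun _ : ℝ => Complex.I * (K - K')) =O[atTop] fun _ => (1 : ℝ) :=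
      isBigO_const_const _ one_ne_zero _
    refine (hconst.sub (hdiff.trans hinv)).congr_left fun Y => ?_
    rw [abelianIntegral_eq]
    ring
  have hzero := eq_zero_of_periods ha hab hbc
    (natDegree_le_one_of_bounded ha.le hab hbc hbdd)
    (by rw [periodA1_sub ha hab hbc, p1, p1', sub_zero])
    (by rw [periodA2_sub ha hab hbc, p2, p2', sub_zero])
  have hlim := hdiff.trans_tendsto tendsto_inv_atTop_zero
  have he : (fun Y : ℝ => abelianIntegral a b c lam0 (P - P') Y + Complex.I * (K - K')) =
      fun _ => Complex.I * (K - K') := by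
    funext Y
    rw [abelianIntegral_eq, hzero]
    simp
  rw [he] at hlim
  have := tendsto_nhds_unique tendsto_const_nhds hlim
  simpa [sub_eq_zero] using this

end Abelian

/-! ### Existence of the normalized Abelian integrals -/

section Existence

variable {a b c : ℝ}

lemma exists_odd_coefficient (ha : 0 < a) (hab : a < b) (hbc : b < c) :
    ∃ q : ℝ, ∫ y in a..b, (y ^ 3 + q * y) / rootGap a b c y = 0 := by
  have hI := intervalIntegrable_one_div_rootGap ha hab hbc
  have hpos := integral_div_rootGap_pos ha hab hbc
  set D := ∫ y in a..b, y * (1 / rootGap a b c y) with hD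
  set N := ∫ y in a..b, y ^ 3 * (1 / rootGap a b c y) with hN
  refine ⟨-N / D, ?_⟩
  have e : ∫ y in a..b, (y ^ 3 + -N / D * y) / rootGap a b c y =
      ∫ y in a..b, (y ^ 3 * (1 / rootGap a b c y) + -N / D * (y * (1 / rootGap a b c y))) :=
    intervalIntegral.integral_congr fun y _ => by ring
  rw [e, intervalIntegral.integral_add (hI.continuousOn_mul (by fun_prop))
    ((hI.continuousOn_mul (by fun_prop)).const_mul _), intervalIntegral.integral_const_mul, ← hD,
    ← hN]
  field_simp
  ring

/-- The coefficient is minus a weighted mean of 4y⁴ - 2s y² over [-a, a], hence O(a²). This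
smallness yields the limit of K₂. -/
lemma exists_even_coefficient (ha : 0 < a) (hab : a < b) (hbc : b < c) :
    ∃ q : ℝ, (∫ y in (-a)..a, (4 * y ^ 4 - 2 * (a ^ 2 + b ^ 2 + c ^ 2) * y ^ 2 + q) *
      (1 / rootInner a b c y) = 0) ∧ |q| ≤ 4 * a ^ 4 + 2 * (a ^ 2 + b ^ 2 + c ^ 2) * a ^ 2 := by
  have hI := intervalIntegrable_one_div_rootInner ha hab hbc
  have hpos := integral_one_div_rootInner_pos ha hab hbc
  set s := a ^ 2 + b ^ 2 + c ^ 2 with hs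
  set D := ∫ y in (-a)..a, 1 / rootInner a b c y with hD
  set N := ∫ y in (-a)..a, (4 * y ^ 4 - 2 * s * y ^ 2) * (1 / rootInner a b c y) with hN
  have hIN : IntervalIntegrable (fun y => (4 * y ^ 4 - 2 * s * y ^ 2) * (1 / rootInner a b c y))
    volume (-a) a := hI.continuousOn_mul (by fun_prop)
  refine ⟨-N / D, ?_, ?_⟩
  · have e : ∫ y in (-a)..a, (4 * y ^ 4 - 2 * s * y ^ 2 + -N / D) * (1 / rootInner a b c y) =
        ∫ y in (-a)..a, ((4 * y ^ 4 - 2 * s * y ^ 2) * (1 / rootInner a b c y) +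
          -N / D * (1 / rootInner a b c y)) :=
      intervalIntegral.integral_congr fun y _ => by ring
    rw [e, intervalIntegral.integral_add hIN (hI.const_mul _), intervalIntegral.integral_const_mul,
      ← hD, ← hN]
    field_simp
    ring
  · have hs0 : 0 ≤ s := by positivity
    have hb : |N| ≤ (4 * a ^ 4 + 2 * s * a ^ 2) * D := by
      rw [hD, ← intervalIntegral.integral_const_mul, ← Real.norm_eq_abs]
      refine intervalIntegral.norm_integral_le_of_norm_le (by linarith) ?_ (hI.const_mul _)
      refine Eventually.of_forall fun y hy => ?_
      have hy2 : y ^ 2 ≤ a ^ 2 := sq_le_sq' hy.1.le hy.2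
      have hR : 0 ≤ rootInner a b c y := Real.sqrt_nonneg _
      rw [norm_mul, Real.norm_of_nonneg (by positivity : 0 ≤ 1 / rootInner a b c y)]
      gcongr
      have hy4 : y ^ 4 ≤ a ^ 4 := by nlinarith [sq_nonneg y, sq_nonneg a]
      have h5 : s * y ^ 2 ≤ s * a ^ 2 := by gcongr
      have h6 : 0 ≤ s * y ^ 2 := by positivity
      have h7 : 0 ≤ y ^ 4 := by positivity
      rw [Real.norm_eq_abs, abs_le]
      constructor <;> nlinarith
    rw [abs_div, abs_neg, abs_of_pos hpos, div_le_iff₀ hpos]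
    exact hb

/-- The polynomial `y³ + q y`. -/
def oddPoly (q : ℝ) : Polynomial ℂ := Polynomial.X ^ 3 + Polynomial.C (q : ℂ) * Polynomial.X

/-- The polynomial `4 y⁴ - 2 s y² + q`. -/
def evenPoly (s q : ℝ) : Polynomial ℂ :=
  4 * Polynomial.X ^ 4 - Polynomial.C (2 * s : ℂ) * Polynomial.X ^ 2 + Polynomial.C (q : ℂ)

lemma eval_oddPoly (q y : ℝ) : (oddPoly q).eval (y : ℂ) = ((y ^ 3 + q * y : ℝ) : ℂ) := by
  simp [oddPoly]

lemma eval_evenPoly (s q y : ℝ) :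
    (evenPoly s q).eval (y : ℂ) = ((4 * y ^ 4 - 2 * s * y ^ 2 + q : ℝ) : ℂ) := by
  simp [evenPoly]

lemma eval_oddPoly_neg (q : ℝ) (y : ℂ) : (oddPoly q).eval (-y) = -(oddPoly q).eval y := by
  simp [oddPoly]
  ring

lemma eval_evenPoly_neg (s q : ℝ) (y : ℂ) : (evenPoly s q).eval (-y) = (evenPoly s q).eval y := by
  have h : (-y) ^ 4 = y ^ 4 := by ring
  simp [evenPoly, h]

/-- A differential given by an odd and an even real polynomial has vanishing `a`-periods if its
odd part is normalized on the gap and its even part on the inner segment. -/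
lemma isAbelianConstant_of_parts (ha : 0 < a) (hab : a < b) (hbc : b < c) {lam0 q₁ q₀ : ℝ}
    {f : ℂ → ℂ} {K α β : ℂ}
    (h1 : ∫ y in a..b, (y ^ 3 + q₁ * y) / rootGap a b c y = 0)
    (h0 : ∫ y in (-a)..a, (4 * y ^ 4 - 2 * (a ^ 2 + b ^ 2 + c ^ 2) * y ^ 2 + q₀) *
      (1 / rootInner a b c y) = 0)
    (hK : ∀ Y : ℝ, Complex.I * (f ((lam0 : ℂ) + Complex.I * Y) + K) = -(α * (Y : ℂ) + β *
      ((2 * Y ^ 2 - (a ^ 2 + b ^ 2 + c ^ 2) +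
        ∫ y in Ioi c, (q₀ - 2 * (a ^ 2 * b ^ 2 * c ^ 2) / y ^ 2) / rootOuter a b c y : ℝ) : ℂ))) :
    IsAbelianConstant a b c lam0 f K := by
  set s := a ^ 2 + b ^ 2 + c ^ 2 with hs
  -- The minus sign compensates that of `abelianIntegral_eq`.
  obtain ⟨P, hP⟩ := exists_rayPoly_eq lam0
    (-(Polynomial.C α * oddPoly q₁ + Polynomial.C β * evenPoly s q₀))
  have hev : ∀ y : ℂ, (rayPoly lam0 P).eval y =
      -(α * (oddPoly q₁).eval y + β * (evenPoly s q₀).eval y) := fun y => by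
    rw [hP]
    simp
  have hIi := intervalIntegrable_one_div_rootInner ha hab hbc
  have hIg := intervalIntegrable_one_div_rootGap ha hab hbc
  refine ⟨P, ?_, ?_, ?_⟩
  · rw [periodA1_eq]
    have hodd : ∫ y in (-a)..a, (oddPoly q₁).eval (y : ℂ) * ((1 / rootInner a b c y : ℝ) : ℂ)
        = 0 := by
      have h := integral_symm_eq (fun y => 1 / rootInner a b c y)
        (fun y => by simp only [rootInner_neg]) a (fun y => (oddPoly q₁).eval (y : ℂ))
      simp only [Complex.ofReal_neg, eval_oddPoly_neg, neg_mul, intervalIntegral.integral_neg] at h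
      exact self_eq_neg.mp h.symm
    have heven : ∫ y in (-a)..a, (evenPoly s q₀).eval (y : ℂ) *
        ((1 / rootInner a b c y : ℝ) : ℂ) = 0 := by
      simp only [eval_evenPoly, ← Complex.ofReal_mul]
      rw [intervalIntegral.integral_ofReal, h0, Complex.ofReal_zero]
    have e : ∫ y in (-a)..a, (rayPoly lam0 P).eval (y : ℂ) * ((1 / rootInner a b c y : ℝ) : ℂ) =
        ∫ y in (-a)..a, ((-α) * ((oddPoly q₁).eval (y : ℂ) * ((1 / rootInner a b c y : ℝ) : ℂ)) +
          (-β) * ((evenPoly s q₀).eval (y : ℂ) * ((1 / rootInner a b c y : ℝ) : ℂ))) :=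
      intervalIntegral.integral_congr fun y _ => by simp only [hev]; ring
    rw [e, intervalIntegral.integral_add
      ((intervalIntegrable_eval_mul hIi (continuous_eval_ofReal _)).const_mul _)
      ((intervalIntegrable_eval_mul hIi (continuous_eval_ofReal _)).const_mul _),
      intervalIntegral.integral_const_mul, intervalIntegral.integral_const_mul, hodd, heven]
    ring
  · rw [periodA2_eq]
    have e : ∫ y in a..b, ((rayPoly lam0 P).eval (y : ℂ) - (rayPoly lam0 P).eval (-(y : ℂ))) *
        ((1 / rootGap a b c y : ℝ) : ℂ) =
        ∫ y in a..b, (-2 * α) * (((y ^ 3 + q₁ * y) / rootGap a b c y : ℝ) : ℂ) := by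
      refine intervalIntegral.integral_congr fun y _ => ?_
      simp only [hev, eval_oddPoly_neg, eval_evenPoly_neg, eval_oddPoly]
      push_cast
      ring
    rw [e, intervalIntegral.integral_const_mul, intervalIntegral.integral_ofReal, h1]
    simp
  · have ho := (isBigO_integral_odd ha.le hab hbc h1)
    have he := (isBigO_integral_even ha.le hab hbc q₀)
    simp only [← hs] at he
    have ho' := (Complex.isBigO_ofReal_left.mpr ho).const_mul_left α
    have he' := (Complex.isBigO_ofReal_left.mpr he).const_mul_left β
    refine (ho'.add he').congr' ?_ EventuallyEq.rfl
    filter_upwards [eventually_ge_atTop c] with Y hY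
    have hIo := intervalIntegrable_one_div_rootOuter ha.le hab hbc hY
    have e : ∫ y in c..Y, (rayPoly lam0 P).eval (y : ℂ) * ((1 / rootOuter a b c y : ℝ) : ℂ) =
        ∫ y in c..Y, ((-α) * ((oddPoly q₁).eval (y : ℂ) * ((1 / rootOuter a b c y : ℝ) : ℂ)) +
          (-β) * ((evenPoly s q₀).eval (y : ℂ) * ((1 / rootOuter a b c y : ℝ) : ℂ))) :=
      intervalIntegral.integral_congr fun y _ => by simp only [hev]; ring
    rw [abelianIntegral_eq, e, intervalIntegral.integral_add
      ((intervalIntegrable_eval_mul hIo (continuous_eval_ofReal _)).const_mul _)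
      ((intervalIntegrable_eval_mul hIo (continuous_eval_ofReal _)).const_mul _),
      intervalIntegral.integral_const_mul, intervalIntegral.integral_const_mul, hK]
    simp only [eval_evenPoly, eval_oddPoly, ← Complex.ofReal_mul]
    rw [intervalIntegral.integral_ofReal, intervalIntegral.integral_ofReal]
    simp only [mul_one_div]
    push_cast
    ring

lemma isK1_neg (ha : 0 < a) (hab : a < b) (hbc : b < c) (lam0 : ℝ) :
    IsK1 a b c lam0 (-lam0) := by
  obtain ⟨q₁, h1⟩ := exists_odd_coefficient ha hab hbc
  obtain ⟨q₀, h0, -⟩ := exists_even_coefficient ha hab hbc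
  -- Since i(λ - lam0) = -Y on the ray, only the odd part occurs, and it has no constant term.
  refine isAbelianConstant_of_parts ha hab hbc (α := 1) (β := 0) h1 h0 fun Y => ?_
  linear_combination (Y : ℂ) * Complex.I_sq

lemma exists_isK2 (ha : 0 < a) (hab : a < b) (hbc : b < c) (lam0 : ℝ) :
    ∃ q : ℝ, |q| ≤ 4 * a ^ 4 + 2 * (a ^ 2 + b ^ 2 + c ^ 2) * a ^ 2 ∧
      IsK2 a b c lam0 ((a ^ 2 + b ^ 2 + c ^ 2 - 2 * lam0 ^ 2 -
        ∫ y in Ioi c, (q - 2 * (a ^ 2 * b ^ 2 * c ^ 2) / y ^ 2) / rootOuter a b c y : ℝ) : ℂ) := by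
  obtain ⟨q₁, h1⟩ := exists_odd_coefficient ha hab hbc
  obtain ⟨q₀, h0, hq⟩ := exists_even_coefficient ha hab hbc
  refine ⟨q₀, hq, ?_⟩
  -- Read off from i · 2(lam0 + iY)² = -4 lam0 Y - 2iY² + 2i lam0².
  refine isAbelianConstant_of_parts ha hab hbc (α := 4 * lam0) (β := Complex.I) h1 h0 fun Y => ?_
  push_cast
  linear_combination (2 * Complex.I * Y ^ 2 + 4 * lam0 * Y) * Complex.I_sq

lemma tendsto_of_isK2 (hb : 0 < b) (hbc : b < c) (lam0 : ℝ) {K : ℝ → ℂ}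
    (hK : ∀ a ∈ Ioo 0 b, IsK2 a b c lam0 (K a)) :
    Tendsto K (𝓝[>] 0) (𝓝 (b ^ 2 + c ^ 2 - 2 * lam0 ^ 2 : ℂ)) := by
  have hmem : Ioo 0 b ∈ 𝓝[>] (0 : ℝ) := Ioo_mem_nhdsGT hb
  choose! q hq hqK using fun (a : ℝ) (h : a ∈ Ioo 0 b) => exists_isK2 h.1 h.2 hbc lam0
  set J : ℝ → ℝ := fun a =>
    ∫ y in Ioi c, (q a - 2 * (a ^ 2 * b ^ 2 * c ^ 2) / y ^ 2) / rootOuter a b c y with hJ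
  set I₀ := ∫ y in Ioi c, arcsecDeriv c y
  have hJ0 : Tendsto J (𝓝[>] 0) (𝓝 0) := by
    have hc : 0 < c := hb.trans hbc
    have hbound : Tendsto (fun a : ℝ => ((4 * a ^ 4 + 2 * (a ^ 2 + b ^ 2 + c ^ 2) * a ^ 2) +
        2 * (a ^ 2 * b ^ 2)) * (c / (c ^ 2 - b ^ 2)) * I₀) (𝓝[>] 0) (𝓝 0) := by
      have hcont : Continuous fun a : ℝ => ((4 * a ^ 4 + 2 * (a ^ 2 + b ^ 2 + c ^ 2) * a ^ 2) +
        2 * (a ^ 2 * b ^ 2)) * (c / (c ^ 2 - b ^ 2)) * I₀ := by fun_prop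
      exact (hcont.tendsto' 0 0 (by simp)).mono_left nhdsWithin_le_nhds
    refine squeeze_zero_norm' ?_ hbound
    filter_upwards [hmem] with a ha
    refine (abs_integral_even_remainder_le ha.1.le ha.2 hbc (q a)).trans ?_
    have h1 : 0 < c ^ 2 - b ^ 2 := by nlinarith
    have h2 : 0 ≤ I₀ := setIntegral_nonneg measurableSet_Ioi fun y hy => arcsecDeriv_nonneg hc hy
    have := hq a ha
    gcongr
  have hlim : Tendsto (fun a : ℝ => ((a ^ 2 + b ^ 2 + c ^ 2 - 2 * lam0 ^ 2 - J a : ℝ) : ℂ)) (𝓝[>] 0)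
      (𝓝 ((b ^ 2 + c ^ 2 - 2 * lam0 ^ 2 : ℝ) : ℂ)) := by
    refine (Complex.continuous_ofReal.tendsto _).comp ?_
    have h1 : Tendsto (fun a : ℝ => a ^ 2 + b ^ 2 + c ^ 2 - 2 * lam0 ^ 2) (𝓝[>] 0)
        (𝓝 (b ^ 2 + c ^ 2 - 2 * lam0 ^ 2)) := by
      have hcont : Continuous fun a : ℝ => a ^ 2 + b ^ 2 + c ^ 2 - 2 * lam0 ^ 2 := by fun_prop
      exact (hcont.tendsto' 0 _ (by simp)).mono_left nhdsWithin_le_nhds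
    simpa using h1.sub hJ0
  push_cast at hlim
  refine hlim.congr' ?_
  filter_upwards [hmem] with a ha
  have := IsAbelianConstant.unique ha.1 ha.2 hbc (hqK a ha) (hK a ha)
  rw [← this]
  push_cast
  rfl

end Existence

/-! ### The elliptic integrals as `a → 0` -/

section Limits

variable {b c : ℝ}

/-- Dominated convergence on a fixed interval: the singular factor v(1 - v) does not move with a,
and g is bounded below by m. -/
lemma tendsto_integral_div_sqrt {n : ℝ → ℝ} (hn : Continuous n) (hn1 : ∀ v ∈ Ioo (0 : ℝ) 1, |n v| ≤ 1)
    {g : ℝ → ℝ → ℝ} {g₀ : ℝ → ℝ} {m : ℝ} (hm : 0 < m)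
    (hg : ∀ a, Continuous (g a)) (hgm : ∀ᶠ a in 𝓝[>] (0 : ℝ), ∀ v ∈ Ioo (0 : ℝ) 1, m ≤ g a v)
    (hlim : ∀ v ∈ Ioo (0 : ℝ) 1, Tendsto (fun a => g a v) (𝓝[>] 0) (𝓝 (g₀ v))) :
    Tendsto (fun a => ∫ v in (0 : ℝ)..1, n v / √(v * (1 - v) * g a v)) (𝓝[>] 0)
      (𝓝 (∫ v in (0 : ℝ)..1, n v / √(v * (1 - v) * g₀ v))) := by
  have hI : IntervalIntegrable (fun v : ℝ => 1 / √m * (1 / √(v * (1 - v)))) volume 0 1 := by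
    simpa using (intervalIntegrable_one_div_sqrt_mul (zero_lt_one (α := ℝ))).const_mul (1 / √m)
  -- Interval integrals run over `Ioc 0 1`, whose right endpoint has to be discarded.
  have hne : ∀ᵐ v : ℝ, v ≠ 1 := by simp [ae_iff, measure_singleton]
  refine intervalIntegral.tendsto_integral_filter_of_dominated_convergence
    (fun v => 1 / √m * (1 / √(v * (1 - v)))) ?_ ?_ hI ?_
  · refine Eventually.of_forall fun a => Measurable.aestronglyMeasurable ?_
    have := (hg a).measurable
    have := hn.measurable
    fun_prop
  · filter_upwards [hgm] with a ha
    filter_upwards [hne] with v hv hv'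
    rw [uIoc_of_le zero_le_one] at hv'
    have hv1 : v ∈ Ioo (0 : ℝ) 1 := ⟨hv'.1, lt_of_le_of_ne hv'.2 hv⟩
    have hp : 0 < v * (1 - v) := mul_pos hv1.1 (by linarith [hv1.2])
    rw [Real.norm_eq_abs, abs_div, abs_of_nonneg (Real.sqrt_nonneg _), Real.sqrt_mul hp.le,
      one_div_mul_one_div, mul_comm (√m)]
    have := Real.sqrt_pos.mpr hp
    have := Real.sqrt_pos.mpr hm
    exact div_le_div₀ zero_le_one (hn1 v hv1) (by positivity)
      (by gcongr; exact ha v hv1)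
  · filter_upwards [hne] with v hv hv'
    rw [uIoc_of_le zero_le_one] at hv'
    have hv1 : v ∈ Ioo (0 : ℝ) 1 := ⟨hv'.1, lt_of_le_of_ne hv'.2 hv⟩
    have hp : 0 < v * (1 - v) := mul_pos hv1.1 (by linarith [hv1.2])
    have hg0 : 0 < g₀ v :=
      hm.trans_le (ge_of_tendsto (hlim v hv1) (hgm.mono fun a ha => ha v hv1))
    refine Tendsto.div tendsto_const_nhds ((hlim v hv1).const_mul _).sqrt ?_
    exact (Real.sqrt_pos.mpr (mul_pos hp hg0)).ne'

lemma tendsto_param_zero {f : ℝ → ℝ} (hf : Continuous f) : Tendsto f (𝓝[>] 0) (𝓝 (f 0)) :=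
  hf.continuousAt.tendsto.mono_left nhdsWithin_le_nhds

lemma eventually_mem_Ioo_param (hb : 0 < b) : ∀ᶠ a in 𝓝[>] (0 : ℝ), a ∈ Ioo 0 b :=
  Ioo_mem_nhdsGT hb

/-- The affine substitution `t = p + m v` turns an elliptic integral into one over `[0, 1]`. -/
lemma integral_div_sqrt_affine {p q m : ℝ} (hm : 0 < m) (hpq : p + m = q) {n : ℝ → ℝ}
    {r g : ℝ → ℝ} (h : ∀ v, r (m * v + p) = m ^ 2 * (v * (1 - v) * g v)) :
    ∫ t in p..q, n t / √(r t) = ∫ v in (0 : ℝ)..1, n (m * v + p) / √(v * (1 - v) * g v) := by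
  have e := intervalIntegral.mul_integral_comp_mul_add (a := 0) (b := 1)
    (f := fun t => n t / √(r t)) m p
  rw [show m * 0 + p = p by ring, show m * 1 + p = q by linarith] at e
  rw [← e, ← intervalIntegral.integral_const_mul]
  refine intervalIntegral.integral_congr fun v _ => ?_
  rw [h, Real.sqrt_mul (by positivity), Real.sqrt_sq hm.le]
  field_simp

lemma Aplus_eq {a : ℝ} (ha : 0 ≤ a) (hab : a < b) : Aplus a b c =
    ∫ v in (0 : ℝ)..1, 1 / √(v * (1 - v) * (c ^ 2 - a ^ 2 - (b ^ 2 - a ^ 2) * v)) :=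
  integral_div_sqrt_affine (m := b ^ 2 - a ^ 2) (by nlinarith) (by ring) (n := fun _ => 1)
    fun v => by ring

lemma Bplus_eq {a : ℝ} (hb : 0 < b) (hbc : b < c) : Bplus a b c =
    ∫ v in (0 : ℝ)..1, 1 / √(v * (1 - v) * (b ^ 2 - a ^ 2 + (c ^ 2 - b ^ 2) * v)) :=
  integral_div_sqrt_affine (m := c ^ 2 - b ^ 2) (by nlinarith) (by ring) (n := fun _ => 1)
    fun v => by ring

lemma Aminus_eq {a : ℝ} (ha : 0 < a) : Aminus a b c =
    ∫ v in (0 : ℝ)..1, 1 / √(v * (1 - v) * ((b ^ 2 - a ^ 2 * v) * (c ^ 2 - a ^ 2 * v))) :=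
  integral_div_sqrt_affine (m := a ^ 2) (by positivity) (by ring) (n := fun _ => 1)
    fun v => by ring

/-- The factor t = a² v in the numerator makes D₋ of order a². -/
lemma Dminus_eq {a : ℝ} (ha : 0 < a) : Dminus a b c = a ^ 2 / 2 *
    ∫ v in (0 : ℝ)..1, v / √(v * (1 - v) * ((b ^ 2 - a ^ 2 * v) * (c ^ 2 - a ^ 2 * v))) := by
  have h := integral_div_sqrt_affine (p := 0) (q := a ^ 2) (m := a ^ 2) (by positivity) (by ring)
    (n := fun t => t) (r := fun t => t * (a ^ 2 - t) * (b ^ 2 - t) * (c ^ 2 - t))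
    (g := fun v => (b ^ 2 - a ^ 2 * v) * (c ^ 2 - a ^ 2 * v)) fun v => by ring
  rw [Dminus, h, mul_comm (a ^ 2 / 2), ← intervalIntegral.integral_const_mul,
    ← intervalIntegral.integral_mul_const]
  refine intervalIntegral.integral_congr fun v _ => ?_
  ring

lemma tendsto_Aplus (hb : 0 < b) (hbc : b < c) :
    Tendsto (fun a => Aplus a b c) (𝓝[>] 0) (𝓝 (Aplus 0 b c)) := by
  have hcb : 0 < c ^ 2 - b ^ 2 := by nlinarith
  rw [Aplus_eq le_rfl hb]
  refine (tendsto_integral_div_sqrt continuous_const (by simp) hcb (fun a => by fun_prop) ?_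
    fun v hv => tendsto_param_zero
      (f := fun a => c ^ 2 - a ^ 2 - (b ^ 2 - a ^ 2) * v) (by fun_prop)).congr' ?_
  · filter_upwards [eventually_mem_Ioo_param hb] with a ha v hv
    have : 0 < b ^ 2 - a ^ 2 := by nlinarith [ha.1, ha.2]
    nlinarith [hv.2]
  · filter_upwards [eventually_mem_Ioo_param hb] with a ha
    rw [Aplus_eq ha.1.le ha.2]

lemma tendsto_Bplus (hb : 0 < b) (hbc : b < c) :
    Tendsto (fun a => Bplus a b c) (𝓝[>] 0) (𝓝 (Bplus 0 b c)) := by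
  have hcb : 0 < c ^ 2 - b ^ 2 := by nlinarith
  simp only [Bplus_eq hb hbc]
  refine tendsto_integral_div_sqrt continuous_const (by simp) (m := b ^ 2 / 2) (by positivity)
    (fun a => by fun_prop) ?_ fun v hv => tendsto_param_zero
      (f := fun a => b ^ 2 - a ^ 2 + (c ^ 2 - b ^ 2) * v) (by fun_prop)
  filter_upwards [eventually_mem_Ioo_param (half_pos hb)] with a ha v hv
  have := mul_pos hcb hv.1
  nlinarith [ha.1, ha.2]

lemma tendsto_frbPlus (hb : 0 < b) (hbc : b < c) (hA : 0 < Aplus 0 b c) :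
    Tendsto (fun a => frbPlus a b c) (𝓝[>] 0) (𝓝 (frbPlus 0 b c)) :=
  (tendsto_Bplus hb hbc).div (tendsto_Aplus hb hbc) hA.ne'

lemma eventually_inner_ge (hb : 0 < b) (hbc : b < c) : ∀ᶠ a in 𝓝[>] (0 : ℝ),
    ∀ v ∈ Ioo (0 : ℝ) 1, (b ^ 2 / 2) ^ 2 ≤ (b ^ 2 - a ^ 2 * v) * (c ^ 2 - a ^ 2 * v) := by
  filter_upwards [eventually_mem_Ioo_param (half_pos hb)] with a ha v hv
  have h1 : a ^ 2 ≤ b ^ 2 / 2 := by nlinarith [ha.1, ha.2]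
  have h2 : a ^ 2 * v ≤ b ^ 2 / 2 := by nlinarith [hv.1, hv.2, sq_nonneg a]
  have h3 : b ^ 2 < c ^ 2 := by nlinarith
  rw [sq]
  have h4 : 0 ≤ b ^ 2 / 2 := by positivity
  exact mul_le_mul (by linarith) (by linarith) h4 (by linarith)

/-- The integrand survives the collapse of [0, a²] after rescaling; positivity of the limit is all
that is used later. -/
lemma exists_tendsto_Aminus (hb : 0 < b) (hbc : b < c) :
    ∃ L, 0 < L ∧ Tendsto (fun a => Aminus a b c) (𝓝[>] 0) (𝓝 L) := by
  have hc : 0 < c := hb.trans hbc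
  refine ⟨∫ v in (0 : ℝ)..1, 1 / √(v * (1 - v) * (b ^ 2 * c ^ 2)), ?_, ?_⟩
  · have e : ∀ v : ℝ, 1 / √(v * (1 - v) * (b ^ 2 * c ^ 2)) =
        1 / (b * c) * (1 / √((v - 0) * (1 - v))) := fun v => by
      rw [mul_comm (v * _), ← mul_pow, Real.sqrt_mul (by positivity), Real.sqrt_sq (by positivity),
        sub_zero, one_div_mul_one_div]
    simp only [e]
    refine intervalIntegral.intervalIntegral_pos_of_pos_on
      ((intervalIntegrable_one_div_sqrt_mul zero_lt_one).const_mul _) (fun v hv => ?_) zero_lt_one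
    have : 0 < (v - 0) * (1 - v) := mul_pos (by linarith [hv.1]) (by linarith [hv.2])
    positivity
  · refine (tendsto_integral_div_sqrt continuous_const (by simp) (m := (b ^ 2 / 2) ^ 2)
      (by positivity) (fun a => by fun_prop) (eventually_inner_ge hb hbc)
      fun v hv => ?_).congr' ?_
    · have h := tendsto_param_zero
        (f := fun a => (b ^ 2 - a ^ 2 * v) * (c ^ 2 - a ^ 2 * v)) (by fun_prop)
      rwa [show (b ^ 2 - 0 ^ 2 * v) * (c ^ 2 - 0 ^ 2 * v) = b ^ 2 * c ^ 2 by ring] at h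
    · filter_upwards [self_mem_nhdsWithin] with a ha
      rw [Aminus_eq ha]

lemma tendsto_Dminus (hb : 0 < b) (hbc : b < c) :
    Tendsto (fun a => Dminus a b c) (𝓝[>] 0) (𝓝 0) := by
  have h := tendsto_integral_div_sqrt (n := fun v => v) continuous_id
    (fun v hv => by rw [abs_of_pos hv.1]; exact hv.2.le) (m := (b ^ 2 / 2) ^ 2)
    (by positivity) (fun a => by fun_prop) (eventually_inner_ge hb hbc)
    fun v hv => tendsto_param_zero
        (f := fun a => (b ^ 2 - a ^ 2 * v) * (c ^ 2 - a ^ 2 * v)) (by fun_prop)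
  have h2 := (tendsto_param_zero (f := fun a => a ^ 2 / 2) (by fun_prop)).mul h
  rw [show ((0 : ℝ) ^ 2 / 2) = 0 by norm_num, zero_mul] at h2
  refine h2.congr' ?_
  filter_upwards [self_mem_nhdsWithin] with a ha
  rw [Dminus_eq ha]

/-- On the gap the radicand is at most (bct)², so the integrand is at least 1/(bct). The divergence
reflects the double point created when ±ia merge. -/
lemma log_div_le_Bminus {a : ℝ} (ha : 0 < a) (hab : a < b) (hbc : b < c) :
    2 * Real.log (b / a) / (b * c) ≤ Bminus a b c := by
  have hb : 0 < b := ha.trans hab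
  have hc : 0 < c := hb.trans hbc
  have h2 : a ^ 2 < b ^ 2 := by nlinarith
  have h3 : b ^ 2 < c ^ 2 := by nlinarith
  have hI : IntervalIntegrable
      (fun t => 1 / √(t * (t - a ^ 2) * (b ^ 2 - t) * (c ^ 2 - t))) volume (a ^ 2) (b ^ 2) := by
    have hcont : ContinuousOn (fun t => 1 / √(t * (c ^ 2 - t))) (uIcc (a ^ 2) (b ^ 2)) := by
      rw [uIcc_of_le h2.le]
      refine continuousOn_const.div (Continuous.continuousOn (by fun_prop)) fun t ht => ?_
      have : 0 < t := lt_of_lt_of_le (by positivity) ht.1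
      exact (Real.sqrt_pos.mpr (mul_pos this (by linarith [ht.2]))).ne'
    refine ((intervalIntegrable_one_div_sqrt_mul h2).mul_continuousOn hcont).congr ?_
    intro t ht
    rw [uIoc_of_le h2.le] at ht
    simp only
    rw [one_div_mul_one_div, ← Real.sqrt_mul
      (mul_nonneg (by linarith [ht.1]) (by linarith [ht.2]))]
    congr 2
    ring
  have e : 2 * Real.log (b / a) / (b * c) = ∫ t in (a ^ 2)..(b ^ 2), 1 / (b * c) * (1 / t) := by
    rw [intervalIntegral.integral_const_mul, integral_one_div_of_pos (by positivity)
      (by positivity), ← div_pow, Real.log_pow]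
    push_cast
    ring
  rw [e, Bminus]
  have hI2 : IntervalIntegrable (fun t : ℝ => 1 / (b * c) * (1 / t)) volume (a ^ 2) (b ^ 2) := by
    refine ContinuousOn.intervalIntegrable ?_
    rw [uIcc_of_le h2.le]
    refine continuousOn_const.mul (continuousOn_const.div continuousOn_id fun t ht => ?_)
    exact (lt_of_lt_of_le (by positivity) ht.1).ne'
  refine intervalIntegral.integral_mono_on_of_le_Ioo h2.le hI2 hI fun t ht => ?_
  have ht0 : 0 < t := lt_trans (by positivity) ht.1
  have p1 : 0 < t - a ^ 2 := by linarith [ht.1]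
  have p2 : 0 < b ^ 2 - t := by linarith [ht.2]
  have p3 : 0 < c ^ 2 - t := by linarith [ht.2]
  rw [one_div_mul_one_div]
  refine one_div_le_one_div_of_le (by positivity) (Real.sqrt_le_iff.mpr ⟨by positivity, ?_⟩)
  calc t * (t - a ^ 2) * (b ^ 2 - t) * (c ^ 2 - t) ≤ t * t * b ^ 2 * c ^ 2 := by
        gcongr <;> nlinarith
    _ = (b * c * t) ^ 2 := by ring

lemma tendsto_Bminus (hb : 0 < b) (hbc : b < c) :
    Tendsto (fun a => Bminus a b c) (𝓝[>] 0) atTop := by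
  have hc : 0 < c := hb.trans hbc
  have h : Tendsto (fun a : ℝ => 2 * Real.log (b / a) / (b * c)) (𝓝[>] 0) atTop := by
    refine Tendsto.atTop_div_const (by positivity) (Tendsto.const_mul_atTop two_pos ?_)
    refine Real.tendsto_log_atTop.comp ?_
    exact (tendsto_inv_nhdsGT_zero.const_mul_atTop hb).congr fun a => (div_eq_mul_inv _ _).symm
  refine tendsto_atTop_mono' _ ?_ h
  filter_upwards [eventually_mem_Ioo_param hb] with a ha
  exact log_div_le_Bminus ha.1 ha.2 hbc

lemma tendsto_frbMinus (hb : 0 < b) (hbc : b < c) :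
    Tendsto (fun a => frbMinus a b c) (𝓝[>] 0) atTop := by
  obtain ⟨L, hL, hA⟩ := exists_tendsto_Aminus hb hbc
  simpa only [frbMinus, div_eq_mul_inv] using
    (tendsto_Bminus hb hbc).atTop_mul_pos (inv_pos.mpr hL) (hA.inv₀ hL.ne')

/-! ### The integrals over the ray -/

/-- The integrand `1 / (t √(t - c²))` dominates those of `Bminus1` and `Fminus`. -/
lemma integrableOn_one_div_mul_sqrt_sub (hc : 0 < c) :
    IntegrableOn (fun t => 1 / (t * √(t - c ^ 2))) (Ioi (c ^ 2)) := by
  have hlim : Tendsto (fun t : ℝ => 2 / c * Real.arctan (√(t - c ^ 2) / c)) atTop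
      (𝓝 (2 / c * (Real.pi / 2))) := by
    have h1 : Tendsto (fun t : ℝ => √(t - c ^ 2) / c) atTop atTop :=
      (Real.tendsto_sqrt_atTop.comp
        (tendsto_atTop_add_const_right _ _ tendsto_id)).atTop_div_const hc
    exact ((Real.tendsto_arctan_atTop.mono_right nhdsWithin_le_nhds).comp h1).const_mul _
  refine integrableOn_Ioi_deriv_of_nonneg (Continuous.continuousWithinAt (by fun_prop)) ?_
    (fun t ht => ?_) hlim
  · intro t ht
    have hpos : 0 < t - c ^ 2 := sub_pos.mpr ht
    have ht0 : 0 < t := lt_trans (by positivity) (mem_Ioi.mp ht)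
    have hs := ((hasDerivAt_id t).sub_const (c ^ 2)).sqrt hpos.ne'
    refine (((hs.div_const c).arctan).const_mul (2 / c)).congr_deriv ?_
    have hp := Real.sqrt_pos.mpr hpos
    simp only [id]
    rw [div_pow, Real.sq_sqrt hpos.le,
      show 1 + (t - c ^ 2) / c ^ 2 = t / c ^ 2 by field_simp; ring]
    field_simp
  · have ht0 : 0 < t := lt_trans (by positivity) (mem_Ioi.mp ht)
    positivity

lemma sqrt_outer_ge {a t : ℝ} (ha : 0 < a) (hab : a < b) (hbc : b < c) (ht : c ^ 2 < t) :
    √t * (t - b ^ 2) * √(t - c ^ 2) ≤ √(t * (t - a ^ 2) * (t - b ^ 2) * (t - c ^ 2)) := by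
  have h1 : a ^ 2 < b ^ 2 := by nlinarith
  have h2 : b ^ 2 < c ^ 2 := by nlinarith
  have ht0 : 0 < t := lt_trans (by nlinarith) ht
  have p2 : 0 < t - b ^ 2 := by linarith
  have p3 : 0 < t - c ^ 2 := by linarith
  have p1 : 0 < t - a ^ 2 := by linarith
  apply Real.le_sqrt_of_sq_le
  rw [mul_pow, mul_pow, Real.sq_sqrt ht0.le, Real.sq_sqrt p3.le]
  have : t * (t - b ^ 2) ^ 2 ≤ t * (t - a ^ 2) * (t - b ^ 2) := by
    rw [sq, ← mul_assoc]
    gcongr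
  gcongr

lemma one_div_outer_le {t : ℝ} (hb : 0 < b) (hbc : b < c) (ht : c ^ 2 < t) :
    1 / (√t * (t - b ^ 2) * √(t - c ^ 2)) ≤ c / (c ^ 2 - b ^ 2) * (1 / (t * √(t - c ^ 2))) := by
  have hc : 0 < c := hb.trans hbc
  have h2 : 0 < c ^ 2 - b ^ 2 := by nlinarith
  have ht0 : 0 < t := lt_trans (by positivity) ht
  have hs := Real.sqrt_pos.mpr (sub_pos.mpr ht)
  have h3 : c ≤ √t := Real.le_sqrt_of_sq_le ht.le
  have h4 : (c ^ 2 - b ^ 2) / c ^ 2 * t ≤ t - b ^ 2 := by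
    rw [div_mul_eq_mul_div, div_le_iff₀ (by positivity)]
    nlinarith [sq_nonneg b]
  calc 1 / (√t * (t - b ^ 2) * √(t - c ^ 2))
      ≤ 1 / (c * ((c ^ 2 - b ^ 2) / c ^ 2 * t) * √(t - c ^ 2)) := by gcongr
    _ = _ := by field_simp

lemma exists_Bminus1_bound (hb : 0 < b) (hbc : b < c) :
    ∃ M, ∀ a ∈ Ioo 0 b, |Bminus1 a b c| ≤ M := by
  have hc : 0 < c := hb.trans hbc
  refine ⟨∫ t in Ioi (c ^ 2), c / (c ^ 2 - b ^ 2) * (1 / (t * √(t - c ^ 2))), fun a ha => ?_⟩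
  rw [Bminus1, ← Real.norm_eq_abs]
  refine norm_integral_le_of_norm_le ((integrableOn_one_div_mul_sqrt_sub hc).const_mul _) ?_
  filter_upwards [ae_restrict_mem measurableSet_Ioi] with t ht
  rw [Real.norm_of_nonneg (by positivity)]
  have ht' : c ^ 2 < t := ht
  have h2 : b ^ 2 < c ^ 2 := by nlinarith
  have ht0 : 0 < t := lt_trans (by positivity) ht'
  have hs := Real.sqrt_pos.mpr (sub_pos.mpr ht')
  have hb2 : 0 < t - b ^ 2 := by linarith
  exact (one_div_le_one_div_of_le (by positivity) (sqrt_outer_ge ha.1 ha.2 hbc ht')).trans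
    (one_div_outer_le hb hbc ht')

/-- Only boundedness of δ is needed: it multiplies D₋ → 0 and otherwise enters as the imaginary part
of a theta argument. -/
lemma exists_delta_bound (hb : 0 < b) (hbc : b < c) :
    ∃ M, ∀ᶠ a in 𝓝[>] (0 : ℝ), |delta a b c| ≤ M := by
  obtain ⟨M, hM⟩ := exists_Bminus1_bound hb hbc
  obtain ⟨L, hL, hA⟩ := exists_tendsto_Aminus hb hbc
  refine ⟨M / (L / 2), ?_⟩
  filter_upwards [eventually_mem_Ioo_param hb, hA.eventually_const_lt (half_lt_self hL)]
    with a ha hA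
  have h := hM a ha
  have h0 := (abs_nonneg _).trans h
  rw [delta, abs_div, abs_of_pos ((half_pos hL).trans hA)]
  gcongr

/-- The integrand lies between 0 and its bound with a² replaced by b². There √t √(t - c²) ≥ t - c²
shows that the leading terms cancel, leaving at most (b² + c²)t in the numerator, uniformly in a. -/
lemma abs_Fminus_integrand_le {a t : ℝ} (ha : 0 < a) (hab : a < b) (hbc : b < c)
    (ht : c ^ 2 < t) : |t / √(t * (t - a ^ 2) * (t - b ^ 2) * (t - c ^ 2)) - 1 / t| ≤
      (b ^ 2 + c ^ 2) * (c / (c ^ 2 - b ^ 2) * (1 / (t * √(t - c ^ 2)))) := by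
  have hb : 0 < b := ha.trans hab
  have h1 : a ^ 2 < b ^ 2 := by nlinarith
  have h2 : b ^ 2 < c ^ 2 := by nlinarith
  have ht0 : 0 < t := lt_trans (by nlinarith) ht
  have p2 : 0 < t - b ^ 2 := by linarith
  have p3 : 0 < t - c ^ 2 := by linarith
  have p1 : 0 < t - a ^ 2 := by linarith
  have hs := Real.sqrt_pos.mpr p3
  have hst := Real.sqrt_pos.mpr ht0
  have hlow : 1 / t ≤ t / √(t * (t - a ^ 2) * (t - b ^ 2) * (t - c ^ 2)) := by
    rw [div_le_div_iff₀ ht0 (by positivity), one_mul]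
    refine Real.sqrt_le_iff.mpr ⟨by positivity, ?_⟩
    calc t * (t - a ^ 2) * (t - b ^ 2) * (t - c ^ 2) ≤ t * t * t * t := by
          gcongr <;> nlinarith
      _ = (t * t) ^ 2 := by ring
  rw [abs_of_nonneg (sub_nonneg.mpr hlow)]
  have hup : t / √(t * (t - a ^ 2) * (t - b ^ 2) * (t - c ^ 2)) ≤
      t / (√t * (t - b ^ 2) * √(t - c ^ 2)) :=
    div_le_div_of_nonneg_left ht0.le (by positivity) (sqrt_outer_ge ha hab hbc ht)
  have hdiff : t / (√t * (t - b ^ 2) * √(t - c ^ 2)) - 1 / t ≤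
      (b ^ 2 + c ^ 2) * (1 / (√t * (t - b ^ 2) * √(t - c ^ 2))) := by
    have e1 := Real.sq_sqrt ht0.le
    have e2 := Real.sq_sqrt p3.le
    have h3 : √(t - c ^ 2) ≤ √t := Real.sqrt_le_sqrt (by nlinarith)
    have key : t * t - √t * (t - b ^ 2) * √(t - c ^ 2) ≤ (b ^ 2 + c ^ 2) * t := by
      have h4 : t - c ^ 2 ≤ √t * √(t - c ^ 2) := by nlinarith
      nlinarith [mul_le_mul_of_nonneg_right h4 p2.le, mul_nonneg (sq_nonneg b) (sq_nonneg c)]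
    rw [mul_one_div, sub_le_iff_le_add, div_add_div _ _ (by positivity) ht0.ne',
      div_le_div_iff₀ (by positivity) (by positivity)]
    nlinarith [mul_le_mul_of_nonneg_right key (by positivity :
      0 ≤ √t * (t - b ^ 2) * √(t - c ^ 2))]
  calc _ ≤ t / (√t * (t - b ^ 2) * √(t - c ^ 2)) - 1 / t := by linarith
    _ ≤ _ := hdiff
    _ ≤ _ := by
      have := one_div_outer_le hb hbc ht
      gcongr

/-- At a = 0 one factor t leaves the root, and 2 log(√(t - b²) + √(t - c²)) - log t is an
antiderivative, with limit 2 log 2 at infinity. -/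
lemma integral_Fminus_zero (hb : 0 < b) (hbc : b < c)
    (hint : IntegrableOn (fun t => 1 / √((t - b ^ 2) * (t - c ^ 2)) - 1 / t) (Ioi (c ^ 2))) :
    ∫ t in Ioi (c ^ 2), (1 / √((t - b ^ 2) * (t - c ^ 2)) - 1 / t) =
      2 * Real.log (2 * c / √(c ^ 2 - b ^ 2)) := by
  have hc : 0 < c := hb.trans hbc
  have h2 : 0 < c ^ 2 - b ^ 2 := by nlinarith
  set f : ℝ → ℝ := fun t => 2 * Real.log (√(t - b ^ 2) + √(t - c ^ 2)) - Real.log t with hf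
  have hpos : ∀ t, c ^ 2 ≤ t → 0 < √(t - b ^ 2) + √(t - c ^ 2) := fun t ht =>
    add_pos_of_pos_of_nonneg (Real.sqrt_pos.mpr (by linarith)) (Real.sqrt_nonneg _)
  have hlim : Tendsto f atTop (𝓝 (2 * Real.log 2)) := by
    have h : ∀ d : ℝ, Tendsto (fun t : ℝ => √(1 - d * t⁻¹)) atTop (𝓝 1) := fun d => by
      simpa using ((tendsto_inv_atTop_zero.const_mul d).const_sub 1).sqrt
    have h3 := (((h (b ^ 2)).add (h (c ^ 2))).log (by norm_num)).const_mul 2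
    norm_num at h3
    refine h3.congr' ?_
    filter_upwards [eventually_gt_atTop (c ^ 2)] with t ht
    have ht0 : 0 < t := lt_trans (by positivity) ht
    have e : ∀ d : ℝ, √(1 - d * t⁻¹) = √(t - d) / √t := fun d => by
      rw [← Real.sqrt_div' _ ht0.le]
      congr 1
      field_simp
    rw [e, e, ← add_div, Real.log_div (hpos t ht.le).ne' (Real.sqrt_pos.mpr ht0).ne',
      Real.log_sqrt ht0.le]
    simp only [hf]
    ring
  have hcont : ContinuousWithinAt f (Ici (c ^ 2)) (c ^ 2) := by
    have h1 : ContinuousAt (fun t => √(t - b ^ 2) + √(t - c ^ 2)) (c ^ 2) :=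
      Continuous.continuousAt (by fun_prop)
    exact (((h1.log (hpos _ le_rfl).ne').const_mul 2).sub
      (Real.continuousAt_log (pow_ne_zero 2 hc.ne'))).continuousWithinAt
  have hd : ∀ t ∈ Ioi (c ^ 2), HasDerivAt f (1 / √((t - b ^ 2) * (t - c ^ 2)) - 1 / t) t := by
    intro t ht
    have ht' : c ^ 2 < t := ht
    have ht0 : 0 < t := lt_trans (by positivity) ht'
    have p2 : 0 < t - b ^ 2 := by linarith
    have p3 : 0 < t - c ^ 2 := by linarith
    have d2 := ((hasDerivAt_id t).sub_const (b ^ 2)).sqrt p2.ne'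
    have d3 := ((hasDerivAt_id t).sub_const (c ^ 2)).sqrt p3.ne'
    refine ((((d2.add d3).log (hpos t ht'.le).ne').const_mul 2).sub
      (Real.hasDerivAt_log ht0.ne')).congr_deriv ?_
    have s2 := Real.sqrt_pos.mpr p2
    have s3 := Real.sqrt_pos.mpr p3
    rw [Real.sqrt_mul p2.le]
    simp only [id, Pi.add_apply]
    field_simp
    ring
  rw [integral_Ioi_of_hasDerivAt_of_tendsto hcont hd hint hlim]
  simp only [hf, sub_self, Real.sqrt_zero, add_zero]
  rw [Real.log_div (by positivity) (by positivity), Real.log_mul two_ne_zero hc.ne', Real.log_pow]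
  push_cast
  ring

lemma tendsto_Fminus (hb : 0 < b) (hbc : b < c) :
    Tendsto (fun a => Fminus a b c) (𝓝[>] 0) (𝓝 (Real.log (2 * c / √(c ^ 2 - b ^ 2)))) := by
  have hc : 0 < c := hb.trans hbc
  have h2 : b ^ 2 < c ^ 2 := by nlinarith
  have hbd : IntegrableOn (fun t => (b ^ 2 + c ^ 2) * (c / (c ^ 2 - b ^ 2) *
      (1 / (t * √(t - c ^ 2))))) (Ioi (c ^ 2)) :=
    ((integrableOn_one_div_mul_sqrt_sub hc).const_mul _).const_mul _
  have hpt : ∀ t, c ^ 2 < t → Tendsto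
      (fun a => t / √(t * (t - a ^ 2) * (t - b ^ 2) * (t - c ^ 2)) - 1 / t) (𝓝[>] 0)
      (𝓝 (1 / √((t - b ^ 2) * (t - c ^ 2)) - 1 / t)) := by
    intro t ht
    have ht0 : 0 < t := lt_trans (by positivity) ht
    have p2 : 0 < t - b ^ 2 := by linarith
    have p3 : 0 < t - c ^ 2 := by linarith
    have hs := Real.sqrt_pos.mpr (mul_pos p2 p3)
    have e : √(t * (t - 0 ^ 2) * (t - b ^ 2) * (t - c ^ 2)) =
        t * √((t - b ^ 2) * (t - c ^ 2)) := by
      rw [show t * (t - 0 ^ 2) * (t - b ^ 2) * (t - c ^ 2) =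
        t ^ 2 * ((t - b ^ 2) * (t - c ^ 2)) by ring, Real.sqrt_mul (by positivity),
        Real.sqrt_sq ht0.le]
    have h := tendsto_param_zero (f := fun a => √(t * (t - a ^ 2) * (t - b ^ 2) * (t - c ^ 2)))
      (by fun_prop)
    rw [e] at h
    have h3 := ((tendsto_const_nhds (x := t)).div h (by positivity)).sub_const (1 / t)
    rwa [show t / (t * √((t - b ^ 2) * (t - c ^ 2))) = 1 / √((t - b ^ 2) * (t - c ^ 2)) by
      field_simp] at h3
  have hev : ∀ᶠ a in 𝓝[>] (0 : ℝ), ∀ᵐ t ∂(volume.restrict (Ioi (c ^ 2))),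
      ‖t / √(t * (t - a ^ 2) * (t - b ^ 2) * (t - c ^ 2)) - 1 / t‖ ≤
        (b ^ 2 + c ^ 2) * (c / (c ^ 2 - b ^ 2) * (1 / (t * √(t - c ^ 2)))) := by
    filter_upwards [eventually_mem_Ioo_param hb] with a ha
    filter_upwards [ae_restrict_mem measurableSet_Ioi] with t ht
    exact abs_Fminus_integrand_le ha.1 ha.2 hbc ht
  have hint : IntegrableOn (fun t => 1 / √((t - b ^ 2) * (t - c ^ 2)) - 1 / t) (Ioi (c ^ 2)) := by
    refine Integrable.mono' hbd (Measurable.aestronglyMeasurable (by fun_prop)) ?_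
    filter_upwards [ae_restrict_mem measurableSet_Ioi] with t ht
    refine le_of_tendsto (hpt t ht).norm ?_
    filter_upwards [eventually_mem_Ioo_param hb] with a ha
    exact abs_Fminus_integrand_le ha.1 ha.2 hbc ht
  have h := tendsto_integral_filter_of_dominated_convergence _
    (Eventually.of_forall fun a => Measurable.aestronglyMeasurable (by fun_prop)) hev hbd
    (by filter_upwards [ae_restrict_mem measurableSet_Ioi] with t ht using hpt t ht)
  rw [integral_Fminus_zero hb hbc hint] at h
  have h3 := h.const_mul (1 / 2)
  rwa [← mul_assoc, one_div_mul_cancel two_ne_zero, one_mul] at h3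

/-- Since -2i · ic = 2c, the limit is 2c exp(-lim F₋) = √(c² - b²). -/
lemma tendsto_K0 (hb : 0 < b) (hbc : b < c) :
    Tendsto (fun a => -2 * Complex.I * K0 a b c) (𝓝[>] 0) (𝓝 (√(c ^ 2 - b ^ 2) : ℝ)) := by
  have hc : 0 < c := hb.trans hbc
  have h2 : 0 < √(c ^ 2 - b ^ 2) := Real.sqrt_pos.mpr (by nlinarith)
  obtain ⟨M, hM⟩ := exists_delta_bound hb hbc
  have hD : Tendsto (fun a => Dminus a b c * delta a b c) (𝓝[>] 0) (𝓝 0) :=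
    bdd_le_mul_tendsto_zero' M hM (tendsto_Dminus hb hbc) |>.congr fun a => mul_comm _ _
  have h := (Real.continuous_exp.tendsto _).comp (hD.sub (tendsto_Fminus hb hbc))
  rw [zero_sub, Real.exp_neg, Real.exp_log (by positivity)] at h
  have h3 := ((Complex.continuous_ofReal.tendsto _).comp (h.const_mul (2 * c)))
  rw [show 2 * c * (2 * c / √(c ^ 2 - b ^ 2))⁻¹ = √(c ^ 2 - b ^ 2) by field_simp] at h3
  refine h3.congr fun a => ?_
  simp only [Function.comp, K0]
  push_cast
  linear_combination (2 * c * Complex.exp (Dminus a b c * delta a b c - Fminus a b c)) *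
    Complex.I_sq

end Limits

/-! ### The limit of the two-phase solution -/

section TwoPhaseLimit

variable {b c : ℝ}

lemma continuousAt_theta2 (z : ℂ) {τ : ℂ} (hτ : 0 < τ.im) :
    ContinuousAt (fun p : ℂ × ℂ => theta2 p.1 p.2) (z, τ) := by
  have h : ContinuousAt (fun p : ℂ × ℂ => jacobiTheta₂ (p.1 + p.2 / 2) p.2) (z, τ) :=
    ContinuousAt.comp (x := (z, τ)) (f := fun p : ℂ × ℂ => (p.1 + p.2 / 2, p.2))
      (g := fun p : ℂ × ℂ => jacobiTheta₂ p.1 p.2)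
      (continuousAt_jacobiTheta₂ (z + τ / 2) hτ) (by fun_prop)
  unfold theta2
  exact ContinuousAt.mul (by fun_prop) h

lemma tendsto_theta3 {ι : Type*} {l : Filter ι} {u τ : ι → ℂ} {u₀ τ₀ : ℂ} (hτ : 0 < τ₀.im)
    (hu : Tendsto u l (𝓝 u₀)) (ht : Tendsto τ l (𝓝 τ₀)) :
    Tendsto (fun i => theta3 (u i) (τ i)) l (𝓝 (theta3 u₀ τ₀)) :=
  Tendsto.comp (g := fun p : ℂ × ℂ => theta3 p.1 p.2) (f := fun i => (u i, τ i))
    (continuousAt_jacobiTheta₂ u₀ hτ) (hu.prodMk_nhds ht)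

lemma tendsto_theta2 {ι : Type*} {l : Filter ι} {u τ : ι → ℂ} {u₀ τ₀ : ℂ} (hτ : 0 < τ₀.im)
    (hu : Tendsto u l (𝓝 u₀)) (ht : Tendsto τ l (𝓝 τ₀)) :
    Tendsto (fun i => theta2 (u i) (τ i)) l (𝓝 (theta2 u₀ τ₀)) :=
  Tendsto.comp (g := fun p : ℂ × ℂ => theta2 p.1 p.2) (f := fun i => (u i, τ i))
    (continuousAt_theta2 u₀ hτ) (hu.prodMk_nhds ht)

lemma theta3_add_one (u τ : ℂ) : theta3 (u + 1) τ = theta3 u τ := jacobiTheta₂_add_left u τ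

/-- The sum is ϑ₃(u/2 | iy), which is positive on the real axis. -/
lemma theta3_add_theta2_ne_zero {y : ℝ} (hy : 0 < y) (u : ℝ) :
    theta3 u (Complex.I * ((4 * y : ℝ) : ℂ)) + theta2 u (Complex.I * ((4 * y : ℝ) : ℂ)) ≠ 0 := by
  have h := jacobiTheta₂_eq_add_theta2 ((u / 2 : ℝ) : ℂ) (im_I_mul_pos hy)
  rw [show 2 * ((u / 2 : ℝ) : ℂ) = u by push_cast; ring,
    show 4 * (Complex.I * (y : ℂ)) = Complex.I * ((4 * y : ℝ) : ℂ) by push_cast; ring] at h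
  rw [theta3, ← h]
  exact jacobiTheta₂_real_ne_zero hy _

lemma tendsto_twoPhase (hb : 0 < b) (hbc : b < c) (lam0 Z₁ Z₂ : ℝ) {K₁ K₂ : ℝ → ℂ} {L₁ L₂ : ℂ}
    (h1 : Tendsto K₁ (𝓝[>] 0) (𝓝 L₁)) (h2 : Tendsto K₂ (𝓝[>] 0) (𝓝 L₂)) (x t : ℝ) :
    Tendsto (fun a => twoPhase a b c lam0 Z₁ Z₂ (K₁ a) (K₂ a) x t) (𝓝[>] 0)
      (𝓝 (onePhase b c lam0 Z₂ L₁ L₂ x t)) := by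
  obtain ⟨y, hy, hfrb, hA, -⟩ := exists_thetaQuot_periods hb hbc
  obtain ⟨M, hM⟩ := exists_delta_bound hb hbc
  set u₁ : ℝ → ℝ := fun a => kappa1 a b c * t + 2 * Z₁
  set u₂ : ℝ → ℝ := fun a => waveNumber a b c * x + kappa2 a b c lam0 * t + 2 * Z₂
  have hu₂ : Tendsto (fun a => ((u₂ a : ℝ) : ℂ)) (𝓝[>] 0) (𝓝 ((u₂ 0 : ℝ) : ℂ)) := by
    refine (Complex.continuous_ofReal.tendsto _).comp ?_
    have hlim := tendsto_Aplus hb hbc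
    exact (((tendsto_const_nhds.div hlim hA.ne').mul_const x).add
      ((tendsto_const_nhds.div hlim hA.ne').mul_const t)).add_const _
  have hτ : Tendsto (fun a => 2 * Complex.I * (frbPlus a b c : ℂ)) (𝓝[>] 0)
      (𝓝 (2 * Complex.I * (frbPlus 0 b c : ℂ))) :=
    ((Complex.continuous_ofReal.tendsto _).comp (tendsto_frbPlus hb hbc hA)).const_mul _
  have hτ0 : 2 * Complex.I * (frbPlus 0 b c : ℂ) = Complex.I * ((4 * y : ℝ) : ℂ) := by
    rw [hfrb]
    push_cast
    ring
  have him : 0 < (2 * Complex.I * (frbPlus 0 b c : ℂ)).im := by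
    rw [hτ0]
    exact im_I_mul_pos (by positivity)
  have T3 := tendsto_theta3 him hu₂ hτ
  have T2 := tendsto_theta2 him hu₂ hτ
  have hB : Tendsto (fun a => 2 * frbMinus a b c) (𝓝[>] 0) atTop :=
    (tendsto_frbMinus hb hbc).const_mul_atTop two_pos
  have e : ∀ a, Complex.I * ((2 * frbMinus a b c : ℝ) : ℂ) = 2 * Complex.I * frbMinus a b c :=
    fun a => by push_cast; ring
  -- The limit of u₁ itself plays no role; only its imaginary part must stay bounded, with and
  -- without the shift iδ.
  have hi : ∀ᶠ a in 𝓝[>] (0 : ℝ), |((u₁ a : ℝ) : ℂ).im| ≤ 0 :=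
    Eventually.of_forall fun a => by simp
  have hi' : ∀ᶠ a in 𝓝[>] (0 : ℝ), |(((u₁ a : ℝ) : ℂ) + Complex.I * delta a b c).im| ≤ M :=
    hM.mono fun a ha => by simpa using ha
  have S3 := tendsto_jacobiTheta₂_one hB hi
  have S2 := tendsto_theta2_zero hB hi
  have S3' := tendsto_jacobiTheta₂_one hB hi'
  have S2' := tendsto_theta2_zero hB hi'
  simp only [e] at S3 S2 S3' S2'
  have hden := (((S3.mul T3).add (S2.mul T3)).add (S3.mul T2)).sub (S2.mul T2)
  -- Signs as in H after u₂ ↦ u₂ + 1, which negates every ϑ₂ in the second variable.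
  have hnum := (((S3'.mul T3).sub (S3'.mul T2)).add (S2'.mul T3)).add (S2'.mul T2)
  have hne : theta3 (u₂ 0) (2 * Complex.I * frbPlus 0 b c) +
      theta2 (u₂ 0) (2 * Complex.I * frbPlus 0 b c) ≠ 0 := by
    rw [hτ0]
    exact theta3_add_theta2_ne_zero hy _
  simp only [one_mul, zero_mul, add_zero, sub_zero] at hden hnum
  have hexp : Tendsto
      (fun a => Complex.exp (2 * Complex.I * K₁ a * x + 2 * Complex.I * K₂ a * t)) (𝓝[>] 0)
      (𝓝 (Complex.exp (2 * Complex.I * (L₁ * x + L₂ * t)))) := by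
    rw [show 2 * Complex.I * (L₁ * x + L₂ * t) =
      2 * Complex.I * L₁ * x + 2 * Complex.I * L₂ * t by ring]
    exact (Complex.continuous_exp.tendsto _).comp
      (((h1.const_mul _).mul_const _).add ((h2.const_mul _).mul_const _))
  refine (((tendsto_K0 hb hbc).mul (hnum.div hden hne)).mul hexp).congr fun a => ?_
  simp only [twoPhase, H, theta3_add_one, theta2_add_one]
  simp only [theta3, u₁, u₂, Pi.div_apply]
  ring

end TwoPhaseLimit

end TwoPhaseNLS

end

/-! ### Assembly of the theorem -/

theorem mainTheorem4 (b c lam0 Z₁ Z₂ : ℝ) (hb : 0 < b) (hbc : b < c) :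
    -- the constants `K₁`, `K₂` of the two-phase solution are well defined
    (∀ a ∈ Set.Ioo 0 b,
      (∃! K : ℂ, TwoPhaseNLS.IsK1 a b c lam0 K) ∧ (∃! K : ℂ, TwoPhaseNLS.IsK2 a b c lam0 K)) ∧
    -- the limit of the two-phase solution as `a → 0+`
    (∀ K₁ K₂ : ℝ → ℂ,
      (∀ a ∈ Set.Ioo 0 b,
        TwoPhaseNLS.IsK1 a b c lam0 (K₁ a) ∧ TwoPhaseNLS.IsK2 a b c lam0 (K₂ a)) →
      Filter.Tendsto K₁ (nhdsWithin 0 (Set.Ioi 0)) (nhds (-lam0 : ℂ)) ∧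
      Filter.Tendsto K₂ (nhdsWithin 0 (Set.Ioi 0)) (nhds (b ^ 2 + c ^ 2 - 2 * lam0 ^ 2 : ℂ)) ∧
      ∀ x t : ℝ, Filter.Tendsto
        (fun a => TwoPhaseNLS.twoPhase a b c lam0 Z₁ Z₂ (K₁ a) (K₂ a) x t)
        (nhdsWithin 0 (Set.Ioi 0))
        (nhds (TwoPhaseNLS.onePhase b c lam0 Z₂ (-lam0) (b ^ 2 + c ^ 2 - 2 * lam0 ^ 2) x t))) ∧
    -- the limit in terms of the Jacobi function `dn`
    (∃ A ϰ x₀ : ℝ, A = b + c ∧ ϰ = 2 * √(b * c) / (b + c) ∧ 0 < ϰ ∧ ϰ < 1 ∧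
      A = √(2 * (b ^ 2 + c ^ 2) / (2 - ϰ ^ 2)) ∧
      x₀ = (1 / 2 - Z₂) * TwoPhaseNLS.Aplus 0 b c ∧
      ∀ x t : ℝ,
        TwoPhaseNLS.onePhase b c lam0 Z₂ (-lam0) (b ^ 2 + c ^ 2 - 2 * lam0 ^ 2) x t =
          (A * TwoPhaseNLS.dn (A * (x + 4 * lam0 * t - x₀)) ϰ : ℝ) *
            Complex.exp (-2 * Complex.I * lam0 * x
              + 2 * Complex.I * (b ^ 2 + c ^ 2 - 2 * lam0 ^ 2) * t)) ∧
    -- the limit solves the focusing nonlinear Schrödinger equation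
    TwoPhaseNLS.SolvesNLS
      (TwoPhaseNLS.onePhase b c lam0 Z₂ (-lam0) (b ^ 2 + c ^ 2 - 2 * lam0 ^ 2)) := by
  have hc : 0 < c := hb.trans hbc
  refine ⟨fun a ha => ⟨?_, ?_⟩, fun K₁ K₂ hK => ?_, ?_, ?_⟩
  · exact ⟨_, TwoPhaseNLS.isK1_neg ha.1 ha.2 hbc lam0,
      fun K h => TwoPhaseNLS.IsAbelianConstant.unique ha.1 ha.2 hbc h
        (TwoPhaseNLS.isK1_neg ha.1 ha.2 hbc lam0)⟩
  · obtain ⟨q, -, hq⟩ := TwoPhaseNLS.exists_isK2 ha.1 ha.2 hbc lam0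
    exact ⟨_, hq, fun K h => TwoPhaseNLS.IsAbelianConstant.unique ha.1 ha.2 hbc h hq⟩
  · have h1 : Filter.Tendsto K₁ (nhdsWithin 0 (Set.Ioi 0)) (nhds (-lam0 : ℂ)) := by
      refine tendsto_const_nhds.congr' ?_
      filter_upwards [TwoPhaseNLS.eventually_mem_Ioo_param hb] with a ha
      exact TwoPhaseNLS.IsAbelianConstant.unique ha.1 ha.2 hbc
        (TwoPhaseNLS.isK1_neg ha.1 ha.2 hbc lam0) (hK a ha).1
    have h2 := TwoPhaseNLS.tendsto_of_isK2 hb hbc lam0 fun a ha => (hK a ha).2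
    exact ⟨h1, h2, TwoPhaseNLS.tendsto_twoPhase hb hbc lam0 Z₁ Z₂ h1 h2⟩
  · have hs : √(b * c) ^ 2 = b * c := Real.sq_sqrt (by positivity)
    have hs0 : 0 < √(b * c) := Real.sqrt_pos.mpr (by positivity)
    -- Here 2 - ϰ² = 2(b² + c²)/(b + c)², which also gives the second expression for A.
    have hk : 0 < 2 - (2 * √(b * c) / (b + c)) ^ 2 := by
      rw [div_pow, mul_pow, hs, sub_pos, div_lt_iff₀ (by positivity)]
      nlinarith [sq_nonneg (b - c)]
    refine ⟨b + c, 2 * √(b * c) / (b + c), (1 / 2 - Z₂) * TwoPhaseNLS.Aplus 0 b c, rfl, rfl,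
      by positivity, ?_, ?_, rfl, fun x t => ?_⟩
    · rw [div_lt_one (by positivity)]
      nlinarith [sq_pos_of_pos (sub_pos.mpr hbc)]
    · symm
      rw [Real.sqrt_eq_iff_mul_self_eq (by positivity) (by positivity), div_eq_iff hk.ne', div_pow,
        mul_pow, hs]
      field_simp
      ring
    · rw [TwoPhaseNLS.onePhase_eq_dn hb hbc]
      congr 2
      ring
  · exact TwoPhaseNLS.solvesNLS_onePhase hb hbc lam0 Z₂
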